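/- \textbf{Conventions.} Fix $\alpha>1$. A \emph{Lorenz map} is a map $f:[0,1]\setminus\{c\}\to[0,1]$ of the form \[ f(x)=\begin{cases} f_-(x)=\phi_-\Big(u\big(1-(\tfrac{c-x}{c})^{\alpha}\big)\Big), & x\in[0,c),\\[2pt] f_+(x)=\phi_+\Big(1+v\big(-1+(\tfrac{x-c}{1-c})^{\alpha}\big)\Big), & x\in(c,1],\end{cases} \] with $c=\operatorname{crit}(f)\in(0,1)$, $u,v\in[0,1]$, and increasing $C^3$ diffeomorphisms $\phi_\pm$ of $[0,1]$ (the diffeomorphic parts) with Schwarzian derivative $\le 0$. The branches $f_\pm$ are extended continuously to $c$. The map is \emph{nontrivial} if $f_+(c)<c<f_-(c)$ and \emph{full} if $f_-(c)=1$, $f_+(c)=0$. All Lorenz maps have $0$ and $1$ as their only fixed points. The map is $\delta$-close to standard maps if $\phi_\pm$ have $C^2$-distance at most $\delta$ to the identity. The \emph{renormalization} $\mathcal Rf$ is the first-return map of $f$ to $C$, affinely rescaled to $[0,1]$, where $C\subsetneq[0,1]$ is the largest closed interval with $c$ in its interior whose first-return map is (after rescaling) a nontrivial Lorenz map with exponent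 $\alpha$. The map $f$ is \emph{$(a,b)$-renormalizable}, $a,b\ge1$, if such a $C$ exists, the points of $C^-=C\cap[0,c)$ return to $C$ at time $a+1$ and are to the right of $c$ at times $1,\dots,a$, and the points of $C^+=C\cap(c,1]$ return to $C$ at time $b+1$ and are to the left of $c$ at times $1,\dots,b$. A \emph{family} is a map $t\mapsto F_t$ from a compact simply connected set $U\subset\mathbb R^2$ to Lorenz maps, all nontrivial except that on $\partial U$ maps with a trivial branch ($f_-(c)=c$ or $f_+(c)=c$, and $f_+(c)\le c\le f_-(c)$) are allowed. It is \emph{analytic} if $c,u,v$ and $\phi_\pm$ (as elements of $C^3([0,1])$) are real-analytic functions of $t$ which extend analytically to a neighbourhood of $U$. An $(a,b)$-\emph{island} is the closure of a connected component of the interior of $\{t\in U: F_t\text{ is }(a,b)\text{-renormalizable}\}$. A \emph{full vertex} of an $(a,b)$-island $D$ is a map $F_t$, $t\in D$, that is $(a,b)$-renormalizable and whose renormalization is full. \textbf{Statement.} For every $\alpha>1$ there is $\delta>0$ such that the following holds. Let $F$ be an analytic family of Lorenz maps on $U$, all of them $\delta$-close to standard maps, with a unique parameter $\hat t\in U$ for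 which $\hat f=F_{\hat t}$ is full. Assume moreover that this uniqueness persists analytically: near $\hat t$, the set $U$ is contained in a closed semianalytic set $S$ (a finite union of sets $\{g_1\ge0,\dots,g_n\ge0\}$ with $g_j$ real-analytic near $\hat t$) in which $\hat t$ is still the only solution of $u=v=1$, where $u,v$ denote analytic extensions of the parameters $u,v$ to a neighbourhood of $\hat t$. (For instance $U$ itself is semianalytic, such as a rectangle; or $\hat t$ is an isolated solution of $u=v=1$ in the plane.) Put $\hat c=\operatorname{crit}(\hat f)$. Then there is $\gamma>0$ such that for every $\epsilon>0$ and $K>0$ there is $N\ge1$ such that for all $a,b\ge N$ with $\frac1K\le\frac ab\le K$, every $(a,b)$-island $D_{a,b}$ and every full vertex $f_{a,b}$ of $D_{a,b}$, \[ 1-\epsilon\ \le\ \frac{c'}{1-c'}\left(\frac{\hat c}{1-\hat c}\left(\gamma\,\frac{D\hat f(0)^b}{D\hat f(1)^a}\right)^{1/\alpha}\right)^{-1}\le\ 1+\epsilon,\qquad c'=\operatorname{crit}(\mathcal R f_{a,b}). \] -/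

import Mathlib

open Set Filter Topology

noncomputable section

/-- The `k`-th derivative on the interval `[0,1]` (one-sided at the endpoints). -/
def iD (k : ℕ) (φ : ℝ → ℝ) (x : ℝ) : ℝ := iteratedDerivWithin k φ (Icc (0 : ℝ) 1) x

/-- The Schwarzian derivative on `[0,1]`. -/
def schwarzian (φ : ℝ → ℝ) (x : ℝ) : ℝ :=
  iD 3 φ x / iD 1 φ x - 3 / 2 * (iD 2 φ x / iD 1 φ x) ^ 2

/-- Increasing `C^3` diffeomorphisms of `[0,1]` with negative Schwarzian derivative. The
inequality is not strict, so that the identity (the diffeomorphic part of a standard Lorenz map)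
is included. Only the values of `φ` on `[0,1]` matter. -/
structure IsDiffeoPart (φ : ℝ → ℝ) : Prop where
  contDiff : ContDiffOn ℝ 3 φ (Icc 0 1)
  map_zero : φ 0 = 0
  map_one : φ 1 = 1
  deriv_pos : ∀ x ∈ Icc (0 : ℝ) 1, 0 < iD 1 φ x
  schwarzian_nonpos : ∀ x ∈ Icc (0 : ℝ) 1, schwarzian φ x ≤ 0

/-- A Lorenz map on `[0,1]` with critical exponent `α`: a standard Lorenz map with critical point
`c` and critical values `u`, `1 - v`, followed on the two branches by the diffeomorphic parts
`φm` (left) and `φp` (right). -/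
structure LorenzMap (α : ℝ) where
  c : ℝ
  u : ℝ
  v : ℝ
  φm : ℝ → ℝ
  φp : ℝ → ℝ
  c_mem : c ∈ Ioo (0 : ℝ) 1
  u_mem : u ∈ Icc (0 : ℝ) 1
  v_mem : v ∈ Icc (0 : ℝ) 1
  φm_diffeo : IsDiffeoPart φm
  φp_diffeo : IsDiffeoPart φp

namespace LorenzMap

variable {α : ℝ}

/-- The left branch `f₋ : [0,c] → [0,1]`. -/
def left (f : LorenzMap α) (x : ℝ) : ℝ :=
  f.φm (f.u * (1 - ((f.c - x) / f.c) ^ α))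

/-- The right branch `f₊ : [c,1] → [0,1]`. -/
def right (f : LorenzMap α) (x : ℝ) : ℝ :=
  f.φp (1 + f.v * (-1 + ((x - f.c) / (1 - f.c)) ^ α))

/-- The map itself; its domain is `[0,1] \ {c}`, and the value given at `c` is never used. -/
def toFun (f : LorenzMap α) (x : ℝ) : ℝ := if x < f.c then f.left x else f.right x

/-- Both branches contain the critical point in the interior of their image. -/
def Nontrivial (f : LorenzMap α) : Prop := f.right f.c < f.c ∧ f.c < f.left f.c

/-- Both branches are onto `[0,1]`. -/
def IsFull (f : LorenzMap α) : Prop := f.left f.c = 1 ∧ f.right f.c = 0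

/-- At least one branch is trivial (`f₋([0,c]) = [0,c]` or `f₊([c,1]) = [c,1]`), and the map is
otherwise a limit case of a nontrivial map. -/
def HasTrivialBranch (f : LorenzMap α) : Prop :=
  f.right f.c ≤ f.c ∧ f.c ≤ f.left f.c ∧ (f.left f.c = f.c ∨ f.right f.c = f.c)

/-- The only fixed points are `0` and `1`. -/
def OnlyFixesEndpoints (f : LorenzMap α) : Prop :=
  ∀ x ∈ Icc (0 : ℝ) 1, x ≠ f.c → f.toFun x = x → x = 0 ∨ x = 1

/-- `C^2`-distance of both diffeomorphic parts to the identity at most `δ`. -/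
def CloseToStandard (f : LorenzMap α) (δ : ℝ) : Prop :=
  ∀ φ ∈ ({f.φm, f.φp} : Set (ℝ → ℝ)), ∀ x ∈ Icc (0 : ℝ) 1,
    |φ x - x| ≤ δ ∧ |iD 1 φ x - 1| ≤ δ ∧ |iD 2 φ x| ≤ δ

/-- `C = [l,r]` is a closed interval, properly contained in `[0,1]`, with the critical point of `f`
in its interior, and the first-return map of `f` to `C`, affinely rescaled to `[0,1]`, is the
nontrivial Lorenz map `g`. -/
structure IsReturnMap (f : LorenzMap α) (l r : ℝ) (g : LorenzMap α) : Prop where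
  l_nonneg : 0 ≤ l
  r_le_one : r ≤ 1
  proper : ¬ (l = 0 ∧ r = 1)
  l_lt : l < f.c
  lt_r : f.c < r
  nontrivial : g.Nontrivial
  fixes : g.OnlyFixesEndpoints
  crit : g.c = (f.c - l) / (r - l)
  firstReturn : ∀ x ∈ Icc l r, x ≠ f.c → ∃ n : ℕ, 0 < n ∧ f.toFun^[n] x ∈ Icc l r ∧
    (∀ m : ℕ, 0 < m → m < n → f.toFun^[m] x ∉ Icc l r) ∧
    (f.toFun^[n] x - l) / (r - l) = g.toFun ((x - l) / (r - l))

/-- `g` is the renormalization of `f`, with return interval `C = [l,r]`, the largest possible. -/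
def IsRenormalization (f : LorenzMap α) (l r : ℝ) (g : LorenzMap α) : Prop :=
  f.IsReturnMap l r g ∧
    ∀ (l' r' : ℝ) (g' : LorenzMap α), f.IsReturnMap l' r' g' → Icc l' r' ⊆ Icc l r

/-- Monotone type with return times `a + 1`, `b + 1`: after the first step, `[l,c)` stays to the
right of the critical point until it returns at time `a + 1`, and `(c,r]` stays to the left of the
critical point until it returns at time `b + 1`. -/
def IsMonotoneType (f : LorenzMap α) (l r : ℝ) (a b : ℕ) : Prop :=
  1 ≤ a ∧ 1 ≤ b ∧
  (∀ x ∈ Ico l f.c, f.toFun^[a + 1] x ∈ Icc l r ∧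
    ∀ i : ℕ, 1 ≤ i → i ≤ a → f.toFun^[i] x ∉ Icc l r ∧ f.c < f.toFun^[i] x) ∧
  (∀ x ∈ Ioc f.c r, f.toFun^[b + 1] x ∈ Icc l r ∧
    ∀ i : ℕ, 1 ≤ i → i ≤ b → f.toFun^[i] x ∉ Icc l r ∧ f.toFun^[i] x < f.c)

/-- `f` is `(a,b)`-renormalizable with renormalization `g`. -/
def RenormalizesTo (f : LorenzMap α) (a b : ℕ) (g : LorenzMap α) : Prop :=
  ∃ l r : ℝ, f.IsRenormalization l r g ∧ f.IsMonotoneType l r a b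

end LorenzMap

/-- A family of Lorenz maps with parameter set `U`. Maps with a trivial branch are allowed on the
boundary of `U`; all other maps are nontrivial. Only the values of `F` on `U` matter. -/
structure IsLorenzFamily {α : ℝ} (U : Set (ℝ × ℝ)) (F : ℝ × ℝ → LorenzMap α) : Prop where
  compact : IsCompact U
  simplyConnected : SimplyConnectedSpace U
  fixes : ∀ t ∈ U, (F t).OnlyFixesEndpoints
  nontrivial : ∀ t ∈ U, (F t).Nontrivial ∨ (t ∈ frontier U ∧ (F t).HasTrivialBranch)

/-- `t ↦ h t` is real-analytic on `U`, i.e. it extends analytically to a neighbourhood of `U`. -/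
def AnalyticParam {E : Type*} [NormedAddCommGroup E] [NormedSpace ℝ E]
    (U : Set (ℝ × ℝ)) (h : ℝ × ℝ → E) : Prop :=
  ∃ H : ℝ × ℝ → E, AnalyticOnNhd ℝ H U ∧ EqOn H h U

/-- `t ↦ φ t` is real-analytic on `U` as a map into `C^3([0,1])`: the derivatives of order at most
three are analytic as maps into `C([0,1])`. -/
def AnalyticDiffeoParam (U : Set (ℝ × ℝ)) (φ : ℝ × ℝ → ℝ → ℝ) : Prop :=
  ∀ k ≤ 3, ∃ J : ℝ × ℝ → C(Icc (0 : ℝ) 1, ℝ), AnalyticOnNhd ℝ J U ∧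
    ∀ t ∈ U, ∀ x : Icc (0 : ℝ) 1, J t x = iD k (φ t) x

/-- The family depends analytically on the parameter. -/
structure IsAnalyticFamily {α : ℝ} (U : Set (ℝ × ℝ)) (F : ℝ × ℝ → LorenzMap α) : Prop where
  c : AnalyticParam U fun t => (F t).c
  u : AnalyticParam U fun t => (F t).u
  v : AnalyticParam U fun t => (F t).v
  φm : AnalyticDiffeoParam U fun t => (F t).φm
  φp : AnalyticDiffeoParam U fun t => (F t).φp

/-- `p` is the unique parameter in `U` whose map is full. -/
def IsUniqueFull {α : ℝ} (U : Set (ℝ × ℝ)) (F : ℝ × ℝ → LorenzMap α) (p : ℝ × ℝ) : Prop :=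
  p ∈ U ∧ (F p).IsFull ∧ ∀ t ∈ U, (F t).IsFull → t = p

/-- Near `p`, the set `S` is a finite union of sets `{g₁ ≥ 0, …, gₙ ≥ 0}`, `gⱼ` analytic. -/
def IsClosedSemianalyticAt (S : Set (ℝ × ℝ)) (p : ℝ × ℝ) : Prop :=
  ∃ (m n : ℕ) (g : Fin m → Fin n → ℝ × ℝ → ℝ), (∀ i j, AnalyticAt ℝ (g i j) p) ∧
    ∀ᶠ z in 𝓝 p, z ∈ S ↔ ∃ i, ∀ j, 0 ≤ g i j z

/-- The full map is unique in the analytic sense: near `p` the parameter set lies in a closed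
semianalytic set `S` on which `p` is still the only solution of `u = v = 1`, where `u`, `v` are
continued analytically beyond `U`. This holds if `p` is an isolated solution of `u = v = 1` in the
plane (take `S` to be the plane), and also if `p` is the unique full parameter in `U` and `U` itself
is closed semianalytic at `p`, such as a rectangle (take `S = U`). -/
def IsAnalyticallyUniqueFull {α : ℝ} (U : Set (ℝ × ℝ)) (F : ℝ × ℝ → LorenzMap α)
    (p : ℝ × ℝ) : Prop :=
  ∃ (S : Set (ℝ × ℝ)) (u v : ℝ × ℝ → ℝ), U ⊆ S ∧ IsClosedSemianalyticAt S p ∧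
    AnalyticAt ℝ u p ∧ AnalyticAt ℝ v p ∧
    (∀ t ∈ U, u t = (F t).u ∧ v t = (F t).v) ∧
    ∀ᶠ z in 𝓝 p, z ∈ S → u z = 1 → v z = 1 → z = p

/-- The `(a,b)`-archipelago. -/
def archipelago {α : ℝ} (U : Set (ℝ × ℝ)) (F : ℝ × ℝ → LorenzMap α) (a b : ℕ) :
    Set (ℝ × ℝ) :=
  {t ∈ U | ∃ g, (F t).RenormalizesTo a b g}

/-- An `(a,b)`-island: the closure of a connected component of the interior of the archipelago. -/
def IsIsland {α : ℝ} (U : Set (ℝ × ℝ)) (F : ℝ × ℝ → LorenzMap α) (a b : ℕ)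
    (D : Set (ℝ × ℝ)) : Prop :=
  ∃ t ∈ interior (archipelago U F a b),
    D = closure (connectedComponentIn (interior (archipelago U F a b)) t)

/-- `t` is a full vertex of the `(a,b)`-island `D`, and `g` is the renormalization of `F t`, which
is a full map. -/
def IsFullVertex {α : ℝ} (U : Set (ℝ × ℝ)) (F : ℝ × ℝ → LorenzMap α) (a b : ℕ)
    (D : Set (ℝ × ℝ)) (t : ℝ × ℝ) (g : LorenzMap α) : Prop :=
  t ∈ D ∧ t ∈ U ∧ (F t).RenormalizesTo a b g ∧ g.IsFull

end

/-!
Let `[l, r]` be the return interval of a full renormalization of type `(a, b)` of a map `f`, and put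
`s = (r - c) / (1 - c)` and `s' = (c - l) / c`. The first step maps `(c, r]` onto an interval of
length of order `s ^ α` at the end point `0`, and the next `b` steps expand it to `[l, r]`. These
follow a long orbit segment which leaves a neighbourhood of `0` along a fixed backward orbit of `c`,
so `r - l = P' * s ^ α * Df(0) ^ b`, where `P'` has a positive limit as `b → ∞`. In the same way
`r - l = P * s' ^ α * Df(1) ^ a`. The quotient of the two formulas determines `s' / s`, and hence
the critical point of the renormalization.

As `a, b → ∞`, the parameters converge to that of the full map. If a limit map has
`c < f₋(c) < 1`, then iterating `f₊`, which has no fixed points in `(c, 1)`, brings the critical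
value below `c` after boundedly many steps; and if both branches of the limit are trivial, then each
of the gaps `f₋(c) - c` and `c - f₊(c)` along the sequence is at most of the order of the power `α`
of the other, although both tend to zero.

Finally `Df(0) ^ b` and `Df(1) ^ a` have to be replaced by the same powers for the full map. As
`1 - u` and `1 - v` are exponentially small in `a` and `b`, it suffices to bound a power of the
distance to the full parameter by `(1 - u) + (1 - v)` on the semianalytic set `S`. If this
Łojasiewicz inequality failed, a sequence in `S` would have contact of infinite order with a Puiseux
arc on which `u = v = 1`, and this arc would be contained in `S`.
-/

open Asymptotics

/-! ### Analytic functions of two variables -/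

section ParametricIntegral

variable {E F G : Type*} [NormedAddCommGroup E] [NormedSpace ℝ E] [NormedAddCommGroup F]
  [NormedSpace ℝ F] [NormedAddCommGroup G] [NormedSpace ℝ G]

theorem norm_compContinuousLinearMap_le_of_norm_le_one {n : ℕ}
    (f : ContinuousMultilinearMap ℝ (fun _ : Fin n => F) G) {A : E →L[ℝ] F} (hA : ‖A‖ ≤ 1) :
    ‖f.compContinuousLinearMap fun _ => A‖ ≤ ‖f‖ :=
  (f.norm_compContinuousLinearMap_le _).trans <| mul_le_of_le_one_right (norm_nonneg _) <|
    Finset.prod_le_one (fun _ _ => norm_nonneg _) fun _ _ => hA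

theorem continuous_compContinuousLinearMap {n : ℕ}
    (f : ContinuousMultilinearMap ℝ (fun _ : Fin n => F) G) {A : ℝ → E →L[ℝ] F}
    (hA : Continuous A) : Continuous fun t => f.compContinuousLinearMap fun _ => A t :=
  ((ContinuousMultilinearMap.compContinuousLinearMapContinuousMultilinear ℝ
    (fun _ : Fin n => E) (fun _ : Fin n => F) G).cont.comp
      (continuous_pi fun _ => hA)).clm_apply continuous_const

variable {A : ℝ → E →L[ℝ] F} {w : ℝ → ℝ}

theorem hasSum_intervalIntegral_comp_clm {R : F → G} {p : FormalMultilinearSeries ℝ F G}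
    {r : ENNReal} (hR : HasFPowerSeriesOnBall R p 0 r) (hA : Continuous A)
    (hA1 : ∀ t ∈ Icc (0 : ℝ) 1, ‖A t‖ ≤ 1) (hw : Continuous w)
    (hw1 : ∀ t ∈ Icc (0 : ℝ) 1, ‖w t‖ ≤ 1) {y : E} (hy : ‖y‖ₑ < r) :
    HasSum (fun n => ∫ t in (0 : ℝ)..1, w t • p n fun _ => A t y)
      (∫ t in (0 : ℝ)..1, w t • R (A t y)) := by
  have hAy : ∀ t ∈ Icc (0 : ℝ) 1, ‖A t y‖ ≤ ‖y‖ := fun t ht =>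
    (A t).le_of_opNorm_le_of_le (hA1 t ht) le_rfl |>.trans_eq (one_mul _)
  have hIcc : ∀ {t : ℝ}, t ∈ uIoc (0 : ℝ) 1 → t ∈ Icc (0 : ℝ) 1 := fun ht =>
    uIcc_of_le (zero_le_one' ℝ) ▸ uIoc_subset_uIcc ht
  have hterm : ∀ n, ∀ t ∈ Icc (0 : ℝ) 1, ‖w t • p n fun _ => A t y‖ ≤ ‖p n‖ * ‖y‖ ^ n := by
    intro n t ht
    have hconst : ‖fun _ : Fin n => A t y‖ ≤ ‖y‖ := (pi_norm_const_le (A t y)).trans (hAy t ht)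
    rw [norm_smul]
    exact (mul_le_of_le_one_left (norm_nonneg _) (hw1 t ht)).trans
      ((p n).le_opNorm_mul_pow_of_le hconst)
  refine intervalIntegral.hasSum_integral_of_dominated_convergence
    (fun n _ => ‖p n‖ * ‖y‖ ^ n) (fun n => ?_) (fun n => Eventually.of_forall fun t ht => ?_)
    (Eventually.of_forall fun _ _ => ?_) (by simp) (Eventually.of_forall fun t ht => ?_)
  · exact (hw.smul ((p n).cont.comp
      (continuous_pi fun _ => hA.clm_apply continuous_const))).aestronglyMeasurable
  · exact hterm n t (hIcc ht)
  · exact p.summable_norm_mul_pow (r := ‖y‖₊) (hy.trans_le hR.r_le)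
  · have hmem : A t y ∈ Metric.eball (0 : F) r := by
      rw [mem_eball_zero_iff]
      exact (enorm_le_iff_norm_le.2 (hAy t (hIcc ht))).trans_lt hy
    simpa only [zero_add] using (hR.hasSum hmem).const_smul (w t)

theorem analyticAt_intervalIntegral_comp_clm [CompleteSpace G] {R : F → G}
    (hR : AnalyticAt ℝ R 0) (hA : Continuous A) (hA1 : ∀ t ∈ Icc (0 : ℝ) 1, ‖A t‖ ≤ 1)
    (hw : Continuous w) (hw1 : ∀ t ∈ Icc (0 : ℝ) 1, ‖w t‖ ≤ 1) :
    AnalyticAt ℝ (fun z => ∫ t in (0 : ℝ)..1, w t • R (A t z)) 0 := by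
  obtain ⟨p, r, hp⟩ := hR
  let Q (n : ℕ) (t : ℝ) : ContinuousMultilinearMap ℝ (fun _ : Fin n => E) G :=
    w t • (p n).compContinuousLinearMap fun _ => A t
  have hQ : ∀ n, Continuous (Q n) := fun n =>
    hw.smul (continuous_compContinuousLinearMap (p n) hA)
  have hQ_le : ∀ n, ∀ t ∈ uIoc (0 : ℝ) 1, ‖Q n t‖ ≤ ‖p n‖ := by
    intro n t ht
    have ht' : t ∈ Icc (0 : ℝ) 1 := uIcc_of_le (zero_le_one' ℝ) ▸ uIoc_subset_uIcc ht
    rw [norm_smul, ← one_mul ‖p n‖]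
    exact mul_le_mul (hw1 t ht') (norm_compContinuousLinearMap_le_of_norm_le_one _ (hA1 t ht'))
      (norm_nonneg _) zero_le_one
  refine ⟨fun n => ∫ t in (0 : ℝ)..1, Q n t, r, ?_, hp.r_pos, fun {y} hy => ?_⟩
  · refine hp.r_le.trans (FormalMultilinearSeries.radius_le_of_le fun n => ?_)
    simpa using intervalIntegral.norm_integral_le_of_norm_le_const (hQ_le n)
  · have happly : ∀ n, (∫ t in (0 : ℝ)..1, Q n t) (fun _ => y)
        = ∫ t in (0 : ℝ)..1, w t • p n fun _ => A t y := fun n =>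
      ((ContinuousMultilinearMap.apply ℝ (fun _ : Fin n => E) G
        (fun _ => y)).intervalIntegral_comp_comm ((hQ n).intervalIntegrable _ _)).symm
    simpa only [happly, zero_add] using
      hasSum_intervalIntegral_comp_clm hp hA hA1 hw hw1 (mem_eball_zero_iff.1 hy)

end ParametricIntegral

section PartialDerivative

variable {f : ℝ × ℝ → ℝ}

/-- The partial derivative of `f` in the second variable. -/
noncomputable def derivSnd (f : ℝ × ℝ → ℝ) (z : ℝ × ℝ) : ℝ := fderiv ℝ f z (0, 1)

theorem analyticAt_derivSnd {z : ℝ × ℝ} (hf : AnalyticAt ℝ f z) : AnalyticAt ℝ (derivSnd f) z :=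
  ((ContinuousLinearMap.apply ℝ ℝ ((0, 1) : ℝ × ℝ)).analyticAt _).comp hf.fderiv

theorem analyticAt_iterate_derivSnd {z : ℝ × ℝ} (hf : AnalyticAt ℝ f z) (n : ℕ) :
    AnalyticAt ℝ (derivSnd^[n] f) z := by
  induction n generalizing f with
  | zero => exact hf
  | succ _ ih => exact ih (analyticAt_derivSnd hf)

theorem hasDerivAt_derivSnd {x y : ℝ} (hf : DifferentiableAt ℝ f (x, y)) :
    HasDerivAt (fun w => f (x, w)) (derivSnd f (x, y)) y :=
  hf.hasFDerivAt.comp_hasDerivAt y ((hasDerivAt_const y x).prodMk (hasDerivAt_id y))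

theorem derivSnd_congr {g : ℝ × ℝ → ℝ} {z : ℝ × ℝ} (h : f =ᶠ[𝓝 z] g) :
    derivSnd f =ᶠ[𝓝 z] derivSnd g := by
  filter_upwards [h.fderiv (𝕜 := ℝ)] with w hw
  rw [derivSnd, derivSnd, hw]

theorem iterate_derivSnd_zero (hf : AnalyticAt ℝ f 0) (n : ℕ) :
    (derivSnd^[n] f) 0 = iteratedDeriv n (fun w => f (0, w)) 0 := by
  induction n generalizing f with
  | zero => rfl
  | succ n ih =>
    rw [Function.iterate_succ_apply, ih (analyticAt_derivSnd hf), iteratedDeriv_succ']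
    refine (Filter.EventuallyEq.iteratedDeriv_eq n ?_).symm
    have hvert : Tendsto (fun w : ℝ => ((0 : ℝ), w)) (𝓝 0) (𝓝 (0 : ℝ × ℝ)) :=
      (Continuous.prodMk_right (0 : ℝ)).tendsto' _ _ rfl
    filter_upwards [hvert.eventually hf.eventually_analyticAt] with w hw
    exact (hasDerivAt_derivSnd hw.differentiableAt).deriv

/-- The shear `(x, y) ↦ (x, y + φ x)`, which straightens the graph of `φ` to the first axis. -/
def shearSnd (φ : ℝ → ℝ) (z : ℝ × ℝ) : ℝ × ℝ := (z.1, z.2 + φ z.1)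

section Shear

variable {φ : ℝ → ℝ}

theorem shearSnd_zero (hφ0 : φ 0 = 0) : shearSnd φ 0 = 0 := by simp [shearSnd, hφ0]

theorem analyticAt_shearSnd (hφ : AnalyticAt ℝ φ 0) : AnalyticAt ℝ (shearSnd φ) 0 :=
  analyticAt_fst.prod (analyticAt_snd.add
    (AnalyticAt.comp (f := Prod.fst) (x := (0 : ℝ × ℝ)) hφ analyticAt_fst))

theorem tendsto_shearSnd (hφ : AnalyticAt ℝ φ 0) (hφ0 : φ 0 = 0) :
    Tendsto (shearSnd φ) (𝓝 0) (𝓝 0) := by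
  simpa only [shearSnd_zero hφ0] using (analyticAt_shearSnd hφ).continuousAt.tendsto

theorem analyticAt_comp_shearSnd (hf : AnalyticAt ℝ f 0) (hφ : AnalyticAt ℝ φ 0) (hφ0 : φ 0 = 0) :
    AnalyticAt ℝ (f ∘ shearSnd φ) 0 :=
  AnalyticAt.comp (by rwa [shearSnd_zero hφ0]) (analyticAt_shearSnd hφ)

theorem iterate_derivSnd_comp_shearSnd (hf : AnalyticAt ℝ f 0) (hφ : AnalyticAt ℝ φ 0)
    (hφ0 : φ 0 = 0) (n : ℕ) :
    derivSnd^[n] (f ∘ shearSnd φ) =ᶠ[𝓝 0] (derivSnd^[n] f) ∘ shearSnd φ := by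
  induction n with
  | zero => rfl
  | succ n ih =>
    rw [Function.iterate_succ_apply', Function.iterate_succ_apply']
    refine (derivSnd_congr ih).trans ?_
    have hana := analyticAt_iterate_derivSnd hf n
    filter_upwards [(tendsto_shearSnd hφ hφ0).eventually hana.eventually_analyticAt,
      (analyticAt_comp_shearSnd hana hφ hφ0).eventually_analyticAt] with z hz hz'
    exact (hasDerivAt_derivSnd hz'.differentiableAt).unique
      ((hasDerivAt_derivSnd hz.differentiableAt).comp_add_const z.2 (φ z.1))

end Shear

theorem exists_analyticAt_implicit (hf : AnalyticAt ℝ f 0) (hf0 : f 0 = 0)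
    (hf1 : derivSnd f 0 ≠ 0) :
    ∃ φ : ℝ → ℝ, AnalyticAt ℝ φ 0 ∧ φ 0 = 0 ∧ ∀ᶠ x in 𝓝 (0 : ℝ), f (x, φ x) = 0 := by
  have hsmooth : ContDiffAt ℝ ⊤ f 0 := hf.contDiffAt
  have hinv : (fderiv ℝ f 0 ∘L .inr ℝ ℝ ℝ).IsInvertible := by
    refine ⟨ContinuousLinearEquiv.unitsEquivAut ℝ (Units.mk0 _ hf1), ?_⟩
    ext
    simp [derivSnd]
  have htop : (⊤ : WithTop ℕ∞) ≠ 0 := by simp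
  refine ⟨hsmooth.implicitFunction htop hinv,
    (hsmooth.contDiffAt_implicitFunction htop hinv).analyticAt,
    hsmooth.implicitFunction_apply_self htop hinv, ?_⟩
  simpa [hf0] using hsmooth.eventually_apply_implicitFunction htop hinv

end PartialDerivative

section Taylor

/-- Scaling of the second coordinate by `t`. -/
noncomputable def scaleSnd (t : ℝ) : ℝ × ℝ →L[ℝ] ℝ × ℝ :=
  (ContinuousLinearMap.fst ℝ ℝ ℝ).prod (t • ContinuousLinearMap.snd ℝ ℝ ℝ)

theorem scaleSnd_apply (t : ℝ) (z : ℝ × ℝ) : scaleSnd t z = (z.1, t * z.2) := rfl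

theorem norm_scaleSnd_le {t : ℝ} (ht : t ∈ Icc (0 : ℝ) 1) : ‖scaleSnd t‖ ≤ 1 := by
  refine ContinuousLinearMap.opNorm_le_bound _ zero_le_one fun z => ?_
  rw [one_mul, scaleSnd_apply, Prod.norm_def, Prod.norm_def, norm_mul,
    Real.norm_of_nonneg ht.1]
  exact max_le_max le_rfl (mul_le_of_le_one_left (norm_nonneg _) ht.2)

theorem continuous_scaleSnd : Continuous scaleSnd := by
  have h : scaleSnd = fun t => (ContinuousLinearMap.inl ℝ ℝ ℝ).comp (ContinuousLinearMap.fst ℝ ℝ ℝ)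
      + t • (ContinuousLinearMap.inr ℝ ℝ ℝ).comp (ContinuousLinearMap.snd ℝ ℝ ℝ) := by
    funext t
    ext <;> simp [scaleSnd]
  rw [h]
  fun_prop

theorem eventually_forall_scaleSnd {P : ℝ × ℝ → Prop} (hP : ∀ᶠ z in 𝓝 0, P z) :
    ∀ᶠ z in 𝓝 0, ∀ t ∈ Icc (0 : ℝ) 1, P (scaleSnd t z) := by
  obtain ⟨ε, hε, hball⟩ := Metric.eventually_nhds_iff_ball.1 hP
  filter_upwards [Metric.ball_mem_nhds 0 hε] with z hz t ht
  refine hball _ (mem_ball_zero_iff.2 ?_)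
  exact ((scaleSnd t).le_of_opNorm_le (norm_scaleSnd_le ht) z).trans_lt
    (by rwa [one_mul, ← mem_ball_zero_iff])

variable {f R : ℝ × ℝ → ℝ}

theorem continuousOn_comp_scaleSnd {z : ℝ × ℝ}
    (hf : ∀ t ∈ Icc (0 : ℝ) 1, ContinuousAt f (scaleSnd t z)) :
    ContinuousOn (fun t => f (scaleSnd t z)) (Icc 0 1) := fun t ht =>
  (ContinuousAt.comp (f := fun t => scaleSnd t z) (hf t ht)
    (continuous_scaleSnd.clm_apply continuous_const).continuousAt).continuousWithinAt

theorem eventually_eq_add_integral_derivSnd (hf : AnalyticAt ℝ f 0) :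
    ∀ᶠ z in 𝓝 0, f z = f (z.1, 0) + z.2 * ∫ t in (0 : ℝ)..1, derivSnd f (scaleSnd t z) := by
  filter_upwards [eventually_forall_scaleSnd hf.eventually_analyticAt] with z hz
  have huIcc : uIcc (0 : ℝ) 1 = Icc 0 1 := uIcc_of_le zero_le_one
  have hderiv : ∀ t ∈ uIcc (0 : ℝ) 1,
      HasDerivAt (fun t => f (scaleSnd t z)) (z.2 * derivSnd f (scaleSnd t z)) t := by
    intro t ht
    have hdiff := (hz t (huIcc ▸ ht)).differentiableAt
    have hchain := (hasDerivAt_derivSnd hdiff).comp t ((hasDerivAt_id t).mul_const z.2)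
    rwa [one_mul, mul_comm] at hchain
  have hint : IntervalIntegrable (fun t => z.2 * derivSnd f (scaleSnd t z))
      MeasureTheory.volume 0 1 := by
    refine (ContinuousOn.intervalIntegrable ?_).const_mul _
    rw [huIcc]
    exact continuousOn_comp_scaleSnd fun t ht => (analyticAt_derivSnd (hz t ht)).continuousAt
  have hftc := intervalIntegral.integral_eq_sub_of_hasDerivAt hderiv hint
  rw [intervalIntegral.integral_const_mul] at hftc
  simp only [scaleSnd_apply, one_mul, zero_mul] at hftc ⊢
  linarith

/-- The function `∑_{i < d} a_i(x) yⁱ + y^d R(x, y)`, the shape of a Taylor expansion of order `d`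
in the second variable. -/
def taylorForm (d : ℕ) (a : ℕ → ℝ → ℝ) (R : ℝ × ℝ → ℝ) (z : ℝ × ℝ) : ℝ :=
  ∑ i ∈ Finset.range d, a i z.1 * z.2 ^ i + z.2 ^ d * R z

theorem eventually_integral_taylorForm (d : ℕ) (a : ℕ → ℝ → ℝ) (hR : AnalyticAt ℝ R 0) :
    ∀ᶠ z in 𝓝 0, ∫ t in (0 : ℝ)..1, taylorForm d a R (scaleSnd t z) =
      taylorForm d (fun i x => a i x / (i + 1))
        (fun z => ∫ t in (0 : ℝ)..1, t ^ d • R (scaleSnd t z)) z := by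
  filter_upwards [eventually_forall_scaleSnd hR.eventually_analyticAt] with z hz
  have hpow : ∀ i : ℕ, IntervalIntegrable (fun t : ℝ => a i z.1 * z.2 ^ i * t ^ i)
      MeasureTheory.volume 0 1 := fun i => Continuous.intervalIntegrable (by fun_prop) _ _
  have hrem : IntervalIntegrable (fun t => t ^ d • R (scaleSnd t z)) MeasureTheory.volume 0 1 := by
    refine ContinuousOn.intervalIntegrable ?_
    rw [uIcc_of_le zero_le_one]
    exact (continuous_id.pow d).continuousOn.smul
      (continuousOn_comp_scaleSnd fun t ht => (hz t ht).continuousAt)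
  have hexpand : ∀ t : ℝ, taylorForm d a R (scaleSnd t z) =
      ∑ i ∈ Finset.range d, a i z.1 * z.2 ^ i * t ^ i + z.2 ^ d * t ^ d • R (scaleSnd t z) := by
    intro t
    simp only [taylorForm, scaleSnd_apply, smul_eq_mul, mul_pow]
    congr 1
    · exact Finset.sum_congr rfl fun i _ => by ring
    · ring
  simp only [hexpand]
  have hsum : IntervalIntegrable (fun t : ℝ => ∑ i ∈ Finset.range d, a i z.1 * z.2 ^ i * t ^ i)
      MeasureTheory.volume 0 1 := Continuous.intervalIntegrable (by fun_prop) _ _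
  rw [intervalIntegral.integral_add hsum (hrem.const_mul _), intervalIntegral.integral_const_mul,
    intervalIntegral.integral_finsetSum fun i _ => hpow i, taylorForm]
  congr 1
  refine Finset.sum_congr rfl fun i _ => ?_
  rw [intervalIntegral.integral_const_mul, integral_pow, one_pow, zero_pow i.succ_ne_zero]
  ring

theorem exists_eventuallyEq_taylorForm (hf : AnalyticAt ℝ f 0) (d : ℕ) :
    ∃ R : ℝ × ℝ → ℝ, AnalyticAt ℝ R 0 ∧ R 0 = (derivSnd^[d] f) 0 / d.factorial ∧
      f =ᶠ[𝓝 0] taylorForm d (fun i x => (derivSnd^[i] f) (x, 0) / i.factorial) R := by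
  induction d generalizing f with
  | zero => exact ⟨f, hf, by simp, Eventually.of_forall fun z => by simp [taylorForm]⟩
  | succ d ih =>
    obtain ⟨R, hR, hR0, hfR⟩ := ih (analyticAt_derivSnd hf)
    refine ⟨fun z => ∫ t in (0 : ℝ)..1, t ^ d • R (scaleSnd t z), ?_, ?_, ?_⟩
    · refine analyticAt_intervalIntegral_comp_clm hR continuous_scaleSnd
        (fun _ => norm_scaleSnd_le) (continuous_id.pow d) fun t ht => ?_
      rw [norm_pow, Real.norm_of_nonneg ht.1]
      exact pow_le_one₀ ht.1 ht.2
    · simp only [map_zero, smul_eq_mul]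
      rw [intervalIntegral.integral_mul_const, integral_pow, hR0, Function.iterate_succ_apply,
        Nat.factorial_succ, one_pow, zero_pow d.succ_ne_zero]
      push_cast
      field_simp
      ring
    · filter_upwards [eventually_eq_add_integral_derivSnd hf, eventually_forall_scaleSnd hfR,
        eventually_integral_taylorForm d _ hR] with z hz hzR hint
      have hcoeff : ∀ i : ℕ, (derivSnd^[i] (derivSnd f)) (z.1, 0) / i.factorial / (i + 1)
          = (derivSnd^[i + 1] f) (z.1, 0) / (i + 1).factorial := by
        intro i
        rw [Function.iterate_succ_apply, Nat.factorial_succ, div_div, mul_comm (i.factorial : ℝ)]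
        norm_cast
      rw [hz, intervalIntegral.integral_congr fun t ht => hzR t (by rwa [← uIcc_of_le zero_le_one]),
        hint, taylorForm, taylorForm, Finset.sum_range_succ', mul_add, Finset.mul_sum]
      simp only [hcoeff, Function.iterate_zero, id_eq, Nat.factorial_zero, Nat.cast_one, div_one,
        pow_zero, mul_one, pow_succ']
      rw [Finset.sum_congr rfl fun i _ => mul_left_comm z.2 _ (z.2 ^ i)]
      ring

end Taylor

/-! ### Newton polygons and Puiseux arcs -/

section NewtonSlope

theorem exists_min_slope {d : ℕ} {I : Finset ℕ} (hI : I.Nonempty) (hId : ∀ i ∈ I, i < d)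
    (n : ℕ → ℕ) : ∃ i₀ ∈ I, ∀ i ∈ I, n i₀ * (d - i) ≤ (d - i₀) * n i := by
  obtain ⟨i₀, hi₀, hmin⟩ := I.exists_min_image (fun i => (n i : ℚ) / ((d - i : ℕ) : ℚ)) hI
  have hpos : ∀ i ∈ I, (0 : ℚ) < ((d - i : ℕ) : ℚ) := fun i hi => by
    exact_mod_cast Nat.sub_pos_of_lt (hId i hi)
  refine ⟨i₀, hi₀, fun i hi => ?_⟩
  have hle := hmin i hi
  rw [div_le_div_iff₀ (hpos _ hi₀) (hpos _ hi), mul_comm (n i : ℚ)] at hle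
  exact_mod_cast hle

variable {𝕜 : Type*} [NontriviallyNormedField 𝕜]

theorem tendsto_pow_nhds_zero {n : ℕ} (hn : 0 < n) :
    Tendsto (fun s : 𝕜 => s ^ n) (𝓝 0) (𝓝 0) :=
  (continuous_pow n).tendsto' _ _ (zero_pow hn.ne')

theorem analyticAt_comp_pow {b : 𝕜 → 𝕜} {q : ℕ} (hb : AnalyticAt 𝕜 b 0) (hq : 0 < q) :
    AnalyticAt 𝕜 (fun s => b (s ^ q)) 0 :=
  AnalyticAt.comp (f := fun s : 𝕜 => s ^ q) (by rwa [zero_pow hq.ne']) (analyticAt_id.pow q)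

theorem exists_newton_slope {d : ℕ} {a : ℕ → 𝕜 → 𝕜} (ha : ∀ i < d, AnalyticAt 𝕜 (a i) 0)
    (ha0 : ∀ i < d, a i 0 = 0) (hne : ∃ i < d, ¬ ∀ᶠ x in 𝓝 0, a i x = 0) :
    ∃ (p q i₀ : ℕ) (B : ℕ → 𝕜 → 𝕜), 0 < p ∧ 0 < q ∧ i₀ < d ∧ B i₀ 0 ≠ 0 ∧
      (∀ i < d, AnalyticAt 𝕜 (B i) 0) ∧
      (∀ i < d, ∀ᶠ s in 𝓝 0, a i (s ^ q) = s ^ (p * (d - i)) * B i s) ∧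
      ∀ i < d, (∀ᶠ x in 𝓝 0, a i x = 0) → B i 0 = 0 := by
  classical
  let I := {i ∈ Finset.range d | ¬ ∀ᶠ x in 𝓝 0, a i x = 0}
  have hmem : ∀ {i}, i ∈ I ↔ i < d ∧ ¬ ∀ᶠ x in 𝓝 0, a i x = 0 := by
    simp only [I, Finset.mem_filter, Finset.mem_range, implies_true]
  have hfactor : ∀ i ∈ I, ∃ (n : ℕ) (b : 𝕜 → 𝕜), AnalyticAt 𝕜 b 0 ∧ b 0 ≠ 0 ∧
      ∀ᶠ x in 𝓝 0, a i x = x ^ n * b x := fun i hi => by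
    simpa only [sub_zero, smul_eq_mul] using
      (ha i (hmem.1 hi).1).exists_eventuallyEq_pow_smul_nonzero_iff.2 (hmem.1 hi).2
  choose! n b hb hb0 hab using hfactor
  obtain ⟨i₀, hi₀, hmin⟩ : ∃ i₀ ∈ I, ∀ i ∈ I, n i₀ * (d - i) ≤ (d - i₀) * n i :=
    exists_min_slope (hne.imp fun _ => hmem.2) (fun i hi => (hmem.1 hi).1) n
  have hq : 0 < d - i₀ := Nat.sub_pos_of_lt (hmem.1 hi₀).1
  have hp : 0 < n i₀ := by
    refine Nat.pos_of_ne_zero fun hn => hb0 i₀ hi₀ ?_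
    simpa only [hn, ha0 i₀ (hmem.1 hi₀).1, pow_zero, one_mul] using
      (hab i₀ hi₀).self_of_nhds.symm
  refine ⟨n i₀, d - i₀, i₀, fun i s => if i ∈ I then
    s ^ ((d - i₀) * n i - n i₀ * (d - i)) * b i (s ^ (d - i₀)) else 0, hp, hq, (hmem.1 hi₀).1,
    ?_, fun i _ => ?_, fun i hi => ?_, fun i _ h0 => if_neg fun hi => (hmem.1 hi).2 h0⟩
  · simpa only [if_pos hi₀, mul_comm (n i₀), Nat.sub_self, pow_zero, one_mul, zero_pow hq.ne']
      using hb0 i₀ hi₀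
  · beta_reduce
    split_ifs with hi
    · exact (analyticAt_id.pow _).mul (analyticAt_comp_pow (hb i hi) hq)
    · exact analyticAt_const
  · by_cases hiI : i ∈ I
    · filter_upwards [(tendsto_pow_nhds_zero hq).eventually (hab i hiI)] with s hs
      rw [if_pos hiI, hs, ← mul_assoc, ← pow_add, Nat.add_sub_cancel' (hmin i hiI), pow_mul]
    · have hzero : ∀ᶠ x in 𝓝 0, a i x = 0 := by simpa [hmem, hi] using hiI
      filter_upwards [(tendsto_pow_nhds_zero hq).eventually hzero] with s hs
      rw [if_neg hiI, hs, mul_zero]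

end NewtonSlope

section TaylorShift

open Polynomial

theorem iteratedDeriv_polynomial_eval_add {𝕜 : Type*} [NontriviallyNormedField 𝕜] (P : 𝕜[X])
    (c : 𝕜) (k : ℕ) :
    iteratedDeriv k (fun w => P.eval (c + w)) 0 = k.factorial * (taylor c P).coeff k := by
  have hderiv : iteratedDeriv k (fun w => P.eval w) = fun w => (derivative^[k] P).eval w := by
    induction k generalizing P with
    | zero => simp
    | succ k ih =>
      rw [iteratedDeriv_succ', Function.iterate_succ_apply, ← ih]
      exact congrArg _ (funext fun w => P.deriv)
  rw [iteratedDeriv_comp_const_add k (fun w => P.eval w) c, hderiv, taylor_coeff]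
  beta_reduce
  rw [add_zero, ← factorial_smul_hasseDeriv, LinearMap.smul_apply, eval_smul, nsmul_eq_mul]

/- `Q` is a multiple of `(X - c) ^ d`, whose coefficient of degree `d - 1` only vanishes for
`c = 0`. -/
theorem coeff_eq_zero_of_taylor_coeff_eq_zero {R : Type*} [CommRing R] [IsDomain R] [CharZero R]
    {Q : R[X]} {d : ℕ} {c : R} (hdeg : Q.natDegree ≤ d) (hQ : Q.coeff (d - 1) = 0)
    (htaylor : ∀ k < d, (taylor c Q).coeff k = 0) {i : ℕ} (hi : i < d) : Q.coeff i = 0 := by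
  obtain ⟨r, hr⟩ : ∃ r, taylor c Q = C r * X ^ d := by
    refine ⟨(taylor c Q).coeff d, Polynomial.ext fun k => ?_⟩
    rw [coeff_C_mul_X_pow]
    split_ifs with hk
    · rw [hk]
    · rcases lt_or_gt_of_ne hk with hlt | hgt
      · exact htaylor k hlt
      · exact coeff_eq_zero_of_natDegree_lt (by rw [natDegree_taylor]; omega)
  have hQ_eq : Q = C r * (X + C (-c)) ^ d := by
    rw [← taylor_zero Q, ← neg_add_cancel c, ← taylor_taylor, hr, taylor_mul, taylor_C,
      taylor_X_pow]
  have hcoeff : ∀ k, Q.coeff k = r * ((-c) ^ (d - k) * d.choose k) := fun k => by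
    rw [hQ_eq, coeff_C_mul, coeff_X_add_C_pow]
  have hchoose : (d.choose (d - 1) : R) ≠ 0 := by
    exact_mod_cast (Nat.choose_pos d.pred_le).ne'
  rw [hcoeff, Nat.sub_sub_self (Nat.one_le_of_lt hi), pow_one, mul_eq_zero, mul_eq_zero,
    neg_eq_zero, or_iff_left hchoose] at hQ
  rw [hcoeff]
  rcases hQ with rfl | rfl
  · exact zero_mul _
  · rw [neg_zero, zero_pow (Nat.sub_ne_zero_of_lt hi), zero_mul, mul_zero]

end TaylorShift

/-- `g` is smaller than every power of `x` along the filter `L`. -/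
def IsFlat {ι : Type*} (L : Filter ι) (x g : ι → ℝ) : Prop :=
  ∀ N : ℕ, g =O[L] fun i => x i ^ N

namespace IsFlat

variable {ι : Type*} {L : Filter ι} {x g h : ι → ℝ}

theorem congr' (hg : IsFlat L x g) (hgh : g =ᶠ[L] h) : IsFlat L x h :=
  fun N => (hg N).congr' hgh EventuallyEq.rfl

theorem tendsto_zero (hx : Tendsto x L (𝓝 0)) (hg : IsFlat L x g) : Tendsto g L (𝓝 0) := by
  refine (hg 1).trans_tendsto ?_
  simpa only [pow_one] using hx

theorem trans_isBigO {y : ι → ℝ} (hg : IsFlat L x g) (hxy : x =O[L] y) : IsFlat L y g :=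
  fun N => (hg N).trans (hxy.pow N)

theorem of_pow {s : ι → ℝ} {q : ℕ} (hq : 0 < q) (hs : Tendsto s L (𝓝 0))
    (hsx : ∀ᶠ i in L, s i ^ q = x i) (hg : IsFlat L x g) : IsFlat L s g := by
  refine hg.trans_isBigO (IsBigO.of_bound 1 ?_)
  filter_upwards [hsx, hs.norm.eventually (gt_mem_nhds (by simp : ‖(0 : ℝ)‖ < 1))] with i hi hi1
  rw [← hi, norm_pow, one_mul]
  exact pow_le_of_le_one (norm_nonneg _) hi1.le hq.ne'

theorem of_mul_pow {k : ℕ} (hx : ∀ᶠ i in L, x i ≠ 0) (hg : IsFlat L x fun i => x i ^ k * g i) :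
    IsFlat L x g := by
  intro N
  obtain ⟨C, hC⟩ := (hg (k + N)).bound
  refine IsBigO.of_bound C ?_
  filter_upwards [hC, hx] with i hi hxi
  rw [norm_mul, pow_add, norm_mul, mul_left_comm] at hi
  exact le_of_mul_le_mul_left hi (norm_pos_iff.2 (pow_ne_zero k hxi))

theorem mul_left {k : ι → ℝ} {k₀ : ℝ} (hk : Tendsto k L (𝓝 k₀)) (hg : IsFlat L x g) :
    IsFlat L x fun i => k i * g i := by
  intro N
  simpa only [one_mul] using (hk.isBigO_one ℝ).mul (hg N)

theorem of_pow_mul {d : ℕ} {r : ι → ℝ} {r₀ : ℝ} (hd : 0 < d) (hr : Tendsto r L (𝓝 r₀))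
    (hr₀ : r₀ ≠ 0) (hg : IsFlat L x fun i => g i ^ d * r i) : IsFlat L x g := by
  have hgd : IsFlat L x fun i => g i ^ d := by
    refine (hg.mul_left (hr.inv₀ hr₀)).congr' ?_
    filter_upwards [hr.eventually_ne hr₀] with i hi
    field_simp
  intro N
  exact IsBigO.of_pow hd.ne' ((hgd (N * d)).congr_right fun i => pow_mul (x i) N d)

end IsFlat

section Boundedness

variable {ι : Type*} (L : Ultrafilter ι)

theorem exists_tendsto_of_eventually_mem {X : Type*} [TopologicalSpace X] {K : Set X}
    (hK : IsCompact K) {f : ι → X} (hf : ∀ᶠ i in L, f i ∈ K) : ∃ x ∈ K, Tendsto f L (𝓝 x) :=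
  hK.ultrafilter_le_nhds (L.map f) (le_principal_iff.2 hf)

theorem tendsto_norm_atTop_or_exists_tendsto (Y : ι → ℝ) :
    Tendsto (fun k => ‖Y k‖) L atTop ∨ ∃ c, Tendsto Y L (𝓝 c) := by
  by_cases hY : ∃ M, ∀ᶠ k in L, ‖Y k‖ ≤ M
  · obtain ⟨M, hM⟩ := hY
    obtain ⟨c, -, hc⟩ := exists_tendsto_of_eventually_mem L (isCompact_closedBall (0 : ℝ) M)
      (hM.mono fun _ => mem_closedBall_zero_iff.2)
    exact Or.inr ⟨c, hc⟩
  · push Not at hY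
    exact Or.inl (tendsto_atTop.2 fun M => (hY M).mono fun _ => le_of_lt)

variable {L}

theorem exists_tendsto_of_tendsto_polynomial {d : ℕ} {β : ℕ → ι → ℝ} {β₀ : ℕ → ℝ}
    (hβ : ∀ i < d, Tendsto (β i) L (𝓝 (β₀ i))) {ρ : ι → ℝ} {r l : ℝ} (hr : r ≠ 0)
    (hd : 0 < d) (hρ : Tendsto ρ L (𝓝 r)) {Y : ι → ℝ}
    (hY : Tendsto (fun k => ∑ i ∈ Finset.range d, β i k * Y k ^ i + Y k ^ d * ρ k) L (𝓝 l)) :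
    ∃ c, Tendsto Y L (𝓝 c) := by
  refine (tendsto_norm_atTop_or_exists_tendsto L Y).resolve_left fun hinfty => hr ?_
  have hinv : Tendsto (fun k => (Y k)⁻¹) L (𝓝 0) :=
    tendsto_inv₀_cobounded.comp (tendsto_norm_atTop_iff_cobounded.1 hinfty)
  have hlim : Tendsto (fun k => ∑ i ∈ Finset.range d, β i k * (Y k)⁻¹ ^ (d - i) + ρ k) L
      (𝓝 (∑ i ∈ Finset.range d, β₀ i * 0 ^ (d - i) + r)) :=
    (tendsto_finsetSum _ fun i hi => (hβ i (Finset.mem_range.1 hi)).mul (hinv.pow _)).add hρ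
  have hlim_eq : ∑ i ∈ Finset.range d, β₀ i * (0 : ℝ) ^ (d - i) = 0 :=
    Finset.sum_eq_zero fun i hi => by
      rw [zero_pow (Nat.sub_ne_zero_of_lt (Finset.mem_range.1 hi)), mul_zero]
  have hmul := hY.mul (hinv.pow d)
  rw [zero_pow hd.ne', mul_zero] at hmul
  rw [hlim_eq, zero_add] at hlim
  refine tendsto_nhds_unique (hlim.congr' ?_) hmul
  filter_upwards [hinfty.eventually_gt_atTop 0] with k hk
  have hYk : Y k ≠ 0 := norm_pos_iff.1 hk
  rw [add_mul, Finset.sum_mul]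
  congr 1
  · refine Finset.sum_congr rfl fun i hi => ?_
    rw [inv_pow, inv_pow, pow_sub₀ _ hYk (Finset.mem_range.1 hi).le]
    field_simp
  · rw [mul_right_comm, ← mul_pow, mul_inv_cancel₀ hYk, one_pow, one_mul]

end Boundedness

/-- The points `(x i, y i)` have contact of infinite order, along `L`, with a Puiseux arc
`s ↦ (s ^ q, ψ s)` in the zero set of `f`, the point with index `i` being close to the one of
parameter `σ i`. -/
def FollowsArc {ι : Type*} (L : Filter ι) (f : ℝ × ℝ → ℝ) (x y : ι → ℝ) : Prop :=
  ∃ (q : ℕ) (ψ : ℝ → ℝ) (σ : ι → ℝ), 0 < q ∧ AnalyticAt ℝ ψ 0 ∧ ψ 0 = 0 ∧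
    Tendsto σ L (𝓝[>] 0) ∧ (∀ᶠ i in L, σ i ^ q = x i) ∧
    (∀ᶠ s in 𝓝 (0 : ℝ), f (s ^ q, ψ s) = 0) ∧ IsFlat L σ (fun i => y i - ψ (σ i))

namespace FollowsArc

variable {ι : Type*} {L : Filter ι} {f : ℝ × ℝ → ℝ} {x y : ι → ℝ}

theorem congr {g : ℝ × ℝ → ℝ} (hfg : f =ᶠ[𝓝 0] g) (h : FollowsArc L f x y) :
    FollowsArc L g x y := by
  obtain ⟨q, ψ, σ, hq, hψ, hψ0, hσ, hσx, hψf, hflat⟩ := h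
  have hψ_tendsto : Tendsto ψ (𝓝 0) (𝓝 0) := by simpa only [hψ0] using hψ.continuousAt.tendsto
  refine ⟨q, ψ, σ, hq, hψ, hψ0, hσ, hσx, ?_, hflat⟩
  filter_upwards [hψf, ((tendsto_pow_nhds_zero hq).prodMk_nhds hψ_tendsto).eventually hfg]
    with s hs hfgs
  rw [← hfgs, hs]

theorem of_comp_shearSnd {φ : ℝ → ℝ} (hφ : AnalyticAt ℝ φ 0) (hφ0 : φ 0 = 0)
    (h : FollowsArc L (f ∘ shearSnd φ) x fun i => y i - φ (x i)) : FollowsArc L f x y := by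
  obtain ⟨q, ψ, σ, hq, hψ, hψ0, hσ, hσx, hψf, hflat⟩ := h
  refine ⟨q, fun s => ψ s + φ (s ^ q), σ, hq, hψ.add (analyticAt_comp_pow hφ hq), ?_, hσ, hσx,
    hψf, hflat.congr' ?_⟩
  · simp [hψ0, hφ0, hq.ne']
  · filter_upwards [hσx] with i hi
    rw [hi]
    ring

theorem of_blowUp {g : ℝ × ℝ → ℝ} {s w : ι → ℝ} {c : ℝ} {p q n : ℕ} (hp : 0 < p) (hq : 0 < q)
    (hg : ∀ᶠ z in 𝓝 (0 : ℝ × ℝ), f (z.1 ^ q, z.1 ^ p * (c + z.2)) = z.1 ^ n * g z)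
    (hs : Tendsto s L (𝓝 0)) (hsx : ∀ᶠ i in L, s i ^ q = x i)
    (hwy : ∀ᶠ i in L, s i ^ p * (c + w i) = y i) (h : FollowsArc L g s w) :
    FollowsArc L f x y := by
  obtain ⟨q', ψ, σ, hq', hψ, hψ0, hσ, hσs, hψg, hflat⟩ := h
  refine ⟨q' * q, fun τ => τ ^ (q' * p) * (c + ψ τ), σ, Nat.mul_pos hq' hq,
    (analyticAt_id.pow _).mul (analyticAt_const.add hψ), ?_, hσ, ?_, ?_, ?_⟩
  · simp [hq'.ne', hp.ne']
  · filter_upwards [hsx, hσs] with i hsx hσs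
    rw [pow_mul, hσs, hsx]
  · have hψ_tendsto : Tendsto ψ (𝓝 0) (𝓝 0) := by simpa only [hψ0] using hψ.continuousAt.tendsto
    filter_upwards [hψg,
      ((tendsto_pow_nhds_zero hq').prodMk_nhds hψ_tendsto).eventually hg] with τ hτg hτ
    rw [pow_mul, pow_mul, hτ, hτg, mul_zero]
  · refine (hflat.mul_left (hs.pow p)).congr' ?_
    filter_upwards [hσs, hwy] with i hσs hwy
    rw [pow_mul, hσs, ← hwy]
    ring

theorem of_eventuallyEq_pow_mul {d : ℕ} {R : ℝ × ℝ → ℝ} (hd : 0 < d) (hR : ContinuousAt R 0)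
    (hR0 : R 0 ≠ 0) (hf : f =ᶠ[𝓝 0] fun z => z.2 ^ d * R z) (hx : Tendsto x L (𝓝[>] 0))
    (hy : Tendsto y L (𝓝 0)) (hflat : IsFlat L x fun i => f (x i, y i)) :
    FollowsArc L f x y := by
  have hxy : Tendsto (fun i => (x i, y i)) L (𝓝 0) :=
    (hx.mono_right nhdsWithin_le_nhds).prodMk_nhds hy
  have haxis : Tendsto (fun s : ℝ => (s, (0 : ℝ))) (𝓝 0) (𝓝 0) :=
    tendsto_id.prodMk_nhds tendsto_const_nhds
  refine ⟨1, fun _ => 0, x, one_pos, analyticAt_const, rfl, hx, by simp, ?_, ?_⟩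
  · filter_upwards [haxis.eventually hf] with s hs
    rw [pow_one, hs, zero_pow hd.ne', zero_mul]
  · simp only [sub_zero]
    exact IsFlat.of_pow_mul hd (hR.tendsto.comp hxy) hR0 (hflat.congr' (hxy.eventually hf))

end FollowsArc

section Blowup

variable {d p q : ℕ} {a B : ℕ → ℝ → ℝ} {R : ℝ × ℝ → ℝ}

theorem exists_comp_shearSnd_eventuallyEq_taylorForm {f : ℝ × ℝ → ℝ} (hf : AnalyticAt ℝ f 0)
    (hd : 0 < d) (hlow : ∀ i < d, (derivSnd^[i] f) 0 = 0) (hdf : (derivSnd^[d] f) 0 ≠ 0) :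
    ∃ (φ : ℝ → ℝ) (a : ℕ → ℝ → ℝ) (R : ℝ × ℝ → ℝ), AnalyticAt ℝ φ 0 ∧ φ 0 = 0 ∧
      (∀ i, AnalyticAt ℝ (a i) 0) ∧ (∀ i < d, a i 0 = 0) ∧ (∀ᶠ x in 𝓝 0, a (d - 1) x = 0) ∧
      AnalyticAt ℝ R 0 ∧ R 0 ≠ 0 ∧ f ∘ shearSnd φ =ᶠ[𝓝 0] taylorForm d a R := by
  have hderiv : derivSnd (derivSnd^[d - 1] f) = derivSnd^[d] f := by
    rw [← Function.iterate_succ_apply' derivSnd, Nat.succ_eq_add_one, Nat.sub_add_cancel hd]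
  obtain ⟨φ, hφ, hφ0, hφf⟩ := exists_analyticAt_implicit (analyticAt_iterate_derivSnd hf (d - 1))
    (hlow _ (Nat.sub_lt hd one_pos)) (hderiv ▸ hdf)
  have hshear : ∀ n, (derivSnd^[n] (f ∘ shearSnd φ)) 0 = (derivSnd^[n] f) 0 := fun n => by
    rw [(iterate_derivSnd_comp_shearSnd hf hφ hφ0 n).self_of_nhds, Function.comp_apply,
      shearSnd_zero hφ0]
  have haxis : Tendsto (fun x : ℝ => (x, (0 : ℝ))) (𝓝 0) (𝓝 0) :=
    tendsto_id.prodMk_nhds tendsto_const_nhds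
  have hfφ := analyticAt_comp_shearSnd hf hφ hφ0
  obtain ⟨R, hR, hR0, hfR⟩ := exists_eventuallyEq_taylorForm hfφ d
  refine ⟨φ, _, R, hφ, hφ0, fun i => ?_, fun i hi => ?_, ?_, hR, ?_, hfR⟩
  · exact AnalyticAt.div_const <| (analyticAt_iterate_derivSnd hfφ i).fun_comp
      (f := fun x : ℝ => (x, (0 : ℝ))) (x := 0) (analyticAt_id.prod analyticAt_const)
  · rw [Prod.mk_zero_zero, hshear, hlow i hi, zero_div]
  · filter_upwards [haxis.eventually (iterate_derivSnd_comp_shearSnd hf hφ hφ0 (d - 1)), hφf]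
      with x hx hφx
    rw [hx, Function.comp_apply, shearSnd, zero_add, hφx, zero_div]
  · rw [hR0, hshear]
    exact div_ne_zero hdf (Nat.cast_ne_zero.2 d.factorial_ne_zero)

theorem taylorForm_pow_pow_mul {s : ℝ} (Y : ℝ)
    (ha : ∀ i < d, a i (s ^ q) = s ^ (p * (d - i)) * B i s) :
    taylorForm d a R (s ^ q, s ^ p * Y) =
      s ^ (p * d) * taylorForm d B (fun z => R (z.1 ^ q, z.1 ^ p * z.2)) (s, Y) := by
  rw [taylorForm, taylorForm, mul_add, Finset.mul_sum]
  congr 1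
  · refine Finset.sum_congr rfl fun i hi => ?_
    have hid := Finset.mem_range.1 hi
    rw [ha i hid, mul_pow, ← pow_mul, show p * d = p * (d - i) + p * i by
      rw [← mul_add, Nat.sub_add_cancel hid.le], pow_add]
    ring
  · rw [mul_pow, ← pow_mul]
    ring

/-- The strict transform of `taylorForm d a R` under the blow-up
`(s, w) ↦ (s ^ q, s ^ p * (c + w))`, where `a i (s ^ q) = s ^ (p * (d - i)) * B i s`: the
coordinate `w` is centred at the point `c` of the exceptional divisor. -/
noncomputable def newtonBlowUp (d p q : ℕ) (B : ℕ → ℝ → ℝ) (R : ℝ × ℝ → ℝ) (c : ℝ) (z : ℝ × ℝ) :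
    ℝ :=
  taylorForm d B (fun z => R (z.1 ^ q, z.1 ^ p * z.2)) (z.1, c + z.2)

theorem analyticAt_newtonBlowUp (hp : 0 < p) (hq : 0 < q) (hB : ∀ i < d, AnalyticAt ℝ (B i) 0)
    (hR : AnalyticAt ℝ R 0) (c : ℝ) : AnalyticAt ℝ (newtonBlowUp d p q B R c) 0 := by
  have hY : AnalyticAt ℝ (fun z : ℝ × ℝ => c + z.2) 0 := analyticAt_const.add analyticAt_snd
  refine AnalyticAt.add (Finset.analyticAt_fun_sum _ fun i hi => AnalyticAt.mul ?_ (hY.pow i))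
    ((hY.pow d).mul ?_)
  · exact AnalyticAt.fun_comp (f := fun z : ℝ × ℝ => z.1) (x := 0)
      (hB i (Finset.mem_range.1 hi)) analyticAt_fst
  · refine AnalyticAt.fun_comp (f := fun z : ℝ × ℝ => (z.1 ^ q, z.1 ^ p * (c + z.2))) ?_
      ((analyticAt_fst.pow q).prod ((analyticAt_fst.pow p).mul hY))
    simp only [Prod.fst_zero, zero_pow hq.ne', zero_pow hp.ne', zero_mul, Prod.mk_zero_zero, hR]

-- By Tschirnhaus' normalization `B (d - 1) 0 = 0` the edge polynomial is not a `d`-th power, so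
-- the order of vanishing drops.
theorem exists_iterate_derivSnd_newtonBlowUp_ne_zero (hp : 0 < p) (hq : 0 < q)
    (hB : ∀ i < d, AnalyticAt ℝ (B i) 0) (hR : AnalyticAt ℝ R 0) (hB0 : B (d - 1) 0 = 0)
    {i₀ : ℕ} (hi₀ : i₀ < d) (hBi₀ : B i₀ 0 ≠ 0) (c : ℝ) :
    ∃ k < d, (derivSnd^[k] (newtonBlowUp d p q B R c)) 0 ≠ 0 := by
  by_contra! hvanish
  set Q : Polynomial ℝ :=
    ∑ i ∈ Finset.range d, .C (B i 0) * .X ^ i + .C (R 0) * .X ^ d with hQ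
  have hcoeff : ∀ i < d, Q.coeff i = B i 0 := fun i hi => by
    simp [hQ, Polynomial.finsetSum_coeff, Polynomial.coeff_X_pow, hi.ne, hi]
  have hdeg : Q.natDegree ≤ d := by
    refine Polynomial.natDegree_add_le_of_degree_le (Polynomial.natDegree_sum_le_of_forall_le _ _
      fun i hi => ?_) (Polynomial.natDegree_C_mul_X_pow_le _ _)
    exact (Polynomial.natDegree_C_mul_X_pow_le _ _).trans (Finset.mem_range.1 hi).le
  have heval : ∀ w, newtonBlowUp d p q B R c (0, w) = Q.eval (c + w) := fun w => by
    simp [newtonBlowUp, taylorForm, hQ, Polynomial.eval_finsetSum, hp.ne', hq.ne',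
      Prod.mk_zero_zero, mul_comm (R 0)]
  have htaylor : ∀ k < d, (Polynomial.taylor c Q).coeff k = 0 := fun k hk => by
    have := hvanish k hk
    rw [iterate_derivSnd_zero (analyticAt_newtonBlowUp hp hq hB hR c)] at this
    simp only [heval, iteratedDeriv_polynomial_eval_add] at this
    exact (mul_eq_zero.1 this).resolve_left (Nat.cast_ne_zero.2 k.factorial_ne_zero)
  refine hBi₀ (hcoeff i₀ hi₀ ▸ coeff_eq_zero_of_taylor_coeff_eq_zero hdeg ?_ htaylor hi₀)
  rw [hcoeff _ (by omega), hB0]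

end Blowup

section PuiseuxArc

variable {ι : Type*} {L : Ultrafilter ι}

theorem exists_root_tendsto {x : ι → ℝ} {L : Filter ι} (hx : Tendsto x L (𝓝[>] 0)) {q : ℕ}
    (hq : 0 < q) : ∃ s : ι → ℝ, Tendsto s L (𝓝[>] 0) ∧ ∀ᶠ i in L, s i ^ q = x i := by
  have hpos : ∀ᶠ i in L, 0 < x i := hx.eventually self_mem_nhdsWithin
  have hq' : (0 : ℝ) < (q : ℝ)⁻¹ := by positivity
  refine ⟨fun i => x i ^ (q : ℝ)⁻¹, tendsto_nhdsWithin_iff.2 ⟨?_, ?_⟩, ?_⟩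
  · have := (hx.mono_right nhdsWithin_le_nhds).rpow_const (p := (q : ℝ)⁻¹) (Or.inr hq'.le)
    rwa [Real.zero_rpow hq'.ne'] at this
  · exact hpos.mono fun i hi => Real.rpow_pos_of_pos hi _
  · exact hpos.mono fun i hi => Real.rpow_inv_natCast_pow hi.le hq.ne'

theorem followsArc_taylorForm {d : ℕ} {a : ℕ → ℝ → ℝ} {R : ℝ × ℝ → ℝ} {x y : ι → ℝ} (hd : 0 < d)
    (ha : ∀ i < d, AnalyticAt ℝ (a i) 0) (ha0 : ∀ i < d, a i 0 = 0)
    (had : ∀ᶠ x in 𝓝 0, a (d - 1) x = 0) (hane : ∃ i < d, ¬ ∀ᶠ x in 𝓝 0, a i x = 0)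
    (hR : AnalyticAt ℝ R 0) (hR0 : R 0 ≠ 0)
    (ih : ∀ g : ℝ × ℝ → ℝ, AnalyticAt ℝ g 0 → (∃ k < d, (derivSnd^[k] g) 0 ≠ 0) →
      ∀ s w : ι → ℝ, Tendsto s L (𝓝[>] 0) → Tendsto w L (𝓝 0) →
      IsFlat L s (fun i => g (s i, w i)) → FollowsArc L g s w)
    (hx : Tendsto x L (𝓝[>] 0)) (hy : Tendsto y L (𝓝 0))
    (hflat : IsFlat L x fun i => taylorForm d a R (x i, y i)) :
    FollowsArc L (taylorForm d a R) x y := by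
  obtain ⟨p, q, i₀, B, hp, hq, hi₀, hBi₀, hB, haB, hB0⟩ := exists_newton_slope ha ha0 hane
  obtain ⟨s, hs, hsx⟩ := exists_root_tendsto hx hq
  have hs0 : Tendsto s L (𝓝 0) := hs.mono_right nhdsWithin_le_nhds
  have hs_ne : ∀ᶠ i in L, s i ≠ 0 :=
    (hs.eventually self_mem_nhdsWithin).mono fun _ => ne_of_gt
  have haB' : ∀ᶠ s in 𝓝 (0 : ℝ), ∀ i < d, a i (s ^ q) = s ^ (p * (d - i)) * B i s :=
    (finite_lt_nat d).eventually_all.2 haB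
  set Y : ι → ℝ := fun i => y i / s i ^ p
  have hYy : ∀ᶠ i in L, s i ^ p * Y i = y i :=
    hs_ne.mono fun i hi => mul_div_cancel₀ _ (pow_ne_zero p hi)
  have hflatY : IsFlat L s fun i =>
      taylorForm d B (fun z => R (z.1 ^ q, z.1 ^ p * z.2)) (s i, Y i) := by
    refine IsFlat.of_mul_pow (k := p * d) hs_ne ((hflat.of_pow hq hs0 hsx).congr' ?_)
    filter_upwards [hYy, hsx, hs0.eventually haB'] with i hYy hsx haB
    rw [← taylorForm_pow_pow_mul (Y i) haB, hYy, hsx]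
  have hRlim : Tendsto (fun i => R (s i ^ q, s i ^ p * Y i)) L (𝓝 (R 0)) := by
    refine (hR.continuousAt.tendsto.comp
      ((hx.mono_right nhdsWithin_le_nhds).prodMk_nhds hy)).congr' ?_
    filter_upwards [hYy, hsx] with i hYy hsx
    rw [hYy, hsx, Function.comp_apply]
  obtain ⟨c, hc⟩ := exists_tendsto_of_tendsto_polynomial (β := fun i k => B i (s k))
    (fun i hi => (hB i hi).continuousAt.tendsto.comp hs0) hR0 hd hRlim (Y := Y)
    (hflatY.tendsto_zero hs0)
  refine FollowsArc.of_blowUp (n := p * d) (g := newtonBlowUp d p q B R c) (c := c)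
    (w := fun i => Y i - c) hp hq ?_ hs0 hsx (by simpa only [add_sub_cancel] using hYy) (ih _
      (analyticAt_newtonBlowUp hp hq hB hR c) (exists_iterate_derivSnd_newtonBlowUp_ne_zero hp hq hB
        hR (hB0 _ (Nat.sub_lt hd one_pos) had) hi₀ hBi₀ c) s _ hs (by simpa using hc.sub_const c)
      (by simpa only [newtonBlowUp, add_sub_cancel] using hflatY))
  filter_upwards [(continuousAt_fst.tendsto : Tendsto Prod.fst (𝓝 (0 : ℝ × ℝ)) _).eventually haB']
    with z hz using taylorForm_pow_pow_mul _ hz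

theorem followsArc_of_isFlat {f : ℝ × ℝ → ℝ} {d : ℕ} (hf : AnalyticAt ℝ f 0)
    (hfd : (derivSnd^[d] f) 0 ≠ 0) {x y : ι → ℝ} (hx : Tendsto x L (𝓝[>] 0))
    (hy : Tendsto y L (𝓝 0)) (hflat : IsFlat L x fun i => f (x i, y i)) : FollowsArc L f x y := by
  induction d using Nat.strong_induction_on generalizing f x y with
  | _ d ih =>
  by_cases hlow : ∃ k < d, (derivSnd^[k] f) 0 ≠ 0
  · obtain ⟨k, hk, hfk⟩ := hlow
    exact ih k hk hf hfk hx hy hflat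
  push Not at hlow
  have hx0 : Tendsto x L (𝓝 0) := hx.mono_right nhdsWithin_le_nhds
  rcases d.eq_zero_or_pos with rfl | hd
  · exact absurd (tendsto_nhds_unique (hf.continuousAt.tendsto.comp (hx0.prodMk_nhds hy))
      (hflat.tendsto_zero hx0)) hfd
  obtain ⟨φ, a, R, hφ, hφ0, ha, ha0, had, hR, hR0, hfR⟩ :=
    exists_comp_shearSnd_eventuallyEq_taylorForm hf hd hlow hfd
  have hφx : Tendsto (fun i => φ (x i)) L (𝓝 0) := hφ0 ▸ hφ.continuousAt.tendsto.comp hx0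
  have hy' : Tendsto (fun i => y i - φ (x i)) L (𝓝 0) := by simpa using hy.sub hφx
  have hflat' : IsFlat L x fun i => (f ∘ shearSnd φ) (x i, y i - φ (x i)) := by
    simpa [shearSnd] using hflat
  refine FollowsArc.of_comp_shearSnd hφ hφ0 ?_
  by_cases hane : ∃ i < d, ¬ ∀ᶠ x in 𝓝 0, a i x = 0
  · have hxy := hx0.prodMk_nhds hy'
    refine (followsArc_taylorForm hd (fun i _ => ha i) ha0 had hane hR hR0 ?_ hx hy'
      (hflat'.congr' (hxy.eventually hfR))).congr hfR.symm
    rintro g hg ⟨k, hk, hgk⟩ s w hs hw hflat_g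
    exact ih k hk hg hgk hs hw hflat_g
  · push Not at hane
    refine FollowsArc.of_eventuallyEq_pow_mul hd hR.continuousAt hR0 (hfR.trans ?_) hx hy' hflat'
    have hane' : ∀ᶠ x in 𝓝 (0 : ℝ), ∀ i < d, a i x = 0 := (finite_lt_nat d).eventually_all.2 hane
    filter_upwards [(continuousAt_fst.tendsto : Tendsto Prod.fst (𝓝 (0 : ℝ × ℝ)) _).eventually
      hane'] with z hz
    rw [taylorForm, Finset.sum_eq_zero fun i hi => by rw [hz i (Finset.mem_range.1 hi), zero_mul],
      zero_add]

end PuiseuxArc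

section Flat

variable {ι : Type*} {L : Filter ι} [L.NeBot]

theorem eventually_nonneg_of_isFlat {G : ℝ → ℝ} (hG : AnalyticAt ℝ G 0) {σ g : ι → ℝ}
    (hσ : Tendsto σ L (𝓝[>] 0)) (hg : ∀ᶠ i in L, 0 ≤ g i)
    (hflat : IsFlat L σ fun i => g i - G (σ i)) : ∀ᶠ s in 𝓝[>] (0 : ℝ), 0 ≤ G s := by
  by_cases hG0 : ∀ᶠ s in 𝓝 (0 : ℝ), G s = 0
  · exact (hG0.filter_mono nhdsWithin_le_nhds).mono fun s hs => hs.ge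
  obtain ⟨n, b, hb, hb0, hGb⟩ := hG.exists_eventuallyEq_pow_smul_nonzero_iff.2 hG0
  simp only [sub_zero, smul_eq_mul] at hGb
  have hσ0 : Tendsto σ L (𝓝 0) := hσ.mono_right nhdsWithin_le_nhds
  have hσ_pos : ∀ᶠ i in L, 0 < σ i := hσ.eventually self_mem_nhdsWithin
  have hquot : Tendsto (fun i => g i / σ i ^ n) L (𝓝 (b 0)) := by
    have hrem : IsFlat L σ fun i => g i / σ i ^ n - b (σ i) := by
      refine IsFlat.of_mul_pow (k := n) (hσ_pos.mono fun _ => ne_of_gt) (hflat.congr' ?_)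
      filter_upwards [hσ_pos, hσ0.eventually hGb] with i hi hGi
      rw [hGi]
      field_simp
    simpa using (hrem.tendsto_zero hσ0).add (hb.continuousAt.tendsto.comp hσ0)
  have hb_nonneg : 0 ≤ b 0 := ge_of_tendsto hquot <| by
    filter_upwards [hg, hσ_pos] with i hi hσi using div_nonneg hi (pow_pos hσi n).le
  filter_upwards [self_mem_nhdsWithin, hGb.filter_mono nhdsWithin_le_nhds,
    (hb.continuousAt.eventually (lt_mem_nhds (hb_nonneg.lt_of_ne' hb0))).filter_mono
      nhdsWithin_le_nhds] with s hs hGs hbs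
  rw [hGs]
  exact mul_nonneg (pow_pos hs n).le hbs.le

variable {E : Type*} [NormedAddCommGroup E]

theorem exists_seq_isFlat {h : E → ℝ} {S : Set E} {p : E}
    (hS : ∀ m : ℕ, ∃ᶠ z in 𝓝 p, z ∈ S ∧ |h z| < ‖z - p‖ ^ m) :
    ∃ z : ℕ → E, (∀ k, z k ∈ S) ∧ (∀ k, z k ≠ p) ∧ Tendsto z atTop (𝓝 p) ∧
      IsFlat atTop (fun k => ‖z k - p‖) fun k => h (z k) := by
  have hsel : ∀ k : ℕ, ∃ z ∈ S, |h z| < ‖z - p‖ ^ (k + 1) ∧ ‖z - p‖ < 1 / ((k : ℝ) + 1) := by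
    intro k
    have hball : ∀ᶠ z in 𝓝 p, ‖z - p‖ < 1 / ((k : ℝ) + 1) := by
      filter_upwards [Metric.ball_mem_nhds p (Nat.one_div_pos_of_nat (n := k))] with z hz
        using mem_ball_iff_norm.1 hz
    obtain ⟨z, ⟨hzS, hzh⟩, hzp⟩ := ((hS (k + 1)).and_eventually hball).exists
    exact ⟨z, hzS, hzh, hzp⟩
  choose z hzS hzh hzp using hsel
  have hlim : Tendsto (fun k => ‖z k - p‖) atTop (𝓝 0) :=
    squeeze_zero (fun k => norm_nonneg _) (fun k => (hzp k).le)
      tendsto_one_div_add_atTop_nhds_zero_nat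
  refine ⟨z, hzS, fun k hk => ?_, tendsto_iff_norm_sub_tendsto_zero.2 hlim, fun N => ?_⟩
  · have := hzh k
    rw [hk, sub_self, norm_zero, zero_pow k.succ_ne_zero] at this
    exact this.not_ge (abs_nonneg _)
  · refine IsBigO.of_bound 1 ?_
    filter_upwards [eventually_ge_atTop N, hlim.eventually (gt_mem_nhds zero_lt_one)] with k hk hk1
    rw [one_mul, norm_pow, norm_norm]
    exact (hzh k).le.trans (pow_le_pow_of_le_one (norm_nonneg _) hk1.le (by omega))

end Flat

theorem exists_line_not_eventually_zero {E : Type*} [NormedAddCommGroup E] [NormedSpace ℝ E]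
    {h : E → ℝ} {p : E} (hh : AnalyticAt ℝ h p) (hne : ¬ ∀ᶠ z in 𝓝 p, h z = 0)
    {V : Submodule ℝ E} (hV : V ≠ ⊤) : ∃ e ∉ V, ¬ ∀ᶠ w in 𝓝 (0 : ℝ), h (p + w • e) = 0 := by
  obtain ⟨r, hr, hball⟩ := Metric.eventually_nhds_iff_ball.1 hh.eventually_analyticAt
  obtain ⟨z, hz, hzr⟩ := ((not_eventually.1 hne).and_eventually (Metric.ball_mem_nhds p hr)).exists
  have hVdense : Dense (V : Set E)ᶜ := interior_eq_empty_iff_dense_compl.1 <|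
    not_nonempty_iff_eq_empty.1 fun hint => hV (V.eq_top_of_nonempty_interior' hint)
  have hnear : ∀ᶠ e in 𝓝 (z - p), h (p + e) ≠ 0 ∧ p + e ∈ Metric.ball p r := by
    have hcont : Tendsto (p + ·) (𝓝 (z - p)) (𝓝 z) :=
      (continuous_const_add p).tendsto' _ _ (add_sub_cancel p z)
    exact hcont.eventually (((hball z hzr).continuousAt.eventually_ne hz).and
      (Metric.isOpen_ball.mem_nhds hzr))
  obtain ⟨e, ⟨hhe, her⟩, heV⟩ := hVdense.inter_nhds_nonempty hnear |>.imp fun _ h => h.symm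
  refine ⟨e, heV, fun hzero => hhe ?_⟩
  have hline : AnalyticOnNhd ℝ (fun w : ℝ => h (p + w • e)) (Icc 0 1) := by
    intro w hw
    refine AnalyticAt.fun_comp (f := fun w : ℝ => p + w • e) (hball _ ?_)
      (analyticAt_const.add (analyticAt_id.smul analyticAt_const))
    rw [mem_ball_iff_norm, add_sub_cancel_left] at her ⊢
    rw [norm_smul, Real.norm_of_nonneg hw.1]
    exact (mul_le_of_le_one_left (norm_nonneg _) hw.2).trans_lt her
  simpa using hline.eqOn_zero_of_preconnected_of_eventuallyEq_zero isPreconnected_Icc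
    (left_mem_Icc.2 zero_le_one) hzero (right_mem_Icc.2 zero_le_one)

theorem exists_iterate_derivSnd_ne_zero {f : ℝ × ℝ → ℝ} (hf : AnalyticAt ℝ f 0)
    (hne : ¬ ∀ᶠ w in 𝓝 (0 : ℝ), f (0, w) = 0) : ∃ d : ℕ, (derivSnd^[d] f) 0 ≠ 0 := by
  have hg : AnalyticAt ℝ (fun w : ℝ => f (0, w)) 0 :=
    hf.fun_comp (f := fun w : ℝ => ((0 : ℝ), w)) (x := 0) (analyticAt_const.prod analyticAt_id)
  obtain ⟨d, hd⟩ := ENat.ne_top_iff_exists.1 (mt analyticOrderAt_eq_top.1 hne)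
  refine ⟨d, ?_⟩
  rw [iterate_derivSnd_zero hf]
  exact ((analyticOrderAt_eq_nat_iff_iteratedDeriv_eq_zero hg).1 hd.symm).2

section LinearChart

/-- The planar determinant of two vectors. -/
def planarDet (ζ e : ℝ × ℝ) : ℝ := ζ.1 * e.2 - ζ.2 * e.1

/-- The affine coordinates of the plane with origin `p` and axes `ζ` and `e`. -/
def affineChart (p ζ e w : ℝ × ℝ) : ℝ × ℝ := p + (w.1 • ζ + w.2 • e)

variable {p ζ e : ℝ × ℝ}

theorem affineChart_zero : affineChart p ζ e 0 = p := by simp [affineChart]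

theorem analyticAt_affineChart (w : ℝ × ℝ) : AnalyticAt ℝ (affineChart p ζ e) w :=
  analyticAt_const.add
    ((analyticAt_fst.smul analyticAt_const).add (analyticAt_snd.smul analyticAt_const))

theorem affineChart_injective (hdet : planarDet ζ e ≠ 0) :
    Function.Injective (affineChart p ζ e) := by
  intro w w' h
  have hlin := add_left_cancel h
  have h₁ : w.1 * ζ.1 + w.2 * e.1 = w'.1 * ζ.1 + w'.2 * e.1 := congrArg Prod.fst hlin
  have h₂ : w.1 * ζ.2 + w.2 * e.2 = w'.1 * ζ.2 + w'.2 * e.2 := congrArg Prod.snd hlin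
  unfold planarDet at hdet
  refine Prod.ext (mul_right_cancel₀ hdet ?_) (mul_right_cancel₀ hdet ?_)
  · linear_combination e.2 * h₁ - e.1 * h₂
  · linear_combination ζ.1 * h₂ - ζ.2 * h₁

theorem affineChart_cramer (hdet : planarDet ζ e ≠ 0) (z : ℝ × ℝ) :
    affineChart p ζ e (planarDet (z - p) e / planarDet ζ e, planarDet ζ (z - p) / planarDet ζ e) =
      z := by
  have h₁ : planarDet (z - p) e * ζ.1 + planarDet ζ (z - p) * e.1 =
      (z - p).1 * planarDet ζ e := by simp only [planarDet]; ring
  have h₂ : planarDet (z - p) e * ζ.2 + planarDet ζ (z - p) * e.2 =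
      (z - p).2 * planarDet ζ e := by simp only [planarDet]; ring
  refine Prod.ext ?_ ?_
  · simp only [affineChart, Prod.fst_add, Prod.smul_fst, smul_eq_mul]
    rw [div_mul_eq_mul_div, div_mul_eq_mul_div, ← add_div, h₁, mul_div_cancel_right₀ _ hdet,
      Prod.fst_sub, add_sub_cancel]
  · simp only [affineChart, Prod.snd_add, Prod.smul_snd, smul_eq_mul]
    rw [div_mul_eq_mul_div, div_mul_eq_mul_div, ← add_div, h₂, mul_div_cancel_right₀ _ hdet,
      Prod.snd_sub, add_sub_cancel]

theorem planarDet_smul_left (r : ℝ) (z e : ℝ × ℝ) : planarDet (r • z) e = r * planarDet z e := by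
  simp only [planarDet, Prod.smul_fst, Prod.smul_snd, smul_eq_mul]
  ring

theorem continuous_planarDet : Continuous fun z : (ℝ × ℝ) × (ℝ × ℝ) => planarDet z.1 z.2 := by
  unfold planarDet
  fun_prop

theorem planarDet_ne_zero_of_notMem_span (hζ : ζ ≠ 0) (he : e ∉ Submodule.span ℝ {ζ}) :
    planarDet ζ e ≠ 0 := by
  contrapose! he
  rw [planarDet, sub_eq_zero] at he
  rw [Submodule.mem_span_singleton]
  by_cases h₁ : ζ.1 = 0
  · have h₂ : ζ.2 ≠ 0 := fun h₂ => hζ (Prod.ext h₁ h₂)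
    refine ⟨e.2 / ζ.2, Prod.ext ?_ (div_mul_cancel₀ _ h₂)⟩
    rw [h₁, zero_mul, zero_eq_mul] at he
    simp [h₁, he.resolve_left h₂]
  · refine ⟨e.1 / ζ.1, Prod.ext (div_mul_cancel₀ _ h₁) ?_⟩
    rw [Prod.smul_snd, smul_eq_mul, div_mul_eq_mul_div, mul_comm, ← he, mul_div_cancel_left₀ _ h₁]

variable {ι : Type*} {L : Filter ι} {z : ι → ℝ × ℝ}

theorem exists_affineChart_coordinates (hdet : planarDet ζ e ≠ 0) (hz : Tendsto z L (𝓝 p))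
    (hzp : ∀ i, z i ≠ p) (hdir : Tendsto (fun i => ‖z i - p‖⁻¹ • (z i - p)) L (𝓝 ζ)) :
    ∃ x y : ι → ℝ, (∀ i, affineChart p ζ e (x i, y i) = z i) ∧ Tendsto x L (𝓝[>] 0) ∧
      Tendsto y L (𝓝 0) ∧ (fun i => ‖z i - p‖) =O[L] x := by
  refine ⟨fun i => planarDet (z i - p) e / planarDet ζ e,
    fun i => planarDet ζ (z i - p) / planarDet ζ e, fun i => affineChart_cramer hdet (z i), ?_⟩
  have hsub : Tendsto (fun i => z i - p) L (𝓝 0) := by simpa using hz.sub_const p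
  have hpos : ∀ i, 0 < ‖z i - p‖ := fun i => norm_pos_iff.2 (sub_ne_zero.2 (hzp i))
  have hratio : ∀ᶠ i in L, ‖z i - p‖ ≤ 2 * (planarDet (z i - p) e / planarDet ζ e) := by
    have hlim := ((continuous_planarDet.tendsto (ζ, e)).comp
      (hdir.prodMk_nhds tendsto_const_nhds)).div_const (planarDet ζ e)
    rw [div_self hdet] at hlim
    filter_upwards [hlim.eventually (lt_mem_nhds one_half_lt_one)] with i hi
    rw [Function.comp_apply, planarDet_smul_left, mul_div_assoc, lt_inv_mul_iff₀ (hpos i)] at hi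
    linarith
  refine ⟨tendsto_nhdsWithin_iff.2 ⟨?_, ?_⟩, ?_, IsBigO.of_bound 2 ?_⟩
  · simpa [planarDet] using ((continuous_planarDet.tendsto (0, e)).comp
      (hsub.prodMk_nhds tendsto_const_nhds)).div_const (planarDet ζ e)
  · filter_upwards [hratio] with i hi
    exact mem_Ioi.2 (by linarith [hpos i])
  · simpa [planarDet] using ((continuous_planarDet.tendsto (ζ, 0)).comp
      (tendsto_const_nhds.prodMk_nhds hsub)).div_const (planarDet ζ e)
  · filter_upwards [hratio] with i hi
    rw [norm_norm]
    exact hi.trans (mul_le_mul_of_nonneg_left (Real.le_norm_self _) zero_le_two)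

end LinearChart

theorem exists_arc_of_isFlat {ι : Type*} {L : Ultrafilter ι} {h : ℝ × ℝ → ℝ} {p : ℝ × ℝ}
    (hh : AnalyticAt ℝ h p) (hne : ¬ ∀ᶠ z in 𝓝 p, h z = 0) {z : ι → ℝ × ℝ}
    (hz : Tendsto z L (𝓝 p)) (hzp : ∀ i, z i ≠ p)
    (hflat : IsFlat L (fun i => ‖z i - p‖) fun i => h (z i)) :
    ∃ (Γ : ℝ → ℝ × ℝ) (σ : ι → ℝ), AnalyticAt ℝ Γ 0 ∧ Γ 0 = p ∧ (∀ s > 0, Γ s ≠ p) ∧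
      (∀ᶠ s in 𝓝 0, h (Γ s) = 0) ∧ Tendsto σ L (𝓝[>] 0) ∧
      IsFlat L σ fun i => ‖z i - Γ (σ i)‖ := by
  obtain ⟨ζ, hζ, hdir⟩ := exists_tendsto_of_eventually_mem L (isCompact_sphere (0 : ℝ × ℝ) 1)
    (f := fun i => ‖z i - p‖⁻¹ • (z i - p)) (Eventually.of_forall fun i => by
      rw [mem_sphere_zero_iff_norm, norm_smul, norm_inv, norm_norm]
      exact inv_mul_cancel₀ (norm_ne_zero_iff.2 (sub_ne_zero.2 (hzp i))))
  have hζ0 : ζ ≠ 0 := ne_zero_of_mem_unit_sphere ⟨ζ, hζ⟩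
  obtain ⟨e, he, hline⟩ := exists_line_not_eventually_zero hh hne
    (V := Submodule.span ℝ {ζ}) (Submodule.lt_top_of_finrank_lt_finrank <| by
      rw [finrank_span_singleton hζ0, Module.finrank_prod, Module.finrank_self]
      norm_num).ne
  have hdet := planarDet_ne_zero_of_notMem_span hζ0 he
  obtain ⟨x, y, hxy, hx, hy, hzx⟩ := exists_affineChart_coordinates hdet hz hzp hdir
  have hf : AnalyticAt ℝ (h ∘ affineChart p ζ e) 0 :=
    AnalyticAt.comp (by rwa [affineChart_zero]) (analyticAt_affineChart 0)
  obtain ⟨d, hd⟩ := exists_iterate_derivSnd_ne_zero hf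
    (by simpa only [Function.comp_apply, affineChart, zero_smul, zero_add] using hline)
  obtain ⟨q, ψ, σ, hq, hψ, hψ0, hσ, hσx, hψh, hψ_flat⟩ := followsArc_of_isFlat hf hd hx hy
    (by simpa only [Function.comp_apply, hxy] using hflat.trans_isBigO hzx)
  refine ⟨fun s => affineChart p ζ e (s ^ q, ψ s), σ, ?_, ?_, fun s hs h0 => ?_, hψh, hσ, ?_⟩
  · exact AnalyticAt.fun_comp (analyticAt_affineChart _) ((analyticAt_id.pow q).prod hψ)
  · beta_reduce
    rw [zero_pow hq.ne', hψ0, Prod.mk_zero_zero, affineChart_zero]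
  · have := affineChart_injective hdet (h0.trans affineChart_zero.symm)
    exact (pow_pos hs q).ne' (congrArg Prod.fst this)
  · refine fun N => ((IsBigO.of_bound ‖e‖ ?_).trans (hψ_flat N))
    filter_upwards [hσx] with i hi
    rw [← hxy i, hi, affineChart, affineChart, norm_norm, add_sub_add_left_eq_sub,
      add_sub_add_left_eq_sub, ← sub_smul, norm_smul, mul_comm]

namespace IsClosedSemianalyticAt

variable {S : Set (ℝ × ℝ)} {p : ℝ × ℝ}

theorem eventually_arc_mem (hS : IsClosedSemianalyticAt S p) {ι : Type*} {L : Ultrafilter ι}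
    {z : ι → ℝ × ℝ} (hz : Tendsto z L (𝓝 p)) (hzS : ∀ᶠ i in L, z i ∈ S) {Γ : ℝ → ℝ × ℝ}
    (hΓ : AnalyticAt ℝ Γ 0) (hΓ0 : Γ 0 = p) {σ : ι → ℝ} (hσ : Tendsto σ L (𝓝[>] 0))
    (hflat : IsFlat L σ fun i => ‖z i - Γ (σ i)‖) : ∀ᶠ s in 𝓝[>] 0, Γ s ∈ S := by
  obtain ⟨m, n, g, hg, hgS⟩ := hS
  subst hΓ0
  obtain ⟨i, hi⟩ : ∃ i, ∀ᶠ k in L, ∀ j, 0 ≤ g i j (z k) := by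
    rw [← Ultrafilter.eventually_exists_iff]
    filter_upwards [hz.eventually hgS, hzS] with k hk hkS using hk.1 hkS
  have hpos : ∀ j, ∀ᶠ s in 𝓝[>] (0 : ℝ), 0 ≤ g i j (Γ s) := fun j => by
    refine eventually_nonneg_of_isFlat (AnalyticAt.fun_comp (hg i j) hΓ) hσ
      (g := fun k => g i j (z k)) (hi.mono fun k hk => hk j) fun N => ?_
    have hpair : Tendsto (fun k => (z k, Γ (σ k))) L (𝓝 (Γ 0, Γ 0)) :=
      hz.prodMk_nhds (hΓ.continuousAt.tendsto.comp (hσ.mono_right nhdsWithin_le_nhds))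
    exact ((hg i j).hasStrictFDerivAt.isBigO_sub.comp_tendsto hpair).norm_right.trans (hflat N)
  filter_upwards [eventually_all.2 hpos,
    (hΓ.continuousAt.tendsto.eventually hgS).filter_mono nhdsWithin_le_nhds] with s hs hsS
    using hsS.2 ⟨i, hs⟩

theorem lojasiewicz_inequality (hS : IsClosedSemianalyticAt S p) {h : ℝ × ℝ → ℝ}
    (hh : AnalyticAt ℝ h p) (hiso : ∀ᶠ z in 𝓝 p, z ∈ S → h z = 0 → z = p) :
    ∃ m : ℕ, ∀ᶠ z in 𝓝 p, z ∈ S → ‖z - p‖ ^ m ≤ |h z| := by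
  by_contra! hcon
  obtain ⟨z, hzS, hzp, hz, hflat⟩ := exists_seq_isFlat hcon
  set L : Ultrafilter ℕ := hyperfilter ℕ
  have hL : (L : Filter ℕ) ≤ atTop := Nat.hyperfilter_le_atTop
  have hne : ¬ ∀ᶠ z in 𝓝 p, h z = 0 := fun hzero => by
    obtain ⟨k, hk, hzero⟩ := (hz.eventually (hiso.and hzero)).exists
    exact hzp k (hk (hzS k) hzero)
  obtain ⟨Γ, σ, hΓ, hΓ0, hΓp, hΓh, hσ, hΓflat⟩ := exists_arc_of_isFlat (L := L) hh hne
    (hz.mono_left hL) hzp fun N => (hflat N).mono hL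
  have hΓS := hS.eventually_arc_mem (hz.mono_left hL) (Eventually.of_forall hzS) hΓ hΓ0 hσ hΓflat
  have hΓiso : ∀ᶠ s in 𝓝 0, Γ s ∈ S → h (Γ s) = 0 → Γ s = p :=
    (by simpa only [hΓ0] using hΓ.continuousAt.tendsto : Tendsto Γ (𝓝 0) (𝓝 p)).eventually hiso
  obtain ⟨s, hs, hsS, hsh, hsp⟩ := (eventually_mem_nhdsWithin.and (hΓS.and
    ((hΓh.and hΓiso).filter_mono nhdsWithin_le_nhds))).exists
  exact hΓp s hs (hsp hsS hsh)

end IsClosedSemianalyticAt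

/-! ### Branches -/

theorem exists_sub_eq_mul_sub_of_hasDerivWithinAt {f f' : ℝ → ℝ} {a b x y : ℝ}
    (hf : ∀ z ∈ Icc a b, HasDerivWithinAt f (f' z) (Icc a b) z) (hax : a ≤ x) (hxy : x < y)
    (hyb : y ≤ b) : ∃ ξ ∈ Ioo x y, f y - f x = f' ξ * (y - x) := by
  have hsub : Icc x y ⊆ Icc a b := Icc_subset_Icc hax hyb
  obtain ⟨ξ, hξ, hslope⟩ := exists_hasDerivAt_eq_slope f f' hxy
    (fun z hz => (hf z (hsub hz)).continuousWithinAt.mono hsub)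
    (fun z hz => (hf z (hsub (Ioo_subset_Icc_self hz))).hasDerivAt
      (Icc_mem_nhds (hax.trans_lt hz.1) (hz.2.trans_le hyb)))
  exact ⟨ξ, hξ, by rw [hslope, div_mul_cancel₀ _ (sub_ne_zero.2 hxy.ne')]⟩

/-- The right branch of a Lorenz map: critical point `c`, parameter `v`, diffeomorphic part `φ` with
derivative `ψ`. Left branches are brought into this form by the reflection `x ↦ 1 - x`. -/
structure Branch where
  c : ℝ
  v : ℝ
  φ : ℝ → ℝ
  ψ : ℝ → ℝ

namespace Branch

/-- Bounds satisfied by the branches of maps close to standard maps. The numerical constants are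
one convenient choice. -/
structure IsTame (B : Branch) : Prop where
  c_pos : 0 < B.c
  c_lt_one : B.c < 1
  v_nonneg : 0 ≤ B.v
  v_le_one : B.v ≤ 1
  map_zero : B.φ 0 = 0
  map_one : B.φ 1 = 1
  hasDeriv : ∀ x ∈ Icc (0 : ℝ) 1, HasDerivWithinAt B.φ (B.ψ x) (Icc 0 1) x
  half_le : ∀ x ∈ Icc (0 : ℝ) 1, 1 / 2 ≤ B.ψ x
  le_two : ∀ x ∈ Icc (0 : ℝ) 1, B.ψ x ≤ 2
  lipschitz : ∀ x ∈ Icc (0 : ℝ) 1, ∀ y ∈ Icc (0 : ℝ) 1, |B.ψ x - B.ψ y| ≤ |x - y|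

/-- The affine coordinate on `[c, 1]`. -/
noncomputable def coord (B : Branch) (x : ℝ) : ℝ := (x - B.c) / (1 - B.c)

/-- The branch before application of the diffeomorphic part. -/
noncomputable def core (α : ℝ) (B : Branch) (x : ℝ) : ℝ :=
  1 + B.v * (-1 + (B.coord x) ^ α)

/-- The branch as a map. -/
noncomputable def map (α : ℝ) (B : Branch) (x : ℝ) : ℝ := B.φ (B.core α x)

/-- The derivative of the branch. -/
noncomputable def slope (α : ℝ) (B : Branch) (x : ℝ) : ℝ :=
  B.ψ (B.core α x) * (B.v * (α * (B.coord x) ^ (α - 1) / (1 - B.c)))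

variable {α : ℝ} {B : Branch}

theorem coord_c : B.coord B.c = 0 := by simp [coord]

theorem core_c (hα : 1 < α) : B.core α B.c = 1 - B.v := by
  rw [core, coord_c, Real.zero_rpow (by linarith)]
  ring

theorem map_c (hα : 1 < α) : B.map α B.c = B.φ (1 - B.v) := by rw [map, core_c hα]

theorem hasDerivAt_core (hα : 1 < α) (x : ℝ) :
    HasDerivAt (B.core α) (B.v * (α * (B.coord x) ^ (α - 1) / (1 - B.c))) x := by
  have hcoord : HasDerivAt B.coord (1 / (1 - B.c)) x :=
    ((hasDerivAt_id x).sub_const B.c).div_const _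
  have hpow := (Real.hasDerivAt_rpow_const (x := B.coord x) (p := α) (Or.inr hα.le)).comp x hcoord
  refine (((hpow.const_add (-1)).const_mul B.v).const_add 1).congr_deriv ?_
  ring

namespace IsTame

theorem c_mem_Icc (hB : B.IsTame) : B.c ∈ Icc B.c 1 := left_mem_Icc.2 hB.c_lt_one.le

theorem coord_one (hB : B.IsTame) : B.coord 1 = 1 := div_self (sub_pos.2 hB.c_lt_one).ne'

theorem coord_lt_coord (hB : B.IsTame) {x y : ℝ} (hxy : x < y) : B.coord x < B.coord y :=
  div_lt_div_of_pos_right (by linarith) (sub_pos.2 hB.c_lt_one)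

theorem coord_pos (hB : B.IsTame) {x : ℝ} (hx : B.c < x) : 0 < B.coord x :=
  coord_c (B := B) ▸ hB.coord_lt_coord hx

theorem coord_mem (hB : B.IsTame) {x : ℝ} (hx : x ∈ Icc B.c 1) : B.coord x ∈ Icc (0 : ℝ) 1 := by
  have hc := sub_pos.2 hB.c_lt_one
  refine ⟨div_nonneg (by linarith [hx.1]) hc.le, ?_⟩
  rw [coord, div_le_one hc]
  linarith [hx.2]

theorem core_one (hB : B.IsTame) : B.core α 1 = 1 := by simp [core, hB.coord_one]

theorem core_mem (hB : B.IsTame) (hα : 1 < α) {x : ℝ} (hx : x ∈ Icc B.c 1) :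
    B.core α x ∈ Icc (0 : ℝ) 1 := by
  have hcoord := hB.coord_mem hx
  have hpow_nonneg : 0 ≤ B.coord x ^ α := Real.rpow_nonneg hcoord.1 _
  have hpow_le : B.coord x ^ α ≤ 1 := Real.rpow_le_one hcoord.1 hcoord.2 (by linarith)
  have hv := hB.v_nonneg
  have hv' := hB.v_le_one
  constructor <;> rw [core] <;> nlinarith

theorem core_strictMonoOn (hB : B.IsTame) (hα : 1 < α) (hv : 0 < B.v) :
    StrictMonoOn (B.core α) (Icc B.c 1) := by
  intro x hx y _ hxy
  have hpow : B.coord x ^ α < B.coord y ^ α :=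
    Real.rpow_lt_rpow (hB.coord_mem hx).1 (hB.coord_lt_coord hxy) (by linarith)
  simp only [core]
  gcongr

theorem core_monotoneOn (hB : B.IsTame) (hα : 1 < α) : MonotoneOn (B.core α) (Icc B.c 1) := by
  rcases hB.v_nonneg.eq_or_lt with hv | hv
  · intro x _ y _ _
    simp [core, ← hv]
  · exact (hB.core_strictMonoOn hα hv).monotoneOn

theorem half_mul_le_φ_sub (hB : B.IsTame) {x y : ℝ} (hx : 0 ≤ x) (hxy : x ≤ y) (hy : y ≤ 1) :
    (y - x) / 2 ≤ B.φ y - B.φ x := by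
  rcases hxy.eq_or_lt with rfl | hxy
  · simp
  obtain ⟨ξ, hξ, h⟩ := exists_sub_eq_mul_sub_of_hasDerivWithinAt hB.hasDeriv hx hxy hy
  have := hB.half_le ξ ⟨hx.trans hξ.1.le, hξ.2.le.trans hy⟩
  rw [h]
  nlinarith

theorem φ_sub_le (hB : B.IsTame) {x y : ℝ} (hx : 0 ≤ x) (hxy : x ≤ y) (hy : y ≤ 1) :
    B.φ y - B.φ x ≤ 2 * (y - x) := by
  rcases hxy.eq_or_lt with rfl | hxy
  · simp
  obtain ⟨ξ, hξ, h⟩ := exists_sub_eq_mul_sub_of_hasDerivWithinAt hB.hasDeriv hx hxy hy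
  rw [h]
  have := hB.le_two ξ ⟨hx.trans hξ.1.le, hξ.2.le.trans hy⟩
  gcongr

theorem φ_strictMonoOn (hB : B.IsTame) : StrictMonoOn B.φ (Icc 0 1) := by
  intro x hx y hy hxy
  have := hB.half_mul_le_φ_sub hx.1 hxy.le hy.2
  linarith

theorem φ_mem (hB : B.IsTame) {x : ℝ} (hx : x ∈ Icc (0 : ℝ) 1) : B.φ x ∈ Icc (0 : ℝ) 1 :=
  ⟨hB.map_zero ▸ hB.φ_strictMonoOn.monotoneOn (by simp) hx hx.1,
    hB.map_one ▸ hB.φ_strictMonoOn.monotoneOn hx (by simp) hx.2⟩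

theorem continuousOn_φ (hB : B.IsTame) : ContinuousOn B.φ (Icc 0 1) :=
  fun x hx => (hB.hasDeriv x hx).continuousWithinAt

theorem continuousOn_ψ (hB : B.IsTame) : ContinuousOn B.ψ (Icc 0 1) :=
  LipschitzOnWith.continuousOn (K := 1) <| LipschitzOnWith.of_dist_le_mul fun x hx y hy => by
    simpa [Real.dist_eq] using hB.lipschitz x hx y hy

theorem ψ_pos (hB : B.IsTame) {x : ℝ} (hx : x ∈ Icc (0 : ℝ) 1) : 0 < B.ψ x :=
  one_half_pos.trans_le (hB.half_le x hx)

theorem map_fix_one (hB : B.IsTame) : B.map α 1 = 1 := by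
  rw [map, hB.core_one, hB.map_one]

theorem map_mem (hB : B.IsTame) (hα : 1 < α) {x : ℝ} (hx : x ∈ Icc B.c 1) :
    B.map α x ∈ Icc (0 : ℝ) 1 := hB.φ_mem (hB.core_mem hα hx)

theorem map_monotoneOn (hB : B.IsTame) (hα : 1 < α) : MonotoneOn (B.map α) (Icc B.c 1) :=
  hB.φ_strictMonoOn.monotoneOn.comp (hB.core_monotoneOn hα) fun _ => hB.core_mem hα

theorem map_strictMonoOn (hB : B.IsTame) (hα : 1 < α) (hv : 0 < B.v) :
    StrictMonoOn (B.map α) (Icc B.c 1) :=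
  hB.φ_strictMonoOn.comp (hB.core_strictMonoOn hα hv) fun _ => hB.core_mem hα

theorem hasDerivWithinAt_map (hB : B.IsTame) (hα : 1 < α) {x : ℝ} (hx : x ∈ Icc B.c 1) :
    HasDerivWithinAt (B.map α) (B.slope α x) (Icc B.c 1) x :=
  HasDerivWithinAt.comp x (hB.hasDeriv _ (hB.core_mem hα hx))
    (hasDerivAt_core hα x).hasDerivWithinAt fun _ => hB.core_mem hα

theorem continuousOn_map (hB : B.IsTame) (hα : 1 < α) : ContinuousOn (B.map α) (Icc B.c 1) :=
  fun _ hx => (hB.hasDerivWithinAt_map hα hx).continuousWithinAt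

theorem exists_map_sub_eq (hB : B.IsTame) (hα : 1 < α) {x y : ℝ} (hx : B.c ≤ x) (hxy : x < y)
    (hy : y ≤ 1) : ∃ ξ ∈ Ioo x y, B.map α y - B.map α x = B.slope α ξ * (y - x) :=
  exists_sub_eq_mul_sub_of_hasDerivWithinAt (fun _ => hB.hasDerivWithinAt_map hα) hx hxy hy

theorem slope_one (hB : B.IsTame) : B.slope α 1 = B.ψ 1 * (B.v * (α / (1 - B.c))) := by
  rw [slope, hB.core_one, hB.coord_one, Real.one_rpow, mul_one]

theorem map_le_self (hB : B.IsTame) (hα : 1 < α) (hc : B.map α B.c < B.c)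
    (hfix : ∀ x ∈ Ioo B.c 1, B.map α x ≠ x) {x : ℝ} (hx : x ∈ Icc B.c 1) : B.map α x ≤ x := by
  by_contra! hlt
  have hx1 : x < 1 := hx.2.lt_of_ne fun h => by simp [h, hB.map_fix_one] at hlt
  have hcont : ContinuousOn (fun y => B.map α y - y) (Icc B.c x) :=
    ((hB.continuousOn_map hα).mono (Icc_subset_Icc le_rfl hx.2)).sub continuousOn_id
  obtain ⟨y, hy, hy0⟩ := intermediate_value_Ioo hx.1 hcont
    (show (0 : ℝ) ∈ Ioo _ _ from ⟨by linarith, by linarith⟩)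
  exact hfix y ⟨hy.1, hy.2.trans hx1⟩ (sub_eq_zero.1 hy0)

theorem eq_one_of_tendsto (hB : B.IsTame) (hα : 1 < α) (hc : B.map α B.c < B.c)
    (hfix : ∀ x ∈ Ioo B.c 1, B.map α x ≠ x) {X : ℕ → ℝ} {y : ℝ} (hX : ∀ j, X j ∈ Icc B.c 1)
    (hy : Tendsto X atTop (𝓝 y)) (hy' : Tendsto (fun j => B.map α (X j)) atTop (𝓝 y)) :
    y = 1 := by
  have hyI : y ∈ Icc B.c 1 := isClosed_Icc.mem_of_tendsto hy (Eventually.of_forall hX)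
  have hfixy : B.map α y = y := tendsto_nhds_unique ((hB.continuousOn_map hα y hyI).tendsto.comp
    (tendsto_nhdsWithin_iff.2 ⟨hy, Eventually.of_forall hX⟩)) hy'
  have hcy : B.c < y := hyI.1.lt_of_ne fun h => by
    rw [← h] at hfixy
    exact hc.ne hfixy
  exact hyI.2.eq_of_not_lt fun hlt => hfix y ⟨hcy, hlt⟩ hfixy

end IsTame

/-- Convergence of tame branches along a filter, with uniform convergence of the diffeomorphic parts
and of their derivatives. -/
structure TendsTo {ι : Type*} (L : Filter ι) (B : ι → Branch) (B₀ : Branch) : Prop where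
  isTame : ∀ i, (B i).IsTame
  isTame_limit : B₀.IsTame
  c : Tendsto (fun i => (B i).c) L (𝓝 B₀.c)
  v : Tendsto (fun i => (B i).v) L (𝓝 B₀.v)
  φ : TendstoUniformlyOn (fun i => (B i).φ) B₀.φ L (Icc 0 1)
  ψ : TendstoUniformlyOn (fun i => (B i).ψ) B₀.ψ L (Icc 0 1)

namespace TendsTo

variable {ι κ : Type*} {L : Filter ι} {𝓑 : ι → Branch}

theorem comp {K : Filter κ} {k : κ → ι} (h : TendsTo L 𝓑 B) (hk : Tendsto k K L) :
    TendsTo K (fun i => 𝓑 (k i)) B where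
  isTame := fun i => h.isTame (k i)
  isTame_limit := h.isTame_limit
  c := h.c.comp hk
  v := h.v.comp hk
  φ := fun u hu => hk.eventually (h.φ u hu)
  ψ := fun u hu => hk.eventually (h.ψ u hu)

theorem mono {L' : Filter ι} (h : TendsTo L 𝓑 B) (hL : L' ≤ L) : TendsTo L' 𝓑 B :=
  h.comp (tendsto_id'.2 hL)

theorem const (hB : B.IsTame) : TendsTo L (fun _ => B) B where
  isTame := fun _ => hB
  isTame_limit := hB
  c := tendsto_const_nhds
  v := tendsto_const_nhds
  φ := fun _ hu => Eventually.of_forall fun _ _ _ => refl_mem_uniformity hu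
  ψ := fun _ hu => Eventually.of_forall fun _ _ _ => refl_mem_uniformity hu

theorem coord (h : TendsTo L 𝓑 B) {X : ι → ℝ} {x : ℝ} (hX : Tendsto X L (𝓝 x)) :
    Tendsto (fun i => (𝓑 i).coord (X i)) L (𝓝 (B.coord x)) :=
  (hX.sub h.c).div (tendsto_const_nhds.sub h.c) (sub_pos.2 h.isTame_limit.c_lt_one).ne'

theorem core (h : TendsTo L 𝓑 B) (hα : 1 < α) {X : ι → ℝ} {x : ℝ} (hX : Tendsto X L (𝓝 x)) :
    Tendsto (fun i => (𝓑 i).core α (X i)) L (𝓝 (B.core α x)) :=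
  (h.v.mul (((h.coord hX).rpow_const (Or.inr (by linarith))).const_add (-1))).const_add 1

theorem mem_of_tendsto [L.NeBot] (h : TendsTo L 𝓑 B) {X : ι → ℝ} {x : ℝ}
    (hX : Tendsto X L (𝓝 x)) (hXs : ∀ᶠ i in L, X i ∈ Icc (𝓑 i).c 1) : x ∈ Icc B.c 1 :=
  ⟨le_of_tendsto_of_tendsto h.c hX (hXs.mono fun _ hi => hi.1),
    le_of_tendsto hX (hXs.mono fun _ hi => hi.2)⟩

theorem core_nhdsWithin [L.NeBot] (h : TendsTo L 𝓑 B) (hα : 1 < α) {X : ι → ℝ} {x : ℝ}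
    (hX : Tendsto X L (𝓝 x)) (hXs : ∀ᶠ i in L, X i ∈ Icc (𝓑 i).c 1) :
    Tendsto (fun i => (𝓑 i).core α (X i)) L (𝓝[Icc 0 1] (B.core α x)) :=
  tendsto_nhdsWithin_iff.2 ⟨h.core hα hX, hXs.mono fun i hi => (h.isTame i).core_mem hα hi⟩

theorem map [L.NeBot] (h : TendsTo L 𝓑 B) (hα : 1 < α) {X : ι → ℝ} {x : ℝ}
    (hX : Tendsto X L (𝓝 x)) (hXs : ∀ᶠ i in L, X i ∈ Icc (𝓑 i).c 1) :
    Tendsto (fun i => (𝓑 i).map α (X i)) L (𝓝 (B.map α x)) :=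
  h.φ.tendsto_comp (h.isTame_limit.continuousOn_φ _
    (h.isTame_limit.core_mem hα (h.mem_of_tendsto hX hXs))) (h.core_nhdsWithin hα hX hXs)

theorem ψ_core [L.NeBot] (h : TendsTo L 𝓑 B) (hα : 1 < α) {X : ι → ℝ} {x : ℝ}
    (hX : Tendsto X L (𝓝 x)) (hXs : ∀ᶠ i in L, X i ∈ Icc (𝓑 i).c 1) :
    Tendsto (fun i => (𝓑 i).ψ ((𝓑 i).core α (X i))) L (𝓝 (B.ψ (B.core α x))) :=
  h.ψ.tendsto_comp (h.isTame_limit.continuousOn_ψ _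
    (h.isTame_limit.core_mem hα (h.mem_of_tendsto hX hXs))) (h.core_nhdsWithin hα hX hXs)

theorem slope [L.NeBot] (h : TendsTo L 𝓑 B) (hα : 1 < α) {X : ι → ℝ} {x : ℝ}
    (hX : Tendsto X L (𝓝 x)) (hXs : ∀ᶠ i in L, X i ∈ Icc (𝓑 i).c 1) :
    Tendsto (fun i => (𝓑 i).slope α (X i)) L (𝓝 (B.slope α x)) :=
  (h.ψ_core hα hX hXs).mul (h.v.mul
    ((((h.coord hX).rpow_const (Or.inr (by linarith))).const_mul α).div
      (tendsto_const_nhds.sub h.c) (sub_pos.2 h.isTame_limit.c_lt_one).ne'))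

theorem of_map [L.NeBot] (h : TendsTo L 𝓑 B) (hα : 1 < α) (hv : 0 < B.v) {X : ι → ℝ} {x : ℝ}
    (hXs : ∀ᶠ i in L, X i ∈ Icc (𝓑 i).c 1) (hx : x ∈ Icc B.c 1)
    (hX : Tendsto (fun i => (𝓑 i).map α (X i)) L (𝓝 (B.map α x))) :
    Tendsto X L (𝓝 x) := by
  rw [tendsto_iff_ultrafilter]
  intro G hG
  have hXG : ∀ᶠ i in (G : Filter ι), X i ∈ Icc (𝓑 i).c 1 := hXs.filter_mono hG
  obtain ⟨x', -, hx'⟩ : ∃ x' ∈ Icc (0 : ℝ) 1, Tendsto X G (𝓝 x') :=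
    exists_tendsto_of_eventually_mem G isCompact_Icc
      (hXG.mono fun i hi => ⟨(h.isTame i).c_pos.le.trans hi.1, hi.2⟩)
  have hmap : B.map α x' = B.map α x :=
    tendsto_nhds_unique ((h.mono hG).map hα hx' hXG) (hX.mono_left hG)
  rwa [(h.isTame_limit.map_strictMonoOn hα hv).injOn ((h.mono hG).mem_of_tendsto hx' hXG) hx hmap]
    at hx'

theorem iterate [L.NeBot] (h : TendsTo L 𝓑 B) (hα : 1 < α) {X : ι → ℝ} {x : ℝ}
    (hX : Tendsto X L (𝓝 x)) {k : ℕ}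
    (hXs : ∀ j < k, ∀ᶠ i in L, ((𝓑 i).map α)^[j] (X i) ∈ Icc (𝓑 i).c 1) :
    Tendsto (fun i => ((𝓑 i).map α)^[k] (X i)) L (𝓝 ((B.map α)^[k] x)) := by
  induction k with
  | zero => exact hX
  | succ k ih =>
    simp only [Function.iterate_succ_apply']
    exact h.map hα (ih fun j hj => hXs j (by omega)) (hXs k (by omega))

theorem eq_one_of_forall_iterate [L.NeBot] (h : TendsTo L 𝓑 B) (hα : 1 < α)
    (hc : B.map α B.c < B.c) (hfix : ∀ x ∈ Ioo B.c 1, B.map α x ≠ x) {X : ι → ℝ} {x : ℝ}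
    (hX : Tendsto X L (𝓝 x))
    (hXs : ∀ j : ℕ, ∀ᶠ i in L, ((𝓑 i).map α)^[j] (X i) ∈ Icc (𝓑 i).c 1) : x = 1 := by
  have hmem : ∀ j, (B.map α)^[j] x ∈ Icc B.c 1 := fun j =>
    h.mem_of_tendsto (h.iterate hα hX fun k _ => hXs k) (hXs j)
  have hanti : Antitone fun j => (B.map α)^[j] x := antitone_nat_of_succ_le fun j => by
    rw [Function.iterate_succ_apply']
    exact h.isTame_limit.map_le_self hα hc hfix (hmem j)
  obtain ⟨y, hy⟩ : ∃ y, Tendsto (fun j => (B.map α)^[j] x) atTop (𝓝 y) :=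
    ⟨_, tendsto_atTop_ciInf hanti ⟨B.c, forall_mem_range.2 fun j => (hmem j).1⟩⟩
  have hy' := (tendsto_add_atTop_iff_nat 1).2 hy
  simp only [Function.iterate_succ_apply'] at hy'
  obtain rfl := h.isTame_limit.eq_one_of_tendsto hα hc hfix hmem hy hy'
  exact le_antisymm (hmem 0).2 (hanti.le_of_tendsto hy 0)

end TendsTo

end Branch

/-! ### Expansion along long orbits -/

theorem abs_log_sub_log_le_div {m x y : ℝ} (hm : 0 < m) (hx : m ≤ x) (hy : m ≤ y) :
    |Real.log x - Real.log y| ≤ |x - y| / m := by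
  have log_sub_le : ∀ {x y : ℝ}, m ≤ x → m ≤ y → Real.log x - Real.log y ≤ |x - y| / m := by
    intro x y hx hy
    have hy0 := hm.trans_le hy
    calc Real.log x - Real.log y = Real.log (x / y) :=
          (Real.log_div (hm.trans_le hx).ne' hy0.ne').symm
      _ ≤ x / y - 1 := Real.log_le_sub_one_of_pos (div_pos (hm.trans_le hx) hy0)
      _ = (x - y) / y := by field_simp
      _ ≤ |x - y| / m := div_le_div₀ (abs_nonneg _) (le_abs_self _) hm hy
  exact abs_sub_le_iff.2 ⟨log_sub_le hx hy, abs_sub_comm x y ▸ log_sub_le hy hx⟩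

theorem tendsto_sum_range_of_dominated {ι G : Type*} [NormedAddCommGroup G] [CompleteSpace G]
    {L : Filter ι} {f : ι → ℕ → G} {g : ℕ → G} {bound : ℕ → ℝ} {a : ι → ℕ}
    (hbound : Summable bound) (hnonneg : ∀ j, 0 ≤ bound j) (ha : Tendsto a L atTop)
    (hf : ∀ j, Tendsto (fun i => f i j) L (𝓝 (g j)))
    (hle : ∀ᶠ i in L, ∀ j < a i, ‖f i j‖ ≤ bound j) :
    Tendsto (fun i => ∑ j ∈ Finset.range (a i), f i j) L (𝓝 (∑' j, g j)) := by
  have hsum : ∀ i, ∑ j ∈ Finset.range (a i), f i j = ∑' j, if j < a i then f i j else 0 := by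
    intro i
    rw [tsum_eq_sum (s := Finset.range (a i)) fun j hj => if_neg (by simpa using hj)]
    exact Finset.sum_congr rfl fun j hj => (if_pos (Finset.mem_range.1 hj)).symm
  simp only [hsum]
  refine tendsto_tsum_of_dominated_convergence hbound (fun j => ?_) ?_
  · refine (hf j).congr' ?_
    filter_upwards [ha.eventually_gt_atTop j] with i hi
    rw [if_pos hi]
  · filter_upwards [hle] with i hi j
    split_ifs with hj
    · exact hi j hj
    · simpa using hnonneg j

namespace Branch

variable {α : ℝ} {B : Branch}

/-- Logarithm of the ratio between the slope at `x` and the slope at the fixed point `1`. -/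
noncomputable def logSlope (α : ℝ) (B : Branch) (x : ℝ) : ℝ :=
  Real.log (B.ψ (B.core α x)) - Real.log (B.ψ 1) + (α - 1) * Real.log (B.coord x)

namespace IsTame

theorem slope_eq_exp (hB : B.IsTame) (hα : 1 < α) {x : ℝ} (hx : x ∈ Ioc B.c 1) :
    B.slope α x = B.slope α 1 * Real.exp (B.logSlope α x) := by
  have hψ : 0 < B.ψ (B.core α x) := hB.ψ_pos (hB.core_mem hα (Ioc_subset_Icc_self hx))
  have hψ1 : 0 < B.ψ 1 := hB.ψ_pos (by simp)
  rw [logSlope, Real.exp_add, Real.exp_sub, Real.exp_log hψ, Real.exp_log hψ1, hB.slope_one, slope,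
    Real.rpow_def_of_pos (hB.coord_pos hx.1), mul_comm (α - 1)]
  field_simp

theorem one_sub_coord (hB : B.IsTame) (x : ℝ) : 1 - B.coord x = (1 - x) / (1 - B.c) := by
  rw [coord, one_sub_div (sub_pos.2 hB.c_lt_one).ne']
  ring

theorem abs_log_ψ_core_sub_le (hB : B.IsTame) (hα : 1 < α) {x : ℝ} (hx : x ∈ Icc B.c 1) :
    |Real.log (B.ψ (B.core α x)) - Real.log (B.ψ 1)| ≤ 2 * α * (1 - B.coord x) := by
  have hcore := hB.core_mem hα hx
  have hcoord := hB.coord_mem hx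
  have hbernoulli : 1 + α * (B.coord x - 1) ≤ B.coord x ^ α := by
    simpa using one_add_mul_self_le_rpow_one_add (by linarith [hcoord.1] : -1 ≤ B.coord x - 1) hα.le
  have hpow : B.coord x ^ α ≤ 1 := Real.rpow_le_one hcoord.1 hcoord.2 (by linarith)
  calc |Real.log (B.ψ (B.core α x)) - Real.log (B.ψ 1)|
      ≤ |B.ψ (B.core α x) - B.ψ 1| / (1 / 2) :=
        abs_log_sub_log_le_div one_half_pos (hB.half_le _ hcore) (hB.half_le 1 (by simp))
    _ ≤ |B.core α x - 1| / (1 / 2) := by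
        exact div_le_div_of_nonneg_right (hB.lipschitz _ hcore 1 (by simp)) one_half_pos.le
    _ = 2 * (B.v * (1 - B.coord x ^ α)) := by
        rw [abs_of_nonpos (by linarith [hcore.2]), core]
        ring
    _ ≤ 2 * (1 * (α * (1 - B.coord x))) := by
        gcongr
        · exact hB.v_le_one
        · linarith
    _ = 2 * α * (1 - B.coord x) := by ring

theorem abs_logSlope_le (hB : B.IsTame) (hα : 1 < α) {x s : ℝ} (hx : x ∈ Icc B.c 1) (hs : 0 < s)
    (hsx : s ≤ B.coord x) :
    |B.logSlope α x| ≤ (2 * α + (α - 1) / s) * ((1 - x) / (1 - B.c)) := by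
  have hcoord := hB.coord_mem hx
  have hlog : |Real.log (B.coord x)| ≤ (1 - B.coord x) / s := by
    have h := abs_log_sub_log_le_div hs hsx (hsx.trans hcoord.2)
    rwa [Real.log_one, sub_zero, abs_sub_comm, abs_of_nonneg (sub_nonneg.2 hcoord.2)] at h
  rw [← hB.one_sub_coord, logSlope, add_mul]
  refine (abs_add_le _ _).trans (add_le_add (hB.abs_log_ψ_core_sub_le hα hx) ?_)
  rw [abs_mul, abs_of_pos (sub_pos.2 hα), div_mul_eq_mul_div, mul_div_assoc]
  exact mul_le_mul_of_nonneg_left hlog (sub_pos.2 hα).le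

theorem iterate_mem (hB : B.IsTame) (hα : 1 < α) {y : ℝ} {a : ℕ} (hy1 : y ≤ 1)
    (hy : ∀ i < a, B.c ≤ (B.map α)^[i] y) {i : ℕ} (hi : i < a) :
    (B.map α)^[i] y ∈ Icc B.c 1 := by
  induction i with
  | zero => exact ⟨hy 0 hi, hy1⟩
  | succ i ih =>
    refine ⟨hy _ hi, ?_⟩
    rw [Function.iterate_succ_apply']
    exact (hB.map_mem hα (ih (by omega))).2

theorem iterate_lt_iterate (hB : B.IsTame) (hα : 1 < α) (hv : 0 < B.v) {y z : ℝ} {a : ℕ}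
    (hyz : y < z) (hz : z ≤ 1) (hy : ∀ i < a, B.c ≤ (B.map α)^[i] y) {i : ℕ} (hi : i ≤ a) :
    (B.map α)^[i] y < (B.map α)^[i] z ∧ (B.map α)^[i] z ≤ 1 := by
  induction i with
  | zero => exact ⟨hyz, hz⟩
  | succ i ih =>
    obtain ⟨hlt, hle⟩ := ih (by omega)
    rw [Function.iterate_succ_apply', Function.iterate_succ_apply']
    have hym := hB.iterate_mem hα (hyz.le.trans hz) hy (by omega : i < a)
    have hzm : (B.map α)^[i] z ∈ Icc B.c 1 := ⟨hym.1.trans hlt.le, hle⟩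
    exact ⟨hB.map_strictMonoOn hα hv hym hzm hlt, (hB.map_mem hα hzm).2⟩

/- Each step of the pair of orbits expands by an intermediate slope, which is the slope at the fixed
point times the exponential of `logSlope`. -/
theorem exists_iterate_sub_iterate_eq (hB : B.IsTame) (hα : 1 < α) (hv : 0 < B.v) {y z : ℝ} {a : ℕ}
    (hyz : y < z) (hz : z ≤ 1) (hy : ∀ i < a, B.c ≤ (B.map α)^[i] y) :
    ∃ ξ : ℕ → ℝ, (∀ i < a, ξ i ∈ Ioo ((B.map α)^[i] y) ((B.map α)^[i] z)) ∧
      (B.map α)^[a] z - (B.map α)^[a] y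
        = (z - y) * (B.slope α 1 ^ a * Real.exp (∑ i ∈ Finset.range a, B.logSlope α (ξ i))) := by
  have hstep : ∀ i < a, ∃ ξ ∈ Ioo ((B.map α)^[i] y) ((B.map α)^[i] z),
      (B.map α)^[i + 1] z - (B.map α)^[i + 1] y
        = B.slope α ξ * ((B.map α)^[i] z - (B.map α)^[i] y) := by
    intro i hi
    obtain ⟨hlt, hle⟩ := hB.iterate_lt_iterate hα hv hyz hz hy hi.le
    simpa only [Function.iterate_succ_apply'] using hB.exists_map_sub_eq hα (hy i hi) hlt hle
  choose! ξ hξ hslope using hstep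
  refine ⟨ξ, hξ, ?_⟩
  suffices hprod : ∀ k ≤ a, (B.map α)^[k] z - (B.map α)^[k] y
      = (z - y) * (B.slope α 1 ^ k * Real.exp (∑ i ∈ Finset.range k, B.logSlope α (ξ i))) from
    hprod a le_rfl
  intro k
  induction k with
  | zero => simp
  | succ k ih =>
    intro hk
    have hka : k < a := by omega
    have hz1 := (hB.iterate_lt_iterate hα hv hyz hz hy hka.le).2
    rw [hslope k hka, ih hka.le,
      hB.slope_eq_exp hα ⟨(hy k hka).trans_lt (hξ k hka).1, (hξ k hka).2.le.trans hz1⟩,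
      Finset.sum_range_succ, Real.exp_add, pow_succ]
    ring

end IsTame

/-- A backward orbit of the critical point which converges to the fixed point `1`. -/
structure IsBackwardOrbit (α : ℝ) (B : Branch) (o : ℕ → ℝ) : Prop where
  mem : ∀ j, o j ∈ Ioo B.c 1
  map_zero : B.map α (o 0) = B.c
  map_succ : ∀ j, B.map α (o (j + 1)) = o j
  tendsto : Tendsto o atTop (𝓝 1)

theorem IsTame.exists_isBackwardOrbit (hB : B.IsTame) (hα : 1 < α) (hv : B.v = 1)
    (hfix : ∀ x ∈ Ioo B.c 1, B.map α x ≠ x) : ∃ o, B.IsBackwardOrbit α o := by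
  have hc0 : B.map α B.c = 0 := by rw [map_c hα, hv, sub_self, hB.map_zero]
  have hc : B.map α B.c < B.c := hc0 ▸ hB.c_pos
  have hsurj : ∀ y ∈ Ioo (0 : ℝ) 1, ∃ x ∈ Ioo B.c 1, B.map α x = y := fun y hy =>
    intermediate_value_Ioo hB.c_lt_one.le (hB.continuousOn_map hα)
      (by rwa [hc0, hB.map_fix_one])
  choose! g hg hmap using hsurj
  have hmem : ∀ j, g^[j] B.c ∈ Ioo (0 : ℝ) 1 := by
    intro j
    induction j with
    | zero => exact ⟨hB.c_pos, hB.c_lt_one⟩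
    | succ j ih =>
      rw [Function.iterate_succ_apply']
      exact ⟨hB.c_pos.trans (hg _ ih).1, (hg _ ih).2⟩
  have hmem' : ∀ j, g^[j + 1] B.c ∈ Ioo B.c 1 := fun j => by
    rw [Function.iterate_succ_apply']
    exact hg _ (hmem j)
  have hmap' : ∀ j, B.map α (g^[j + 1] B.c) = g^[j] B.c := fun j => by
    rw [Function.iterate_succ_apply', hmap _ (hmem j)]
  have hmono : Monotone fun j => g^[j + 1] B.c := monotone_nat_of_le_succ fun j => by
    rw [← hmap' (j + 1)]
    exact hB.map_le_self hα hc hfix (Ioo_subset_Icc_self (hmem' (j + 1)))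
  obtain ⟨y, hy⟩ : ∃ y, Tendsto (fun j => g^[j + 1] B.c) atTop (𝓝 y) :=
    ⟨_, tendsto_atTop_ciSup hmono ⟨1, forall_mem_range.2 fun j => (hmem' j).2.le⟩⟩
  have hy1 : y = 1 := hB.eq_one_of_tendsto hα hc hfix
    (fun j => Ioo_subset_Icc_self (hmem' (j + 1))) ((tendsto_add_atTop_iff_nat 1).2 hy)
    (by simpa only [hmap'] using hy)
  exact ⟨fun j => g^[j + 1] B.c, hmem', hmap' 0, fun j => hmap' (j + 1), hy1 ▸ hy⟩

/-- The orbit of `y` up to time `a - 1`, read backwards; meaningful for `j < a` only, because of the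
truncated subtraction. -/
noncomputable def reverseOrbit (α : ℝ) (B : Branch) (a : ℕ) (y : ℝ) (j : ℕ) : ℝ :=
  (B.map α)^[a - 1 - j] y

section reverseOrbit

variable {a : ℕ} {y : ℝ}

theorem map_reverseOrbit_zero (ha : 0 < a) :
    B.map α (B.reverseOrbit α a y 0) = (B.map α)^[a] y := by
  rw [reverseOrbit, ← Function.iterate_succ_apply' (f := B.map α)]
  congr 1
  omega

theorem map_reverseOrbit_succ {j : ℕ} (hj : j + 1 < a) :
    B.map α (B.reverseOrbit α a y (j + 1)) = B.reverseOrbit α a y j := by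
  rw [reverseOrbit, ← Function.iterate_succ_apply' (f := B.map α), reverseOrbit]
  congr 1
  omega

theorem reverseOrbit_le_reverseOrbit (hmap : ∀ x ∈ Icc B.c 1, B.map α x ≤ x)
    (hy : ∀ j < a, B.reverseOrbit α a y j ∈ Icc B.c 1) {i j : ℕ} (hij : i ≤ j) (hj : j < a) :
    B.reverseOrbit α a y i ≤ B.reverseOrbit α a y j := by
  induction j, hij using Nat.le_induction with
  | base => exact le_rfl
  | succ j _ ih =>
    refine (ih (by omega)).trans ?_
    rw [← map_reverseOrbit_succ hj]
    exact hmap _ (hy _ hj)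

theorem IsTame.mul_one_sub_le (hB : B.IsTame) (hα : 1 < α) {r μ x : ℝ}
    (hslope : ∀ x ∈ Icc r 1, μ ≤ B.slope α x) (hx : x ∈ Icc B.c 1) (hr : r ≤ x) :
    μ * (1 - x) ≤ 1 - B.map α x := by
  rcases hx.2.eq_or_lt with rfl | hlt
  · simp [hB.map_fix_one]
  obtain ⟨ξ, hξ, heq⟩ := hB.exists_map_sub_eq hα hx.1 hlt le_rfl
  rw [hB.map_fix_one] at heq
  rw [heq]
  exact mul_le_mul_of_nonneg_right (hslope ξ ⟨hr.trans hξ.1.le, hξ.2.le⟩) (sub_nonneg.2 hx.2)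

theorem IsTame.pow_mul_one_sub_reverseOrbit_le (hB : B.IsTame) (hα : 1 < α) {r μ : ℝ} (hμ : 0 ≤ μ)
    (hslope : ∀ x ∈ Icc r 1, μ ≤ B.slope α x) (hmap : ∀ x ∈ Icc B.c 1, B.map α x ≤ x)
    (hy : ∀ j < a, B.reverseOrbit α a y j ∈ Icc B.c 1) {J k : ℕ}
    (hJ : r ≤ B.reverseOrbit α a y J) (hk : J + k < a) :
    μ ^ k * (1 - B.reverseOrbit α a y (J + k)) ≤ 1 := by
  induction k with
  | zero => linarith [(hy _ hk).1, hB.c_pos]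
  | succ k ih =>
    have hr : r ≤ B.reverseOrbit α a y (J + k + 1) :=
      hJ.trans (reverseOrbit_le_reverseOrbit hmap hy (by omega) hk)
    have hstep : μ * (1 - B.reverseOrbit α a y (J + k + 1)) ≤ 1 - B.reverseOrbit α a y (J + k) :=
      (hB.mul_one_sub_le hα hslope (hy _ hk) hr).trans_eq
        (by rw [← map_reverseOrbit_succ (j := J + k) hk]; rfl)
    calc μ ^ (k + 1) * (1 - B.reverseOrbit α a y (J + k + 1))
        = μ ^ k * (μ * (1 - B.reverseOrbit α a y (J + k + 1))) := by ring
      _ ≤ μ ^ k * (1 - B.reverseOrbit α a y (J + k)) := by gcongr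
      _ ≤ 1 := ih (by omega)

end reverseOrbit

namespace TendsTo

variable {ι : Type*} {L : Filter ι} {𝓑 : ι → Branch}

theorem logSlope [L.NeBot] (h : TendsTo L 𝓑 B) (hα : 1 < α) {X : ι → ℝ} {x : ℝ}
    (hX : Tendsto X L (𝓝 x)) (hx : B.c < x) (hXs : ∀ᶠ i in L, X i ∈ Icc (𝓑 i).c 1) :
    Tendsto (fun i => (𝓑 i).logSlope α (X i)) L (𝓝 (B.logSlope α x)) := by
  have hB := h.isTame_limit
  have hψ := hB.ψ_pos (hB.core_mem hα (h.mem_of_tendsto hX hXs))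
  have hψ1 : Tendsto (fun i => (𝓑 i).ψ 1) L (𝓝 (B.ψ 1)) := h.ψ.tendsto_at (by simp)
  exact (((h.ψ_core hα hX hXs).log hψ.ne').sub (hψ1.log (hB.ψ_pos (by simp)).ne')).add
    (((h.coord hX).log (hB.coord_pos hx).ne').const_mul _)

theorem exists_abs_logSlope_le (h : TendsTo L 𝓑 B) (hα : 1 < α) {s : ℝ} (hs : 0 < s) :
    ∃ K, 0 ≤ K ∧ ∀ᶠ i in L, ∀ x ∈ Icc (𝓑 i).c 1, s ≤ (𝓑 i).coord x →
      |(𝓑 i).logSlope α x| ≤ K * (1 - x) := by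
  have hc : 0 < 1 - B.c := sub_pos.2 h.isTame_limit.c_lt_one
  have hα' : 0 < α - 1 := sub_pos.2 hα
  have hconst : 0 ≤ 2 * α + (α - 1) / s := by positivity
  refine ⟨(2 * α + (α - 1) / s) / ((1 - B.c) / 2), by positivity, ?_⟩
  filter_upwards [(tendsto_const_nhds.sub h.c).eventually (lt_mem_nhds (half_lt_self hc))]
    with i hi x hx hsx
  have hx1 : 0 ≤ 1 - x := sub_nonneg.2 hx.2
  calc |(𝓑 i).logSlope α x| ≤ (2 * α + (α - 1) / s) * ((1 - x) / (1 - (𝓑 i).c)) :=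
        (h.isTame i).abs_logSlope_le hα hx hs hsx
    _ ≤ (2 * α + (α - 1) / s) * ((1 - x) / ((1 - B.c) / 2)) := by gcongr
    _ = (2 * α + (α - 1) / s) / ((1 - B.c) / 2) * (1 - x) := by ring

theorem exists_lt_slope [L.NeBot] (h : TendsTo L 𝓑 B) (hα : 1 < α) {μ : ℝ}
    (hμ : μ < B.slope α 1) : ∃ r < 1, ∀ᶠ i in L, ∀ x ∈ Icc r 1, μ < (𝓑 i).slope α x := by
  have hfst : Tendsto (Prod.fst : ι × ℝ → ι) (L ×ˢ 𝓝[≤] (1 : ℝ)) L := tendsto_fst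
  have hsnd : Tendsto (Prod.snd : ι × ℝ → ℝ) (L ×ˢ 𝓝[≤] (1 : ℝ)) (𝓝[≤] 1) := tendsto_snd
  have hsnd' := hsnd.mono_right nhdsWithin_le_nhds
  have hmem : ∀ᶠ z in L ×ˢ 𝓝[≤] (1 : ℝ), z.2 ∈ Icc (𝓑 z.1).c 1 := by
    filter_upwards [(h.c.comp hfst).eventually_lt hsnd' h.isTame_limit.c_lt_one,
      hsnd.eventually self_mem_nhdsWithin] with z hc hz
    exact ⟨hc.le, hz⟩
  obtain ⟨p, hp, q, hq, hpq⟩ := eventually_prod_iff.1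
    (((h.comp hfst).slope hα hsnd' hmem).eventually (lt_mem_nhds hμ))
  obtain ⟨r, hr, hrq⟩ := mem_nhdsLE_iff_exists_Icc_subset.1 hq
  exact ⟨r, hr, hp.mono fun i hi x hx => hpq hi (hrq hx)⟩

variable {o : ℕ → ℝ} {a : ι → ℕ} {Y : ι → ℝ}

/- By injectivity of the limit branch, orbits ending near the critical point shadow its backward
orbit. -/
theorem reverseOrbit [L.NeBot] (h : TendsTo L 𝓑 B) (hα : 1 < α) (hv : 0 < B.v)
    (ho : B.IsBackwardOrbit α o) (ha : Tendsto a L atTop)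
    (hY : ∀ i, ∀ j < a i, (𝓑 i).reverseOrbit α (a i) (Y i) j ∈ Icc (𝓑 i).c 1)
    (hend : Tendsto (fun i => ((𝓑 i).map α)^[a i] (Y i)) L (𝓝 B.c)) (j : ℕ) :
    Tendsto (fun i => (𝓑 i).reverseOrbit α (a i) (Y i) j) L (𝓝 (o j)) := by
  have hmem : ∀ j, ∀ᶠ i in L, (𝓑 i).reverseOrbit α (a i) (Y i) j ∈ Icc (𝓑 i).c 1 := fun j => by
    filter_upwards [ha.eventually_gt_atTop j] with i hi
    exact hY i j hi
  induction j with
  | zero =>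
    refine h.of_map hα hv (hmem 0) (Ioo_subset_Icc_self (ho.mem 0)) ?_
    rw [ho.map_zero]
    refine hend.congr' ?_
    filter_upwards [ha.eventually_gt_atTop 0] with i hi
    rw [map_reverseOrbit_zero hi]
  | succ j ih =>
    refine h.of_map hα hv (hmem _) (Ioo_subset_Icc_self (ho.mem _)) ?_
    rw [ho.map_succ]
    refine ih.congr' ?_
    filter_upwards [ha.eventually_gt_atTop (j + 1)] with i hi
    rw [map_reverseOrbit_succ hi]

theorem exists_one_sub_reverseOrbit_le [L.NeBot] (h : TendsTo L 𝓑 B) (hα : 1 < α)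
    (hexp : 1 < B.slope α 1) (hmap : ∀ i, ∀ x ∈ Icc (𝓑 i).c 1, (𝓑 i).map α x ≤ x)
    (ho : Tendsto o atTop (𝓝 1))
    (hY : ∀ i, ∀ j < a i, (𝓑 i).reverseOrbit α (a i) (Y i) j ∈ Icc (𝓑 i).c 1)
    (hback : ∀ j, Tendsto (fun i => (𝓑 i).reverseOrbit α (a i) (Y i) j) L (𝓝 (o j))) :
    ∃ C q : ℝ, 0 < C ∧ 0 < q ∧ q < 1 ∧
      ∀ᶠ i in L, ∀ j < a i, 1 - (𝓑 i).reverseOrbit α (a i) (Y i) j ≤ C * q ^ j := by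
  obtain ⟨μ, hμ1, hμ⟩ := exists_between hexp
  have hμ0 : 0 < μ := one_pos.trans hμ1
  obtain ⟨r, hr, hslope⟩ := h.exists_lt_slope hα hμ
  obtain ⟨J, hJ⟩ := (ho.eventually (lt_mem_nhds hr)).exists
  refine ⟨μ ^ J, μ⁻¹, by positivity, by positivity, inv_lt_one_of_one_lt₀ hμ1, ?_⟩
  filter_upwards [hslope, (hback J).eventually (lt_mem_nhds hJ)] with i hi hiJ j hj
  rcases le_total J j with hJj | hjJ
  · obtain ⟨k, rfl⟩ := Nat.exists_eq_add_of_le hJj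
    have hpow := (h.isTame i).pow_mul_one_sub_reverseOrbit_le hα hμ0.le
      (fun x hx => (hi x hx).le) (hmap i) (hY i) hiJ.le hj
    calc 1 - (𝓑 i).reverseOrbit α (a i) (Y i) (J + k)
        = μ⁻¹ ^ k * (μ ^ k * (1 - (𝓑 i).reverseOrbit α (a i) (Y i) (J + k))) := by
          rw [inv_pow, inv_mul_cancel_left₀ (by positivity)]
      _ ≤ μ⁻¹ ^ k * 1 := by gcongr
      _ = μ ^ J * μ⁻¹ ^ (J + k) := by
          rw [mul_one, pow_add, inv_pow μ J, mul_inv_cancel_left₀ (by positivity)]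
  · calc 1 - (𝓑 i).reverseOrbit α (a i) (Y i) j ≤ 1 := by
          linarith [(hY i j hj).1, (h.isTame i).c_pos]
      _ ≤ μ ^ J * μ⁻¹ ^ j := by
          rw [inv_pow, ← div_eq_mul_inv, one_le_div (by positivity)]
          exact pow_le_pow_right₀ hμ1.le hjJ

end TendsTo

/-- Pairs of points `y i < z i` of branches converging to `B` whose orbits stay above the critical
point up to time `a i`, with `a i → ∞`, and then end near the critical point. -/
structure LongOrbitPairs (α : ℝ) {ι : Type*} (L : Filter ι) (𝓑 : ι → Branch) (B : Branch)
    (a : ι → ℕ) (y z : ι → ℝ) : Prop extends TendsTo L 𝓑 B where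
  v_pos : ∀ i, 0 < (𝓑 i).v
  map_le : ∀ i, ∀ x ∈ Icc (𝓑 i).c 1, (𝓑 i).map α x ≤ x
  time : Tendsto a L atTop
  lt : ∀ i, y i < z i
  le_one : ∀ i, z i ≤ 1
  c_le : ∀ i, ∀ j < a i, (𝓑 i).c ≤ ((𝓑 i).map α)^[j] (y i)
  left_end : Tendsto (fun i => ((𝓑 i).map α)^[a i] (y i)) L (𝓝 B.c)
  right_end : Tendsto (fun i => ((𝓑 i).map α)^[a i] (z i)) L (𝓝 B.c)

/-- The limit of the expansion along long orbits, divided by a power of the slope at `1`. -/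
noncomputable def expansionFactor (α : ℝ) (B : Branch) (o : ℕ → ℝ) : ℝ :=
  Real.exp (∑' j, B.logSlope α (o j))

theorem expansionFactor_pos (o : ℕ → ℝ) : 0 < B.expansionFactor α o := Real.exp_pos _

namespace LongOrbitPairs

variable {ι : Type*} {L : Filter ι} {𝓑 : ι → Branch} {a : ι → ℕ} {y z : ι → ℝ} {o : ℕ → ℝ}

theorem iterate_lt (h : LongOrbitPairs α L 𝓑 B a y z) (hα : 1 < α) {i : ι} {j : ℕ} (hj : j < a i) :
    ((𝓑 i).map α)^[j] (y i) < ((𝓑 i).map α)^[j] (z i) ∧ ((𝓑 i).map α)^[j] (z i) ≤ 1 :=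
  (h.isTame i).iterate_lt_iterate hα (h.v_pos i) (h.lt i) (h.le_one i) (h.c_le i) hj.le

theorem left_mem (h : LongOrbitPairs α L 𝓑 B a y z) (hα : 1 < α) {i : ι} {j : ℕ} (hj : j < a i) :
    (𝓑 i).reverseOrbit α (a i) (y i) j ∈ Icc (𝓑 i).c 1 :=
  (h.isTame i).iterate_mem hα ((h.lt i).le.trans (h.le_one i)) (h.c_le i) (by omega)

theorem right_mem (h : LongOrbitPairs α L 𝓑 B a y z) (hα : 1 < α) {i : ι} {j : ℕ} (hj : j < a i) :
    (𝓑 i).reverseOrbit α (a i) (z i) j ∈ Icc (𝓑 i).c 1 :=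
  have hlt := h.iterate_lt hα (i := i) (j := a i - 1 - j) (by omega)
  ⟨(h.left_mem hα hj).1.trans hlt.1.le, hlt.2⟩

theorem exists_one_sub_le [L.NeBot] (h : LongOrbitPairs α L 𝓑 B a y z) (hα : 1 < α)
    (hv : 0 < B.v) (ho : B.IsBackwardOrbit α o) (hexp : 1 < B.slope α 1) :
    ∃ C q : ℝ, 0 < C ∧ 0 < q ∧ q < 1 ∧ ∀ᶠ i in L, 1 - z i ≤ C * q ^ a i := by
  have hmem := fun i j (hj : j < a i) => h.left_mem hα hj
  obtain ⟨C, q, hC, hq0, hq1, hbound⟩ := h.exists_one_sub_reverseOrbit_le hα hexp h.map_le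
    ho.tendsto hmem (h.toTendsTo.reverseOrbit hα hv ho h.time hmem h.left_end)
  refine ⟨C / q, q, div_pos hC hq0, hq0, hq1, ?_⟩
  filter_upwards [hbound, h.time.eventually_gt_atTop 0] with i hi ha
  have hlast := hi (a i - 1) (by omega)
  rw [Branch.reverseOrbit, Nat.sub_self, Function.iterate_zero, id_eq] at hlast
  calc 1 - z i ≤ C * q ^ (a i - 1) := by linarith [h.lt i]
    _ = C / q * q ^ a i := by
      rw [← pow_sub_one_mul ha.ne' q]
      field_simp

theorem tendsto_sum_logSlope [L.NeBot] (h : LongOrbitPairs α L 𝓑 B a y z) (hα : 1 < α)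
    (hv : 0 < B.v) (ho : B.IsBackwardOrbit α o) (hexp : 1 < B.slope α 1) {ξ : ι → ℕ → ℝ}
    (hξ : ∀ i, ∀ j < a i, ξ i j ∈ Ioo ((𝓑 i).reverseOrbit α (a i) (y i) j)
      ((𝓑 i).reverseOrbit α (a i) (z i) j)) :
    Tendsto (fun i => ∑ j ∈ Finset.range (a i), (𝓑 i).logSlope α (ξ i j)) L
      (𝓝 (∑' j, B.logSlope α (o j))) := by
  have hleft := h.toTendsTo.reverseOrbit hα hv ho h.time (fun i j => h.left_mem hα) h.left_end
  have hright := h.toTendsTo.reverseOrbit hα hv ho h.time (fun i j => h.right_mem hα) h.right_end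
  have hξmem : ∀ i, ∀ j < a i, ξ i j ∈ Icc (𝓑 i).c 1 := fun i j hj =>
    ⟨(h.left_mem hα hj).1.trans (hξ i j hj).1.le, (hξ i j hj).2.le.trans (h.right_mem hα hj).2⟩
  have htime := fun j => h.time.eventually_gt_atTop j
  have hξlim : ∀ j, Tendsto (fun i => ξ i j) L (𝓝 (o j)) := fun j =>
    tendsto_of_tendsto_of_tendsto_of_le_of_le' (hleft j) (hright j)
      ((htime j).mono fun i hi => (hξ i j hi).1.le) ((htime j).mono fun i hi => (hξ i j hi).2.le)
  obtain ⟨C, q, hC, hq0, hq1, hbound⟩ := h.exists_one_sub_reverseOrbit_le hα hexp h.map_le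
    ho.tendsto (fun i j => h.left_mem hα) hleft
  have hcoord := h.isTame_limit.coord_pos (ho.mem 0).1
  obtain ⟨K, hK, hlog⟩ := h.exists_abs_logSlope_le hα (half_pos hcoord)
  refine tendsto_sum_range_of_dominated (bound := fun j => K * C * q ^ j)
    ((summable_geometric_of_lt_one hq0.le hq1).mul_left _) (fun j => by positivity) h.time
    (fun j => h.logSlope hα (hξlim j) (ho.mem j).1 ((htime j).mono fun i hi => hξmem i j hi)) ?_
  filter_upwards [hbound, hlog, (h.coord (hleft 0)).eventually (lt_mem_nhds (half_lt_self hcoord))]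
    with i hbound hlog hcoord j hj
  have hξcoord : B.coord (o 0) / 2 ≤ (𝓑 i).coord (ξ i j) :=
    hcoord.le.trans ((h.isTame i).coord_lt_coord ((reverseOrbit_le_reverseOrbit (h.map_le i)
      (fun j => h.left_mem hα) j.zero_le hj).trans_lt (hξ i j hj).1)).le
  calc ‖(𝓑 i).logSlope α (ξ i j)‖ ≤ K * (1 - ξ i j) := hlog _ (hξmem i j hj) hξcoord
    _ ≤ K * (C * q ^ j) := by
      gcongr
      linarith [hbound j hj, (hξ i j hj).1]
    _ = K * C * q ^ j := by ring

theorem exists_tendsto_expansionFactor [L.NeBot] (h : LongOrbitPairs α L 𝓑 B a y z) (hα : 1 < α)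
    (hv : 0 < B.v) (ho : B.IsBackwardOrbit α o) (hexp : 1 < B.slope α 1) :
    ∃ P : ι → ℝ, Tendsto P L (𝓝 (B.expansionFactor α o)) ∧ ∀ i,
      ((𝓑 i).map α)^[a i] (z i) - ((𝓑 i).map α)^[a i] (y i)
        = (z i - y i) * ((𝓑 i).slope α 1 ^ a i * P i) := by
  choose ξ hξ heq using fun i => (h.isTame i).exists_iterate_sub_iterate_eq hα (h.v_pos i)
    (h.lt i) (h.le_one i) (h.c_le i)
  have hsum : Tendsto (fun i => ∑ j ∈ Finset.range (a i), (𝓑 i).logSlope α (ξ i j)) L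
      (𝓝 (∑' j, B.logSlope α (o j))) :=
    (h.tendsto_sum_logSlope hα hv ho hexp (ξ := fun i j => ξ i (a i - 1 - j))
      fun i j hj => hξ i _ (by omega)).congr fun i =>
        Finset.sum_range_reflect (fun k => (𝓑 i).logSlope α (ξ i k)) (a i)
  exact ⟨_, (Real.continuous_exp.tendsto _).comp hsum, heq⟩

end LongOrbitPairs

end Branch

/-! ### Linked branches -/

namespace Branch

variable {α : ℝ} {B B' : Branch}

/-- The branches `B` and (after reflection) `B'` fit together to a Lorenz map with a return interval
`[1 - x', x]`: the part of the interval on the side of `B'` follows `B` for `a` steps and is then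
mapped onto the return interval. -/
structure IsLinked (α : ℝ) (B B' : Branch) (x x' : ℝ) (a : ℕ) : Prop where
  c_add : B.c + B'.c = 1
  c_lt : B.c < x
  c_lt' : B'.c < x'
  le_one' : x' ≤ 1
  orbit : ∀ i < a, x < (B.map α)^[i] (1 - B'.map α x')
  left_end : (B.map α)^[a] (1 - B'.map α x') = 1 - x'
  right_end : (B.map α)^[a] (1 - B'.map α B'.c) = x

namespace IsLinked

variable {x x' : ℝ} {a : ℕ}

theorem x'_mem (h : IsLinked α B B' x x' a) : x' ∈ Icc B'.c 1 := ⟨h.c_lt'.le, h.le_one'⟩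

theorem map_le (h : IsLinked α B B' x x' a) (hB' : B'.IsTame) (hα : 1 < α) :
    1 - B'.map α x' ≤ 1 - B'.map α B'.c ∧ 1 - B'.map α B'.c ≤ 1 :=
  ⟨sub_le_sub_left (hB'.map_monotoneOn hα hB'.c_mem_Icc h.x'_mem h.c_lt'.le) 1,
    sub_le_self 1 (hB'.map_mem hα hB'.c_mem_Icc).1⟩

theorem map_lt (h : IsLinked α B B' x x' a) (hB' : B'.IsTame) (hα : 1 < α) :
    1 - B'.map α x' < 1 - B'.map α B'.c := by
  refine (h.map_le hB' hα).1.lt_of_ne fun heq => ?_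
  have hend := h.left_end
  rw [heq, h.right_end] at hend
  linarith [h.c_lt, h.c_lt', h.c_add]

theorem orbit_mem (h : IsLinked α B B' x x' a) (hB : B.IsTame) (hB' : B'.IsTame) (hα : 1 < α)
    {i : ℕ} (hi : i < a) : (B.map α)^[i] (1 - B'.map α x') ∈ Icc B.c 1 :=
  have hle := h.map_le hB' hα
  hB.iterate_mem hα (hle.1.trans hle.2) (fun i hi => (h.c_lt.trans (h.orbit i hi)).le) hi

theorem map_c_lt (h : IsLinked α B B' x x' a) (hB' : B'.IsTame) (hα : 1 < α) (ha : 0 < a) :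
    B'.map α B'.c < B'.c := by
  have horbit : x < 1 - B'.map α x' := h.orbit 0 ha
  linarith [h.c_lt, h.c_add, (h.map_le hB' hα).1]

/- The image of the critical value of `B'` under `B` is above the critical point, hence close to the
critical value of `B` only if the latter is close to the critical point to order `α`. -/
theorem sub_map_c_lt (h : IsLinked α B B' x x' a) (hB : B.IsTame) (hB' : B'.IsTame) (hα : 1 < α)
    (ha : 1 < a) : B.c - B.map α B.c < 2 * ((B'.c - B'.map α B'.c) / (1 - B.c)) ^ α := by
  have hy : 1 - B'.map α x' ∈ Icc B.c 1 := h.orbit_mem hB hB' hα (by omega : 0 < a)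
  have hz : 1 - B'.map α B'.c ∈ Icc B.c 1 :=
    ⟨hy.1.trans (h.map_le hB' hα).1, (h.map_le hB' hα).2⟩
  have hc := hB.c_mem_Icc
  have hcoord : B.coord (1 - B'.map α B'.c) = (B'.c - B'.map α B'.c) / (1 - B.c) := by
    rw [coord]
    congr 1
    linarith [h.c_add]
  calc B.c - B.map α B.c < B.map α (1 - B'.map α x') - B.map α B.c := by
        gcongr
        exact h.c_lt.trans (h.orbit 1 ha)
    _ ≤ B.map α (1 - B'.map α B'.c) - B.map α B.c :=
        sub_le_sub_right (hB.map_monotoneOn hα hy hz (h.map_le hB' hα).1) _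
    _ ≤ 2 * (B.core α (1 - B'.map α B'.c) - B.core α B.c) :=
        hB.φ_sub_le (hB.core_mem hα hc).1 (hB.core_monotoneOn hα hc hz hz.1) (hB.core_mem hα hz).2
    _ = 2 * (B.v * B.coord (1 - B'.map α B'.c) ^ α) := by
        rw [core_c hα, core]
        ring
    _ ≤ 2 * B.coord (1 - B'.map α B'.c) ^ α := by
        gcongr
        exact mul_le_of_le_one_left (Real.rpow_nonneg (hB.coord_mem hz).1 _) hB.v_le_one
    _ = 2 * ((B'.c - B'.map α B'.c) / (1 - B.c)) ^ α := by rw [hcoord]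

end IsLinked

theorem exists_forall_two_mul_div_rpow_lt (hα : 1 < α) {m : ℝ} (hm : 0 < m) :
    ∃ τ > 0, ∀ t ∈ Ioo (0 : ℝ) τ, 2 * (t / m) ^ α < t := by
  have hlim : Tendsto (fun t : ℝ => 2 * (t / m) ^ (α - 1) / m) (𝓝 0) (𝓝 0) := by
    have hdiv : Tendsto (fun t : ℝ => t / m) (𝓝 0) (𝓝 0) :=
      (by fun_prop : Continuous fun t : ℝ => t / m).tendsto' _ _ (by simp)
    have hpow := ((hdiv.rpow_const (p := α - 1) (Or.inr (by linarith))).const_mul 2).div_const m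
    rwa [Real.zero_rpow (by linarith), mul_zero, zero_div] at hpow
  obtain ⟨τ, hτ, hlt⟩ := Metric.eventually_nhds_iff_ball.1 (hlim.eventually (gt_mem_nhds one_pos))
  refine ⟨τ, hτ, fun t ht => ?_⟩
  calc 2 * (t / m) ^ α = 2 * (t / m) ^ (α - 1) / m * t := by
        rw [← sub_add_cancel α 1, Real.rpow_add_one (div_pos ht.1 hm).ne', sub_add_cancel]
        ring
    _ < 1 * t := by
        refine mul_lt_mul_of_pos_right (hlt t ?_) ht.1
        rw [mem_ball_zero_iff, Real.norm_of_nonneg ht.1.le]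
        exact ht.2
    _ = t := one_mul t

/-- Linked branches with return times `a i → ∞` which converge to the branches `B` and `B'`. -/
structure LinkedTendsTo (α : ℝ) {ι : Type*} (L : Filter ι) (𝓑 𝓑' : ι → Branch) (B B' : Branch)
    (x x' : ι → ℝ) (a : ι → ℕ) : Prop where
  fst : TendsTo L 𝓑 B
  snd : TendsTo L 𝓑' B'
  linked : ∀ i, IsLinked α (𝓑 i) (𝓑' i) (x i) (x' i) (a i)
  time : Tendsto a L atTop

namespace TendsTo

variable {ι : Type*} {L : Filter ι} {𝓑 : ι → Branch} {x : ι → ℝ}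

theorem map_c [L.NeBot] (h : TendsTo L 𝓑 B) (hα : 1 < α) :
    Tendsto (fun i => (𝓑 i).map α (𝓑 i).c) L (𝓝 (B.map α B.c)) :=
  h.map hα h.c (Eventually.of_forall fun i => (h.isTame i).c_mem_Icc)

theorem exists_cusp_factor (h : TendsTo L 𝓑 B) (hα : 1 < α) (hv : ∀ i, 0 < (𝓑 i).v)
    (hx : Tendsto x L (𝓝 B.c)) (hxs : ∀ i, x i ∈ Ioc (𝓑 i).c 1) :
    ∃ Q : ι → ℝ, Tendsto Q L (𝓝 (B.ψ (1 - B.v) * B.v)) ∧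
      ∀ i, (𝓑 i).map α (x i) - (𝓑 i).map α (𝓑 i).c = Q i * (𝓑 i).coord (x i) ^ α := by
  have hxm := fun i => Ioc_subset_Icc_self (hxs i)
  have hcore_c := fun i => (h.isTame i).core_mem hα (h.isTame i).c_mem_Icc
  have hcore_x := fun i => (h.isTame i).core_mem hα (hxm i)
  choose ξ hξ hξe using fun i => exists_sub_eq_mul_sub_of_hasDerivWithinAt (h.isTame i).hasDeriv
    (hcore_c i).1
    ((h.isTame i).core_strictMonoOn hα (hv i) (h.isTame i).c_mem_Icc (hxm i) (hxs i).1)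
    (hcore_x i).2
  refine ⟨fun i => (𝓑 i).ψ (ξ i) * (𝓑 i).v, Tendsto.mul ?_ h.v, fun i => ?_⟩
  · have hξlim : Tendsto ξ L (𝓝 (1 - B.v)) := core_c hα ▸
      tendsto_of_tendsto_of_tendsto_of_le_of_le (h.core hα h.c) (h.core hα hx)
        (fun i => (hξ i).1.le) (fun i => (hξ i).2.le)
    refine h.ψ.tendsto_comp (h.isTame_limit.continuousOn_ψ _ ?_) (tendsto_nhdsWithin_iff.2
      ⟨hξlim, Eventually.of_forall fun i =>
        ⟨(hcore_c i).1.trans (hξ i).1.le, (hξ i).2.le.trans (hcore_x i).2⟩⟩)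
    exact ⟨sub_nonneg.2 h.isTame_limit.v_le_one, sub_le_self 1 h.isTame_limit.v_nonneg⟩
  · refine (hξe i).trans ?_
    rw [core_c hα, Branch.core]
    ring

end TendsTo

namespace LinkedTendsTo

variable {ι : Type*} {L : Filter ι} {𝓑 𝓑' : ι → Branch} {x x' : ι → ℝ} {a b : ι → ℕ}

theorem tendsto_map_zero (h : LinkedTendsTo α L 𝓑 𝓑' B B' x x' a) (hα : 1 < α)
    (hc : B.map α B.c < B.c) (hfix : ∀ y ∈ Ioo B.c 1, B.map α y ≠ y) :
    Tendsto (fun i => (𝓑' i).map α (x' i)) L (𝓝 0) := by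
  rw [tendsto_iff_ultrafilter]
  intro G hG
  obtain ⟨y, -, hy⟩ := exists_tendsto_of_eventually_mem G (isCompact_Icc (a := (0 : ℝ)) (b := 1))
    (f := fun i => (𝓑' i).map α (x' i))
    (Eventually.of_forall fun i => (h.snd.isTame i).map_mem hα (h.linked i).x'_mem)
  have hy1 : 1 - y = 1 := (h.fst.mono hG).eq_one_of_forall_iterate hα hc hfix (hy.const_sub 1)
    fun j => by
      filter_upwards [(h.time.mono_left hG).eventually_gt_atTop j] with i hi
      exact (h.linked i).orbit_mem (h.fst.isTame i) (h.snd.isTame i) hα hi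
  rwa [show y = 0 by linarith] at hy

theorem map_c_eq_zero [L.NeBot] (h : LinkedTendsTo α L 𝓑 𝓑' B B' x x' a) (hα : 1 < α)
    (hc : B.map α B.c < B.c) (hfix : ∀ y ∈ Ioo B.c 1, B.map α y ≠ y) : B'.map α B'.c = 0 := by
  refine tendsto_nhds_unique (h.snd.map_c hα) (squeeze_zero (fun i => ?_) (fun i => ?_)
    (h.tendsto_map_zero hα hc hfix))
  · exact ((h.snd.isTame i).map_mem hα (h.snd.isTame i).c_mem_Icc).1
  · exact (sub_le_sub_iff_left 1).1 ((h.linked i).map_le (h.snd.isTame i) hα).1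

theorem tendsto_c [L.NeBot] (h : LinkedTendsTo α L 𝓑 𝓑' B B' x x' a) (hα : 1 < α)
    (hc : B.map α B.c < B.c) (hfix : ∀ y ∈ Ioo B.c 1, B.map α y ≠ y) (hv' : 0 < B'.v) :
    Tendsto x' L (𝓝 B'.c) := by
  refine h.snd.of_map hα hv' (Eventually.of_forall fun i => (h.linked i).x'_mem)
    h.snd.isTame_limit.c_mem_Icc ?_
  rw [h.map_c_eq_zero hα hc hfix]
  exact h.tendsto_map_zero hα hc hfix

theorem eventually_sub_map_c_lt [L.NeBot] (h : LinkedTendsTo α L 𝓑 𝓑' B B' x x' a) (hα : 1 < α)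
    (hc' : B'.map α B'.c = B'.c) :
    ∀ᶠ i in L, (𝓑 i).c - (𝓑 i).map α (𝓑 i).c < (𝓑' i).c - (𝓑' i).map α (𝓑' i).c := by
  have hgap : Tendsto (fun i => (𝓑' i).c - (𝓑' i).map α (𝓑' i).c) L (𝓝 0) := by
    simpa only [hc', sub_self] using h.snd.c.sub (h.snd.map_c hα)
  have hc : 0 < 1 - B.c := sub_pos.2 h.fst.isTame_limit.c_lt_one
  obtain ⟨τ, hτ, hlt⟩ := exists_forall_two_mul_div_rpow_lt hα (half_pos hc)
  filter_upwards [h.time.eventually_gt_atTop 1, hgap.eventually (gt_mem_nhds hτ),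
    (tendsto_const_nhds.sub h.fst.c).eventually (lt_mem_nhds (half_lt_self hc))] with i ha hgap hci
  have hpos := sub_pos.2 ((h.linked i).map_c_lt (h.snd.isTame i) hα (by omega))
  calc (𝓑 i).c - (𝓑 i).map α (𝓑 i).c
      < 2 * (((𝓑' i).c - (𝓑' i).map α (𝓑' i).c) / (1 - (𝓑 i).c)) ^ α :=
        (h.linked i).sub_map_c_lt (h.fst.isTame i) (h.snd.isTame i) hα ha
    _ ≤ 2 * (((𝓑' i).c - (𝓑' i).map α (𝓑' i).c) / ((1 - B.c) / 2)) ^ α := by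
        gcongr
        exact div_nonneg hpos.le (by linarith)
    _ < (𝓑' i).c - (𝓑' i).map α (𝓑' i).c := hlt _ ⟨hpos, hgap⟩

theorem map_c_eq_zero_and [L.NeBot] (h : LinkedTendsTo α L 𝓑 𝓑' B B' x x' a)
    (h' : LinkedTendsTo α L 𝓑' 𝓑 B' B x' x b) (hα : 1 < α) (hc : B.map α B.c ≤ B.c)
    (hc' : B'.map α B'.c ≤ B'.c)
    (hfix : ∀ y ∈ Ioo B.c 1, B.map α y ≠ y) (hfix' : ∀ y ∈ Ioo B'.c 1, B'.map α y ≠ y) :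
    B.map α B.c = 0 ∧ B'.map α B'.c = 0 := by
  rcases hc.lt_or_eq with hlt | heq
  · have hzero' := h.map_c_eq_zero hα hlt hfix
    exact ⟨h'.map_c_eq_zero hα (hzero' ▸ h.snd.isTame_limit.c_pos) hfix', hzero'⟩
  rcases hc'.lt_or_eq with hlt' | heq'
  · refine absurd (h'.map_c_eq_zero hα hlt' hfix') ?_
    rw [heq]
    exact h.fst.isTame_limit.c_pos.ne'
  · obtain ⟨i, hi, hi'⟩ :=
      ((h.eventually_sub_map_c_lt hα heq').and (h'.eventually_sub_map_c_lt hα heq)).exists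
    exact absurd hi hi'.asymm

end LinkedTendsTo

theorem v_eq_one_of_map_c (hB : B.IsTame) (hα : 1 < α) (h : B.map α B.c = 0) : B.v = 1 := by
  rw [map_c hα, ← hB.map_zero] at h
  have hv : 1 - B.v = 0 := hB.φ_strictMonoOn.injOn
    ⟨sub_nonneg.2 hB.v_le_one, sub_le_self 1 hB.v_nonneg⟩ (left_mem_Icc.2 zero_le_one) h
  linarith

theorem v_pos_of_map_c_lt (hB : B.IsTame) (hα : 1 < α) (h : B.map α B.c < B.c) : 0 < B.v := by
  refine hB.v_nonneg.lt_of_ne fun hv => ?_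
  rw [map_c hα, ← hv, sub_zero, hB.map_one] at h
  exact h.asymm hB.c_lt_one

/-- The limit of the ratio of the length of the return interval to `s ^ α * D ^ a`, where `s` is the
relative size of the part of the interval on the side of `B'`, `D` is the slope of `B` at `1`, and
`a` is the time this part follows `B`. -/
noncomputable def returnFactor (α : ℝ) (B B' : Branch) (o : ℕ → ℝ) : ℝ :=
  B'.ψ (1 - B'.v) * B'.v * B.expansionFactor α o

theorem returnFactor_pos (hB' : B'.IsTame) (hv' : B'.v = 1) (o : ℕ → ℝ) :
    0 < B.returnFactor α B' o := by
  rw [returnFactor, hv', sub_self, mul_one]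
  exact mul_pos (hB'.ψ_pos (left_mem_Icc.2 zero_le_one)) (expansionFactor_pos o)

/-- Pairs of branches, linked in both directions with return times tending to infinity, which
converge to the two branches of a full map. -/
structure LinkedTendsToFull (α : ℝ) {ι : Type*} (L : Filter ι) (𝓑 𝓑' : ι → Branch) (B B' : Branch)
    (x x' : ι → ℝ) (a b : ι → ℕ) : Prop where
  link : LinkedTendsTo α L 𝓑 𝓑' B B' x x' a
  link' : LinkedTendsTo α L 𝓑' 𝓑 B' B x' x b
  time_pos : ∀ i, 0 < a i
  time_pos' : ∀ i, 0 < b i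
  map_ne : ∀ i, ∀ y ∈ Ioo (𝓑 i).c 1, (𝓑 i).map α y ≠ y
  map_ne' : ∀ i, ∀ y ∈ Ioo (𝓑' i).c 1, (𝓑' i).map α y ≠ y
  v_eq_one : B.v = 1
  v_eq_one' : B'.v = 1
  limit_map_ne : ∀ y ∈ Ioo B.c 1, B.map α y ≠ y
  limit_map_ne' : ∀ y ∈ Ioo B'.c 1, B'.map α y ≠ y

namespace LinkedTendsToFull

variable {ι : Type*} {L : Filter ι} {𝓑 𝓑' : ι → Branch} {x x' : ι → ℝ} {a b : ι → ℕ}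
  {o : ℕ → ℝ}

theorem symm (h : LinkedTendsToFull α L 𝓑 𝓑' B B' x x' a b) :
    LinkedTendsToFull α L 𝓑' 𝓑 B' B x' x b a :=
  ⟨h.link', h.link, h.time_pos', h.time_pos, h.map_ne', h.map_ne, h.v_eq_one', h.v_eq_one,
    h.limit_map_ne', h.limit_map_ne⟩

theorem map_c_lt (h : LinkedTendsToFull α L 𝓑 𝓑' B B' x x' a b) (hα : 1 < α) (i : ι) :
    (𝓑 i).map α (𝓑 i).c < (𝓑 i).c :=
  (h.link'.linked i).map_c_lt (h.link.fst.isTame i) hα (h.time_pos' i)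

theorem v_pos (h : LinkedTendsToFull α L 𝓑 𝓑' B B' x x' a b) (hα : 1 < α) (i : ι) :
    0 < (𝓑 i).v :=
  v_pos_of_map_c_lt (h.link.fst.isTame i) hα (h.map_c_lt hα i)

theorem tendsto_c [L.NeBot] (h : LinkedTendsToFull α L 𝓑 𝓑' B B' x x' a b) (hα : 1 < α) :
    Tendsto x L (𝓝 B.c) := by
  have hB' := h.link'.fst.isTame_limit
  refine h.link'.tendsto_c hα ?_ h.limit_map_ne' (h.v_eq_one ▸ one_pos)
  rw [map_c hα, h.v_eq_one', sub_self, hB'.map_zero]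
  exact hB'.c_pos

theorem c_add [L.NeBot] (h : LinkedTendsToFull α L 𝓑 𝓑' B B' x x' a b) : B.c + B'.c = 1 :=
  tendsto_nhds_unique (h.link.fst.c.add h.link.snd.c)
    (tendsto_const_nhds.congr fun i => (h.link.linked i).c_add.symm)

theorem longOrbitPairs [L.NeBot] (h : LinkedTendsToFull α L 𝓑 𝓑' B B' x x' a b) (hα : 1 < α) :
    LongOrbitPairs α L 𝓑 B a (fun i => 1 - (𝓑' i).map α (x' i))
      (fun i => 1 - (𝓑' i).map α (𝓑' i).c) where
  toTendsTo := h.link.fst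
  v_pos := h.v_pos hα
  map_le i _ := (h.link.fst.isTame i).map_le_self hα (h.map_c_lt hα i) (h.map_ne i)
  time := h.link.time
  lt i := (h.link.linked i).map_lt (h.link.snd.isTame i) hα
  le_one i := ((h.link.linked i).map_le (h.link.snd.isTame i) hα).2
  c_le i _ hj := ((h.link.linked i).orbit_mem (h.link.fst.isTame i) (h.link.snd.isTame i) hα hj).1
  left_end := by
    simp only [fun i => (h.link.linked i).left_end]
    simpa only [← h.c_add, add_sub_cancel_right] using (h.symm.tendsto_c hα).const_sub 1
  right_end := by simpa only [fun i => (h.link.linked i).right_end] using h.tendsto_c hα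

theorem exists_tendsto_returnFactor [L.NeBot] (h : LinkedTendsToFull α L 𝓑 𝓑' B B' x x' a b)
    (hα : 1 < α) (ho : B.IsBackwardOrbit α o) (hexp : 1 < B.slope α 1) :
    ∃ P : ι → ℝ, Tendsto P L (𝓝 (B.returnFactor α B' o)) ∧
      ∀ i, x i + x' i - 1 = P i * (𝓑' i).coord (x' i) ^ α * (𝓑 i).slope α 1 ^ a i := by
  obtain ⟨P, hP, heqP⟩ :=
    (h.longOrbitPairs hα).exists_tendsto_expansionFactor hα (h.v_eq_one ▸ one_pos) ho hexp
  obtain ⟨Q, hQ, heqQ⟩ := h.link.snd.exists_cusp_factor hα (h.symm.v_pos hα) (h.symm.tendsto_c hα)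
    fun i => ⟨(h.link.linked i).c_lt', (h.link.linked i).le_one'⟩
  refine ⟨fun i => Q i * P i, hQ.mul hP, fun i => ?_⟩
  have hlen := heqP i
  rw [(h.link.linked i).left_end, (h.link.linked i).right_end] at hlen
  linear_combination hlen + (𝓑 i).slope α 1 ^ a i * P i * heqQ i

theorem exists_one_sub_v_le [L.NeBot] (h : LinkedTendsToFull α L 𝓑 𝓑' B B' x x' a b) (hα : 1 < α)
    (ho : B.IsBackwardOrbit α o) (hexp : 1 < B.slope α 1) :
    ∃ C q : ℝ, 0 < C ∧ 0 < q ∧ q < 1 ∧ ∀ᶠ i in L, 1 - (𝓑' i).v ≤ C * q ^ a i := by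
  obtain ⟨C, q, hC, hq0, hq1, hbound⟩ :=
    (h.longOrbitPairs hα).exists_one_sub_le hα (h.v_eq_one ▸ one_pos) ho hexp
  refine ⟨2 * C, q, by positivity, hq0, hq1, hbound.mono fun i hi => ?_⟩
  have hB' := h.link.snd.isTame i
  have hφ := hB'.half_mul_le_φ_sub le_rfl (sub_nonneg.2 hB'.v_le_one)
    (sub_le_self 1 hB'.v_nonneg)
  rw [hB'.map_zero, ← map_c hα] at hφ
  linarith

end LinkedTendsToFull

end Branch

/-! ### Lorenz maps as pairs of branches -/

theorem iD_zero (φ : ℝ → ℝ) : iD 0 φ = φ := funext fun _ => by rw [iD, iteratedDerivWithin_zero]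

namespace IsDiffeoPart

variable {φ : ℝ → ℝ}

theorem hasDerivWithinAt_iD (h : IsDiffeoPart φ) {k : ℕ} (hk : k < 3) {x : ℝ}
    (hx : x ∈ Icc (0 : ℝ) 1) : HasDerivWithinAt (iD k φ) (iD (k + 1) φ x) (Icc 0 1) x := by
  rw [iD, iteratedDerivWithin_succ]
  exact (h.contDiff.differentiableOn_iteratedDerivWithin (by exact_mod_cast hk)
    (uniqueDiffOn_Icc zero_lt_one) x hx).hasDerivWithinAt

theorem hasDerivWithinAt (h : IsDiffeoPart φ) {x : ℝ} (hx : x ∈ Icc (0 : ℝ) 1) :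
    HasDerivWithinAt φ (iD 1 φ x) (Icc 0 1) x := by
  simpa only [iD_zero] using h.hasDerivWithinAt_iD (k := 0) (by norm_num) hx

theorem abs_iD_one_sub_le (h : IsDiffeoPart φ) {C : ℝ} (hφ : ∀ x ∈ Icc (0 : ℝ) 1, |iD 2 φ x| ≤ C)
    {x y : ℝ} (hx : x ∈ Icc (0 : ℝ) 1) (hy : y ∈ Icc (0 : ℝ) 1) :
    |iD 1 φ x - iD 1 φ y| ≤ C * |x - y| :=
  (convex_Icc (0 : ℝ) 1).norm_image_sub_le_of_norm_hasDerivWithin_le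
    (fun _ hz => h.hasDerivWithinAt_iD (by norm_num) hz) hφ hy hx

end IsDiffeoPart

namespace LorenzMap

variable {α : ℝ} {f g : LorenzMap α} {δ : ℝ}

/-- The right branch as a `Branch`. -/
noncomputable def rightBranch (f : LorenzMap α) : Branch := ⟨f.c, f.v, f.φp, iD 1 f.φp⟩

/-- The left branch as a `Branch`, after reflection by `x ↦ 1 - x`. -/
noncomputable def leftBranch (f : LorenzMap α) : Branch :=
  ⟨1 - f.c, f.u, fun y => 1 - f.φm (1 - y), fun y => iD 1 f.φm (1 - y)⟩

theorem map_rightBranch (f : LorenzMap α) : f.rightBranch.map α = f.right := rfl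

theorem coord_leftBranch (f : LorenzMap α) (x : ℝ) :
    f.leftBranch.coord (1 - x) = (f.c - x) / f.c := by
  simp only [Branch.coord, leftBranch]
  congr 1 <;> ring

theorem map_leftBranch_one_sub (f : LorenzMap α) (x : ℝ) :
    f.leftBranch.map α (1 - x) = 1 - f.left x := by
  rw [Branch.map, Branch.core, coord_leftBranch, left]
  simp only [leftBranch]
  congr 2
  ring

theorem map_leftBranch (f : LorenzMap α) (x : ℝ) :
    f.leftBranch.map α x = 1 - f.left (1 - x) := by
  rw [← map_leftBranch_one_sub, sub_sub_cancel]

theorem iterate_map_leftBranch_one_sub (f : LorenzMap α) (i : ℕ) (x : ℝ) :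
    (f.leftBranch.map α)^[i] (1 - x) = 1 - f.left^[i] x :=
  have h : Function.Semiconj (fun x => 1 - x) f.left (f.leftBranch.map α) :=
    fun x => (map_leftBranch_one_sub f x).symm
  (h.iterate_right i x).symm

theorem toFun_of_lt {x : ℝ} (hx : x < f.c) : f.toFun x = f.left x := if_pos hx

theorem toFun_of_le {x : ℝ} (hx : f.c ≤ x) : f.toFun x = f.right x := if_neg hx.not_gt

theorem left_zero (f : LorenzMap α) : f.left 0 = 0 := by
  rw [left, sub_zero, div_self f.c_mem.1.ne', Real.one_rpow, sub_self, mul_zero,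
    f.φm_diffeo.map_zero]

theorem right_one (f : LorenzMap α) : f.right 1 = 1 := by
  rw [right, div_self (sub_pos.2 f.c_mem.2).ne', Real.one_rpow, neg_add_cancel, mul_zero, add_zero,
    f.φp_diffeo.map_one]

theorem CloseToStandard.isTame_rightBranch (hf : f.CloseToStandard δ) (hδ : δ ≤ 1 / 2) :
    f.rightBranch.IsTame where
  c_pos := f.c_mem.1
  c_lt_one := f.c_mem.2
  v_nonneg := f.v_mem.1
  v_le_one := f.v_mem.2
  map_zero := f.φp_diffeo.map_zero
  map_one := f.φp_diffeo.map_one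
  hasDeriv _ := f.φp_diffeo.hasDerivWithinAt
  half_le x hx := by
    have hderiv := (abs_le.1 (hf f.φp (by simp) x hx).2.1).1
    change 1 / 2 ≤ iD 1 f.φp x
    linarith
  le_two x hx := by
    have hderiv := (abs_le.1 (hf f.φp (by simp) x hx).2.1).2
    change iD 1 f.φp x ≤ 2
    linarith
  lipschitz x hx y hy := by
    have hlip := f.φp_diffeo.abs_iD_one_sub_le (C := 1)
      (fun z hz => (hf f.φp (by simp) z hz).2.2.trans (by linarith)) hx hy
    rwa [one_mul] at hlip

theorem CloseToStandard.isTame_leftBranch (hf : f.CloseToStandard δ) (hδ : δ ≤ 1 / 2) :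
    f.leftBranch.IsTame where
  c_pos := sub_pos.2 f.c_mem.2
  c_lt_one := sub_lt_self 1 f.c_mem.1
  v_nonneg := f.u_mem.1
  v_le_one := f.u_mem.2
  map_zero := by simp only [leftBranch, sub_zero, f.φm_diffeo.map_one, sub_self]
  map_one := by simp only [leftBranch, sub_self, f.φm_diffeo.map_zero, sub_zero]
  hasDeriv x hx := by
    have hreflect : HasDerivWithinAt (fun y : ℝ => 1 - y) (-1) (Icc 0 1) x :=
      ((hasDerivAt_id x).const_sub 1).hasDerivWithinAt
    have houter := f.φm_diffeo.hasDerivWithinAt (Icc.mem_iff_one_sub_mem.1 hx)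
    simpa [leftBranch] using
      (houter.comp x hreflect fun y => Icc.mem_iff_one_sub_mem.1).const_sub 1
  half_le x hx := by
    have hderiv := (abs_le.1 (hf f.φm (by simp) _ (Icc.mem_iff_one_sub_mem.1 hx)).2.1).1
    change 1 / 2 ≤ iD 1 f.φm (1 - x)
    linarith
  le_two x hx := by
    have hderiv := (abs_le.1 (hf f.φm (by simp) _ (Icc.mem_iff_one_sub_mem.1 hx)).2.1).2
    change iD 1 f.φm (1 - x) ≤ 2
    linarith
  lipschitz x hx y hy := by
    have hlip := f.φm_diffeo.abs_iD_one_sub_le (C := 1)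
      (fun z hz => (hf f.φm (by simp) z hz).2.2.trans (by linarith))
      (Icc.mem_iff_one_sub_mem.1 hx) (Icc.mem_iff_one_sub_mem.1 hy)
    rwa [one_mul, sub_sub_sub_cancel_left, abs_sub_comm y x] at hlip

theorem OnlyFixesEndpoints.map_rightBranch_ne (hf : f.OnlyFixesEndpoints) :
    ∀ x ∈ Ioo f.rightBranch.c 1, f.rightBranch.map α x ≠ x := by
  intro x hx heq
  have hcx : f.c < x := hx.1
  have hx0 : 0 < x := f.c_mem.1.trans hcx
  rcases hf x ⟨hx0.le, hx.2.le⟩ hcx.ne' (by rw [toFun_of_le hcx.le, ← map_rightBranch, heq])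
    with h | h
  exacts [hx0.ne' h, hx.2.ne h]

theorem OnlyFixesEndpoints.map_leftBranch_ne (hf : f.OnlyFixesEndpoints) :
    ∀ x ∈ Ioo f.leftBranch.c 1, f.leftBranch.map α x ≠ x := by
  intro x hx heq
  have hcx : 1 - x < f.c := sub_lt_comm.1 hx.1
  have hx1 : 0 < 1 - x := sub_pos.2 hx.2
  have hlt : 1 - x < 1 := hcx.trans f.c_mem.2
  rw [map_leftBranch] at heq
  rcases hf (1 - x) ⟨hx1.le, hlt.le⟩ hcx.ne (by rw [toFun_of_lt hcx]; linarith) with h | h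
  exacts [hx1.ne' h, hlt.ne h]

theorem isFull_iff : f.IsFull ↔
    f.rightBranch.map α f.rightBranch.c = 0 ∧ f.leftBranch.map α f.leftBranch.c = 0 := by
  change _ ↔ f.right f.c = 0 ∧ f.leftBranch.map α (1 - f.c) = 0
  rw [map_leftBranch_one_sub, IsFull, sub_eq_zero, and_comm, eq_comm (a := (1 : ℝ))]

theorem map_c_le (hf : f.Nontrivial ∨ f.HasTrivialBranch) :
    f.rightBranch.map α f.rightBranch.c ≤ f.rightBranch.c ∧
      f.leftBranch.map α f.leftBranch.c ≤ f.leftBranch.c := by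
  change f.right f.c ≤ f.c ∧ f.leftBranch.map α (1 - f.c) ≤ 1 - f.c
  rw [map_leftBranch_one_sub, sub_le_sub_iff_left]
  rcases hf with h | h
  exacts [⟨h.1.le, h.2.le⟩, ⟨h.1, h.2.1⟩]

theorem mul_one_sub_rpow_mem (hα : 1 < α) {s u : ℝ} (hu : u ∈ Icc (0 : ℝ) 1)
    (hs : s ∈ Icc (0 : ℝ) 1) : u * (1 - s ^ α) ∈ Icc (0 : ℝ) 1 :=
  unitInterval.mul_mem hu (Icc.mem_iff_one_sub_mem.1
    ⟨Real.rpow_nonneg hs.1 α, Real.rpow_le_one hs.1 hs.2 (by linarith)⟩)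

theorem continuousOn_left (f : LorenzMap α) (hα : 1 < α) : ContinuousOn f.left (Icc 0 f.c) := by
  have hc := f.c_mem.1
  refine f.φm_diffeo.contDiff.continuousOn.comp (Continuous.continuousOn ?_) fun x hx =>
    mul_one_sub_rpow_mem hα f.u_mem ⟨div_nonneg (sub_nonneg.2 hx.2) hc.le,
      (div_le_one hc).2 (sub_le_self _ hx.1)⟩
  exact continuous_const.mul (continuous_const.sub
    (Continuous.rpow_const (by fun_prop) fun _ => Or.inr (by linarith)))

theorem continuousOn_right (f : LorenzMap α) (hα : 1 < α) : ContinuousOn f.right (Icc f.c 1) := by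
  have hc := sub_pos.2 f.c_mem.2
  refine f.φp_diffeo.contDiff.continuousOn.comp (Continuous.continuousOn ?_) fun x hx => ?_
  · exact continuous_const.add (continuous_const.mul (continuous_const.add
      (Continuous.rpow_const (by fun_prop) fun _ => Or.inr (by linarith))))
  · convert Icc.mem_iff_one_sub_mem.1 (mul_one_sub_rpow_mem hα f.v_mem
      ⟨div_nonneg (sub_nonneg.2 hx.1) hc.le, (div_le_one hc).2 (sub_le_sub_right hx.2 _)⟩) using 1
    ring

theorem derivWithin_toFun_one (hf : f.rightBranch.IsTame) (hα : 1 < α) :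
    derivWithin f.toFun (Icc 0 1) 1 = f.rightBranch.slope α 1 := by
  have hc := f.c_mem
  have hderiv : HasDerivWithinAt f.toFun (f.rightBranch.slope α 1) (Icc f.c 1) 1 :=
    (hf.hasDerivWithinAt_map hα ⟨hc.2.le, le_rfl⟩).congr (fun x hx => toFun_of_le hx.1)
      (toFun_of_le hc.2.le)
  refine (hderiv.mono_of_mem_nhdsWithin ?_).derivWithin
    (uniqueDiffOn_Icc zero_lt_one 1 (right_mem_Icc.2 zero_le_one))
  filter_upwards [mem_nhdsWithin_of_mem_nhds (Ici_mem_nhds hc.2), self_mem_nhdsWithin] with x hcx hx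
  exact ⟨hcx, hx.2⟩

theorem derivWithin_toFun_zero (hf : f.leftBranch.IsTame) (hα : 1 < α) :
    derivWithin f.toFun (Icc 0 1) 0 = f.leftBranch.slope α 1 := by
  have hc := f.c_mem
  have hreflect : HasDerivWithinAt (fun y : ℝ => 1 - y) (-1) (Ico 0 f.c) 0 :=
    ((hasDerivAt_id (0 : ℝ)).const_sub 1).hasDerivWithinAt
  have hmaps : MapsTo (fun y : ℝ => 1 - y) (Ico 0 f.c) (Icc f.leftBranch.c 1) := fun x hx =>
    ⟨sub_le_sub_left hx.2.le 1, sub_le_self 1 hx.1⟩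
  have heq : ∀ x ∈ Ico 0 f.c, f.toFun x = 1 - f.leftBranch.map α (1 - x) := fun x hx => by
    rw [toFun_of_lt hx.2, map_leftBranch_one_sub, sub_sub_cancel]
  have hderiv : HasDerivWithinAt f.toFun (f.leftBranch.slope α 1) (Ico 0 f.c) 0 := by
    have hmap := hf.hasDerivWithinAt_map hα (hmaps (left_mem_Ico.2 hc.1))
    simpa using ((hmap.comp 0 hreflect hmaps).const_sub 1).congr heq (heq 0 (left_mem_Ico.2 hc.1))
  refine (hderiv.mono_of_mem_nhdsWithin ?_).derivWithin
    (uniqueDiffOn_Icc zero_lt_one 0 (left_mem_Icc.2 zero_le_one))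
  filter_upwards [mem_nhdsWithin_of_mem_nhds (Iio_mem_nhds hc.1), self_mem_nhdsWithin] with x hxc hx
  exact ⟨hx.1, hxc⟩

end LorenzMap

theorem Branch.IsLinked.of_tendsto {α : ℝ} (hα : 1 < α) {B B' : Branch} (hB : B.IsTame)
    (hB' : B'.IsTame) {x x' : ℝ} {a : ℕ} (hc : B.c + B'.c = 1) (hx : B.c < x)
    (hx' : B'.c < x') (hx1' : x' ≤ 1)
    (horbit : ∀ w ∈ Ioc B'.c x', ∀ i < a, x < (B.map α)^[i] (1 - B'.map α w))
    (hend : (B.map α)^[a] (1 - B'.map α x') = 1 - x')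
    (hlim : Tendsto (fun w => (B.map α)^[a] (1 - B'.map α w)) (𝓝[Ioc B'.c x'] B'.c) (𝓝 x)) :
    B.IsLinked α B' x x' a := by
  refine ⟨hc, hx, hx', hx1', horbit x' ⟨hx', le_rfl⟩, hend, ?_⟩
  have hne : (𝓝[Ioc B'.c x'] B'.c).NeBot := by
    rw [nhdsWithin_Ioc_eq_nhdsGT hx']
    infer_instance
  have hIcc : Ioc B'.c x' ⊆ Icc B'.c 1 := fun w hw => ⟨hw.1.le, hw.2.trans hx1'⟩
  have hmap : Tendsto (fun w => 1 - B'.map α w) (𝓝[Ioc B'.c x'] B'.c) (𝓝 (1 - B'.map α B'.c)) :=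
    ((hB'.continuousOn_map hα B'.c hB'.c_mem_Icc).mono hIcc).tendsto.const_sub 1
  refine tendsto_nhds_unique ((TendsTo.const hB).iterate hα hmap fun j hj => ?_) hlim
  filter_upwards [self_mem_nhdsWithin] with w hw
  exact hB.iterate_mem hα (sub_le_self 1 (hB'.map_mem hα (hIcc hw)).1)
    (fun i hi => (hx.trans (horbit w hw i hi)).le) hj

namespace LorenzMap

variable {α : ℝ} {f g : LorenzMap α} {l r x : ℝ} {a b n : ℕ}

theorem IsReturnMap.iterate_eq (h : f.IsReturnMap l r g) (hx : x ∈ Icc l r) (hxc : x ≠ f.c)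
    (hn : 0 < n) (hret : f.toFun^[n] x ∈ Icc l r)
    (hnot : ∀ i, 1 ≤ i → i < n → f.toFun^[i] x ∉ Icc l r) :
    f.toFun^[n] x = l + (r - l) * g.toFun ((x - l) / (r - l)) := by
  obtain ⟨m, hm0, hm, hfirst, heq⟩ := h.firstReturn x hx hxc
  obtain rfl : m = n := le_antisymm (le_of_not_gt fun hlt => hfirst n hn hlt hret)
    (le_of_not_gt fun hlt => hnot m hm0 hlt hm)
  rw [← heq, mul_div_cancel₀ _ (sub_pos.2 (h.l_lt.trans h.lt_r)).ne', add_sub_cancel]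

namespace IsMonotoneType

theorem iterate_left (h : f.IsMonotoneType l r a b) (hx : x ∈ Ico l f.c) {i : ℕ} (hi : i ≤ a) :
    f.right^[i] (f.left x) = f.toFun^[i + 1] x := by
  induction i with
  | zero => exact (toFun_of_lt hx.2).symm
  | succ i ih =>
    rw [Function.iterate_succ_apply', ih (by omega), Function.iterate_succ_apply' (n := i + 1),
      toFun_of_le ((h.2.2.1 x hx).2 (i + 1) (by omega) hi).2.le]

theorem iterate_right (h : f.IsMonotoneType l r a b) (hx : x ∈ Ioc f.c r) {i : ℕ} (hi : i ≤ b) :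
    f.left^[i] (f.right x) = f.toFun^[i + 1] x := by
  induction i with
  | zero => exact (toFun_of_le hx.1.le).symm
  | succ i ih =>
    rw [Function.iterate_succ_apply', ih (by omega), Function.iterate_succ_apply' (n := i + 1),
      toFun_of_lt ((h.2.2.2 x hx).2 (i + 1) (by omega) hi).2]

theorem lt_iterate_left (h : f.IsMonotoneType l r a b) (hx : x ∈ Ico l f.c) {i : ℕ} (hi : i < a) :
    r < f.right^[i] (f.left x) := by
  rw [h.iterate_left hx hi.le]
  obtain ⟨hnot, hlt⟩ := (h.2.2.1 x hx).2 (i + 1) (by omega) hi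
  exact lt_of_not_ge fun hle => hnot ⟨(hx.1.trans hx.2.le).trans hlt.le, hle⟩

theorem iterate_right_lt (h : f.IsMonotoneType l r a b) (hx : x ∈ Ioc f.c r) {i : ℕ} (hi : i < b) :
    f.left^[i] (f.right x) < l := by
  rw [h.iterate_right hx hi.le]
  obtain ⟨hnot, hlt⟩ := (h.2.2.2 x hx).2 (i + 1) (by omega) hi
  exact lt_of_not_ge fun hle => hnot ⟨hle, hlt.le.trans (hx.1.le.trans hx.2)⟩

theorem iterate_left_eq (h : f.IsMonotoneType l r a b) (hret : f.IsReturnMap l r g)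
    (hx : x ∈ Ico l f.c) :
    f.right^[a] (f.left x) = l + (r - l) * g.left ((x - l) / (r - l)) := by
  have horbit := h.2.2.1 x hx
  rw [h.iterate_left hx le_rfl, hret.iterate_eq ⟨hx.1, hx.2.le.trans hret.lt_r.le⟩ hx.2.ne
    (by omega) horbit.1 fun i hi hia => (horbit.2 i hi (by omega)).1, toFun_of_lt]
  rw [hret.crit]
  exact div_lt_div_of_pos_right (sub_lt_sub_right hx.2 l) (sub_pos.2 (hret.l_lt.trans hret.lt_r))

theorem iterate_right_eq (h : f.IsMonotoneType l r a b) (hret : f.IsReturnMap l r g)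
    (hx : x ∈ Ioc f.c r) :
    f.left^[b] (f.right x) = l + (r - l) * g.right ((x - l) / (r - l)) := by
  have horbit := h.2.2.2 x hx
  rw [h.iterate_right hx le_rfl, hret.iterate_eq ⟨hret.l_lt.le.trans hx.1.le, hx.2⟩ hx.1.ne'
    (by omega) horbit.1 fun i hi hib => (horbit.2 i hi (by omega)).1, toFun_of_le]
  rw [hret.crit]
  exact div_le_div_of_nonneg_right (sub_le_sub_right hx.1.le l)
    (sub_pos.2 (hret.l_lt.trans hret.lt_r)).le

end IsMonotoneType

namespace IsReturnMap

theorem tendsto_left (h : f.IsReturnMap l r g) (hα : 1 < α) (hg : g.left g.c = 1) :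
    Tendsto (fun x => l + (r - l) * g.left ((x - l) / (r - l))) (𝓝[Ico l f.c] f.c) (𝓝 r) := by
  have hlr := sub_pos.2 (h.l_lt.trans h.lt_r)
  have hcoord : Tendsto (fun x => (x - l) / (r - l)) (𝓝[Ico l f.c] f.c) (𝓝[Icc 0 g.c] g.c) := by
    refine tendsto_nhdsWithin_iff.2 ⟨h.crit ▸
      (by fun_prop : Continuous fun x => (x - l) / (r - l)).continuousAt.tendsto.mono_left
        nhdsWithin_le_nhds, ?_⟩
    filter_upwards [self_mem_nhdsWithin] with x hx
    exact ⟨div_nonneg (sub_nonneg.2 hx.1) hlr.le,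
      h.crit ▸ div_le_div_of_nonneg_right (sub_le_sub_right hx.2.le l) hlr.le⟩
  have hlim := (((g.continuousOn_left hα g.c ⟨g.c_mem.1.le, le_rfl⟩).tendsto.comp
    hcoord).const_mul (r - l)).const_add l
  rwa [hg, mul_one, add_sub_cancel] at hlim

theorem tendsto_right (h : f.IsReturnMap l r g) (hα : 1 < α) (hg : g.right g.c = 0) :
    Tendsto (fun x => l + (r - l) * g.right ((x - l) / (r - l))) (𝓝[Ioc f.c r] f.c) (𝓝 l) := by
  have hlr := sub_pos.2 (h.l_lt.trans h.lt_r)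
  have hcoord : Tendsto (fun x => (x - l) / (r - l)) (𝓝[Ioc f.c r] f.c) (𝓝[Icc g.c 1] g.c) := by
    refine tendsto_nhdsWithin_iff.2 ⟨h.crit ▸
      (by fun_prop : Continuous fun x => (x - l) / (r - l)).continuousAt.tendsto.mono_left
        nhdsWithin_le_nhds, ?_⟩
    filter_upwards [self_mem_nhdsWithin] with x hx
    exact ⟨h.crit ▸ div_le_div_of_nonneg_right (sub_le_sub_right hx.1.le l) hlr.le,
      (div_le_one hlr).2 (sub_le_sub_right hx.2 l)⟩
  have hlim := (((g.continuousOn_right hα g.c ⟨le_rfl, g.c_mem.2.le⟩).tendsto.comp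
    hcoord).const_mul (r - l)).const_add l
  rwa [hg, mul_zero, add_zero] at hlim

theorem isLinked_rightBranch (h : f.IsReturnMap l r g) (hm : f.IsMonotoneType l r a b)
    (hg : g.left g.c = 1) (hα : 1 < α) (hR : f.rightBranch.IsTame) (hL : f.leftBranch.IsTame) :
    f.rightBranch.IsLinked α f.leftBranch r (1 - l) a := by
  have hmem : MapsTo (fun w => 1 - w) (Ioc f.leftBranch.c (1 - l)) (Ico l f.c) := fun w hw =>
    ⟨le_sub_comm.1 hw.2, sub_lt_comm.1 hw.1⟩
  have heq : ∀ w ∈ Ioc f.leftBranch.c (1 - l), (f.rightBranch.map α)^[a] (1 - f.leftBranch.map α w)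
      = l + (r - l) * g.left ((1 - w - l) / (r - l)) := fun w hw => by
    rw [map_leftBranch, sub_sub_cancel, map_rightBranch, hm.iterate_left_eq h (hmem hw)]
  have hlt : f.leftBranch.c < 1 - l := sub_lt_sub_left h.l_lt 1
  refine .of_tendsto hα hR hL (add_sub_cancel f.c 1) h.lt_r hlt
    (sub_le_self 1 h.l_nonneg) (fun w hw i hi => ?_) ?_ ?_
  · rw [map_leftBranch, sub_sub_cancel]
    exact hm.lt_iterate_left (hmem hw) hi
  · rw [heq _ ⟨hlt, le_rfl⟩, sub_sub_cancel, sub_self, zero_div, left_zero, mul_zero, add_zero]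
  · have hreflect : Tendsto (fun w => 1 - w) (𝓝[Ioc f.leftBranch.c (1 - l)] f.leftBranch.c)
        (𝓝[Ico l f.c] f.c) :=
      tendsto_nhdsWithin_iff.2 ⟨((continuous_sub_left 1).tendsto' _ _
        (sub_sub_cancel 1 f.c)).mono_left nhdsWithin_le_nhds,
        eventually_of_mem self_mem_nhdsWithin hmem⟩
    refine ((h.tendsto_left hα hg).comp hreflect).congr' ?_
    filter_upwards [self_mem_nhdsWithin] with w hw using (heq w hw).symm

theorem isLinked_leftBranch (h : f.IsReturnMap l r g) (hm : f.IsMonotoneType l r a b)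
    (hg : g.right g.c = 0) (hα : 1 < α) (hR : f.rightBranch.IsTame) (hL : f.leftBranch.IsTame) :
    f.leftBranch.IsLinked α f.rightBranch (1 - l) r b := by
  have heq : ∀ w ∈ Ioc f.c r, (f.leftBranch.map α)^[b] (1 - f.rightBranch.map α w)
      = 1 - (l + (r - l) * g.right ((w - l) / (r - l))) := fun w hw => by
    rw [map_rightBranch, iterate_map_leftBranch_one_sub, hm.iterate_right_eq h hw]
  refine .of_tendsto hα hL hR (sub_add_cancel 1 f.c) (sub_lt_sub_left h.l_lt 1)
    h.lt_r h.r_le_one (fun w hw i hi => ?_) ?_ ?_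
  · rw [map_rightBranch, iterate_map_leftBranch_one_sub]
    exact sub_lt_sub_left (hm.iterate_right_lt hw hi) 1
  · rw [heq r ⟨h.lt_r, le_rfl⟩, div_self (sub_pos.2 (h.l_lt.trans h.lt_r)).ne', right_one, mul_one,
      add_sub_cancel]
  · refine ((h.tendsto_right hα hg).const_sub 1).congr' ?_
    filter_upwards [self_mem_nhdsWithin] with w hw using (heq w hw).symm

end IsReturnMap

end LorenzMap

/-! ### Analytic families -/

section AnalyticFamily

variable {α : ℝ} {U : Set (ℝ × ℝ)} {F : ℝ × ℝ → LorenzMap α} {ι : Type*} {L : Filter ι}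
  {t : ι → ℝ × ℝ} {t₀ : ℝ × ℝ}

namespace AnalyticParam

theorem tendsto {h : ℝ × ℝ → ℝ} (hh : AnalyticParam U h) (ht : Tendsto t L (𝓝 t₀))
    (htU : ∀ i, t i ∈ U) (ht₀ : t₀ ∈ U) : Tendsto (fun i => h (t i)) L (𝓝 (h t₀)) := by
  obtain ⟨H, hH, heq⟩ := hh
  rw [← heq ht₀]
  exact ((hH t₀ ht₀).continuousAt.tendsto.comp ht).congr fun i => heq (htU i)

theorem isBigO_sub {h : ℝ × ℝ → ℝ} (hh : AnalyticParam U h) (ht : Tendsto t L (𝓝 t₀))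
    (htU : ∀ i, t i ∈ U) (ht₀ : t₀ ∈ U) :
    (fun i => h (t i) - h t₀) =O[L] fun i => ‖t i - t₀‖ := by
  obtain ⟨H, hH, heq⟩ := hh
  refine ((hH t₀ ht₀).differentiableAt.isBigO_sub.comp_tendsto ht).norm_right.congr_left fun i => ?_
  simp only [Function.comp_apply, heq (htU i), heq ht₀]

theorem mul {g h : ℝ × ℝ → ℝ} (hg : AnalyticParam U g) (hh : AnalyticParam U h) :
    AnalyticParam U fun t => g t * h t := by
  obtain ⟨G, hG, heqG⟩ := hg
  obtain ⟨H, hH, heqH⟩ := hh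
  exact ⟨fun t => G t * H t, fun t ht => (hG t ht).mul (hH t ht),
    fun t ht => by simp only [heqG ht, heqH ht]⟩

theorem const_div {h : ℝ × ℝ → ℝ} (hh : AnalyticParam U h) (h0 : ∀ t ∈ U, h t ≠ 0) (k : ℝ) :
    AnalyticParam U fun t => k / h t := by
  obtain ⟨H, hH, heq⟩ := hh
  exact ⟨fun t => k / H t,
    fun t ht => analyticAt_const.div (hH t ht) ((heq ht).symm ▸ h0 t ht),
    fun t ht => by simp only [heq ht]⟩

theorem const_sub {h : ℝ × ℝ → ℝ} (hh : AnalyticParam U h) (k : ℝ) :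
    AnalyticParam U fun t => k - h t := by
  obtain ⟨H, hH, heq⟩ := hh
  exact ⟨fun t => k - H t, fun t ht => analyticAt_const.sub (hH t ht),
    fun t ht => by simp only [heq ht]⟩

end AnalyticParam

namespace AnalyticDiffeoParam

theorem tendstoUniformlyOn {φ : ℝ × ℝ → ℝ → ℝ} (hφ : AnalyticDiffeoParam U φ) {k : ℕ}
    (hk : k ≤ 3) (ht : Tendsto t L (𝓝 t₀)) (htU : ∀ i, t i ∈ U) (ht₀ : t₀ ∈ U) :
    TendstoUniformlyOn (fun i => iD k (φ (t i))) (iD k (φ t₀)) L (Icc 0 1) := by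
  obtain ⟨J, hJ, heq⟩ := hφ k hk
  rw [Metric.tendstoUniformlyOn_iff]
  intro ε hε
  filter_upwards [Metric.tendsto_nhds.1 ((hJ t₀ ht₀).continuousAt.tendsto.comp ht) ε hε]
    with i hi x hx
  rw [← heq _ (htU i) ⟨x, hx⟩, ← heq _ ht₀ ⟨x, hx⟩, dist_comm]
  exact (ContinuousMap.dist_apply_le_dist _).trans_lt hi

theorem analyticParam_iD {φ : ℝ × ℝ → ℝ → ℝ} (hφ : AnalyticDiffeoParam U φ) {k : ℕ} (hk : k ≤ 3)
    {x : ℝ} (hx : x ∈ Icc (0 : ℝ) 1) : AnalyticParam U fun t => iD k (φ t) x := by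
  obtain ⟨J, hJ, heq⟩ := hφ k hk
  refine ⟨fun t => J t ⟨x, hx⟩, fun t ht => ?_, fun t ht => heq t ht ⟨x, hx⟩⟩
  exact ((ContinuousMap.evalCLM ℝ (⟨x, hx⟩ : Icc (0 : ℝ) 1)).analyticAt (J t)).comp (hJ t ht)

end AnalyticDiffeoParam

/-- Analytic families of Lorenz maps, without a condition on the parameter set, whose branches are
tame. -/
structure IsTameFamily (U : Set (ℝ × ℝ)) (F : ℝ × ℝ → LorenzMap α) : Prop where
  analytic : IsAnalyticFamily U F
  isTame_rightBranch : ∀ t ∈ U, (F t).rightBranch.IsTame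
  isTame_leftBranch : ∀ t ∈ U, (F t).leftBranch.IsTame
  fixes : ∀ t ∈ U, (F t).OnlyFixesEndpoints
  nontrivial : ∀ t ∈ U, (F t).Nontrivial ∨ (F t).HasTrivialBranch

namespace IsTameFamily

theorem tendsTo_rightBranch (hF : IsTameFamily U F) (ht : Tendsto t L (𝓝 t₀))
    (htU : ∀ i, t i ∈ U) (ht₀ : t₀ ∈ U) :
    Branch.TendsTo L (fun i => (F (t i)).rightBranch) (F t₀).rightBranch where
  isTame i := hF.isTame_rightBranch _ (htU i)
  isTame_limit := hF.isTame_rightBranch _ ht₀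
  c := hF.analytic.c.tendsto ht htU ht₀
  v := hF.analytic.v.tendsto ht htU ht₀
  φ := by
    simpa only [iD_zero, LorenzMap.rightBranch] using
      hF.analytic.φp.tendstoUniformlyOn (k := 0) (by norm_num) ht htU ht₀
  ψ := hF.analytic.φp.tendstoUniformlyOn (by norm_num) ht htU ht₀

theorem tendsTo_leftBranch (hF : IsTameFamily U F) (ht : Tendsto t L (𝓝 t₀))
    (htU : ∀ i, t i ∈ U) (ht₀ : t₀ ∈ U) :
    Branch.TendsTo L (fun i => (F (t i)).leftBranch) (F t₀).leftBranch where
  isTame i := hF.isTame_leftBranch _ (htU i)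
  isTame_limit := hF.isTame_leftBranch _ ht₀
  c := (hF.analytic.c.tendsto ht htU ht₀).const_sub 1
  v := hF.analytic.u.tendsto ht htU ht₀
  φ := by
    have hφ : TendstoUniformlyOn (fun i => (F (t i)).φm) (F t₀).φm L (Icc 0 1) := by
      simpa only [iD_zero] using
        hF.analytic.φm.tendstoUniformlyOn (k := 0) (by norm_num) ht htU ht₀
    rw [Metric.tendstoUniformlyOn_iff] at hφ ⊢
    refine fun ε hε => (hφ ε hε).mono fun i hi x hx => ?_
    simpa only [LorenzMap.leftBranch, dist_sub_left] using hi _ (Icc.mem_iff_one_sub_mem.1 hx)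
  ψ := ((hF.analytic.φm.tendstoUniformlyOn (by norm_num) ht htU ht₀).comp fun x => 1 - x).mono
    fun _ => Icc.mem_iff_one_sub_mem.1

theorem analyticParam_slope_rightBranch (hF : IsTameFamily U F) :
    AnalyticParam U fun t => (F t).rightBranch.slope α 1 := by
  obtain ⟨H, hH, heq⟩ := (hF.analytic.φp.analyticParam_iD (k := 1) (by norm_num)
    (right_mem_Icc.2 zero_le_one)).mul (hF.analytic.v.mul ((hF.analytic.c.const_sub 1).const_div
      (fun t _ => (sub_pos.2 (F t).c_mem.2).ne') α))
  exact ⟨H, hH, fun t ht => (heq ht).trans (hF.isTame_rightBranch t ht).slope_one.symm⟩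

theorem analyticParam_slope_leftBranch (hF : IsTameFamily U F) :
    AnalyticParam U fun t => (F t).leftBranch.slope α 1 := by
  obtain ⟨H, hH, heq⟩ := (hF.analytic.φm.analyticParam_iD (k := 1) (x := 1 - 1) (by norm_num)
    (by norm_num)).mul (hF.analytic.u.mul (((hF.analytic.c.const_sub 1).const_sub 1).const_div
      (fun t _ => by simpa only [sub_sub_cancel] using (F t).c_mem.1.ne') α))
  exact ⟨H, hH, fun t ht => (heq ht).trans (hF.isTame_leftBranch t ht).slope_one.symm⟩

end IsTameFamily

end AnalyticFamily

theorem IsAnalyticallyUniqueFull.exists_norm_pow_le {α : ℝ} {U : Set (ℝ × ℝ)}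
    {F : ℝ × ℝ → LorenzMap α} {p : ℝ × ℝ} (h : IsAnalyticallyUniqueFull U F p) :
    ∃ m : ℕ, ∀ᶠ t in 𝓝 p, t ∈ U → ‖t - p‖ ^ m ≤ (1 - (F t).u) + (1 - (F t).v) := by
  obtain ⟨S, u, v, hUS, hS, hu, hv, huv, hiso⟩ := h
  obtain ⟨m, hm⟩ := hS.lojasiewicz_inequality (h := fun z => (1 - u z) ^ 2 + (1 - v z) ^ 2)
    (((analyticAt_const.sub hu).pow 2).add ((analyticAt_const.sub hv).pow 2)) (by
      filter_upwards [hiso] with z hz hzS hzero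
      obtain ⟨hzu, hzv⟩ := (add_eq_zero_iff_of_nonneg (sq_nonneg _) (sq_nonneg _)).1 hzero
      rw [sq_eq_zero_iff, sub_eq_zero] at hzu hzv
      exact hz hzS hzu.symm hzv.symm)
  refine ⟨m, hm.mono fun t ht htU => (ht (hUS htU)).trans ?_⟩
  rw [abs_of_nonneg (by positivity), (huv t htU).1, (huv t htU).2]
  have hsq : ∀ s ∈ Icc (0 : ℝ) 1, (1 - s) ^ 2 ≤ 1 - s := fun s hs =>
    pow_le_of_le_one (sub_nonneg.2 hs.2) (sub_le_self 1 hs.1) two_ne_zero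
  exact add_le_add (hsq _ (F t).u_mem) (hsq _ (F t).v_mem)

/-! ### Comparison of powers -/

section Powers

variable {ι : Type*} {L : Filter ι}

theorem tendsto_div_pow_one {s d : ι → ℝ} {s₀ : ℝ} (hs₀ : s₀ ≠ 0) {k : ι → ℕ}
    (hs : Tendsto s L (𝓝 s₀)) (hO : (fun i => s i - s₀) =O[L] d)
    (hk : Tendsto (fun i => (k i : ℝ) * d i) L (𝓝 0)) :
    Tendsto (fun i => (s i / s₀) ^ k i) L (𝓝 1) := by
  have hratio : Tendsto (fun i => s i / s₀) L (𝓝 1) := by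
    simpa only [div_self hs₀] using hs.div_const s₀
  have hratioO : (fun i => s i / s₀ - 1) =O[L] d :=
    (hO.const_mul_left s₀⁻¹).congr_left fun i => by
      rw [mul_sub, inv_mul_cancel₀ hs₀, inv_mul_eq_div]
  have hlogO : (fun i => Real.log (s i / s₀)) =O[L] d := by
    have hlog := (Real.differentiableAt_log one_ne_zero).isBigO_sub.comp_tendsto hratio
    simp only [Real.log_one, sub_zero] at hlog
    exact hlog.trans hratioO
  have hexp := (Real.continuous_exp.tendsto 0).comp
    (((isBigO_refl (fun i => (k i : ℝ)) L).mul hlogO).trans_tendsto hk)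
  rw [Real.exp_zero] at hexp
  refine hexp.congr' ?_
  filter_upwards [hratio.eventually (lt_mem_nhds one_pos)] with i hi
  rw [Function.comp_apply, mul_comm, Real.exp_mul, Real.exp_log hi, Real.rpow_natCast]

theorem tendsto_zero_of_tendsto_pow {x : ι → ℝ} {m : ℕ} (hm : m ≠ 0) (hx : ∀ i, 0 ≤ x i)
    (h : Tendsto (fun i => x i ^ m) L (𝓝 0)) : Tendsto x L (𝓝 0) := by
  have hm0 : (0 : ℝ) < (m : ℝ)⁻¹ := by positivity
  have hroot := h.rpow_const (p := (m : ℝ)⁻¹) (Or.inr hm0.le)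
  rw [Real.zero_rpow hm0.ne'] at hroot
  exact hroot.congr fun i => Real.pow_rpow_inv_natCast (hx i) hm

theorem tendsto_mul_zero_of_pow_le_geometric {x : ι → ℝ} {N : ι → ℕ} {m : ℕ} {C ρ : ℝ}
    (hx : ∀ i, 0 ≤ x i) (hx0 : Tendsto x L (𝓝 0)) (hN : Tendsto N L atTop) (hρ : 0 ≤ ρ)
    (hρ1 : ρ < 1) (hbound : ∀ᶠ i in L, x i ^ m ≤ C * ρ ^ N i) :
    Tendsto (fun i => (N i : ℝ) * x i) L (𝓝 0) := by
  have hnonneg : ∀ i, 0 ≤ (N i : ℝ) * x i := fun i => mul_nonneg (Nat.cast_nonneg _) (hx i)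
  refine tendsto_zero_of_tendsto_pow (m := m + 1) m.succ_ne_zero hnonneg ?_
  have hlim : Tendsto (fun i => C * ((N i : ℝ) ^ (m + 1) * ρ ^ N i)) L (𝓝 0) := by
    have hgeom := tendsto_pow_const_mul_const_pow_of_abs_lt_one (m + 1)
      ((abs_of_nonneg hρ).trans_lt hρ1)
    simpa only [Function.comp_apply, mul_zero] using (hgeom.comp hN).const_mul C
  refine squeeze_zero' (Eventually.of_forall fun i => pow_nonneg (hnonneg i) _) ?_ hlim
  filter_upwards [hbound, hx0.eventually (gt_mem_nhds one_pos)] with i hi hlt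
  calc ((N i : ℝ) * x i) ^ (m + 1) = (N i : ℝ) ^ (m + 1) * x i ^ (m + 1) := mul_pow _ _ _
    _ ≤ (N i : ℝ) ^ (m + 1) * (C * ρ ^ N i) := by
        gcongr
        exact (pow_le_pow_of_le_one (hx i) hlt.le m.le_succ).trans hi
    _ = C * ((N i : ℝ) ^ (m + 1) * ρ ^ N i) := by ring

theorem pow_le_rpow_inv_pow {q K : ℝ} (hq : 0 < q) (hq1 : q ≤ 1) (hK : 0 < K) {N k : ℕ}
    (h : (N : ℝ) ≤ K * k) : q ^ k ≤ (q ^ K⁻¹) ^ N := by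
  rw [← Real.rpow_natCast, ← Real.rpow_natCast, ← Real.rpow_mul hq.le]
  exact Real.rpow_le_rpow_of_exponent_ge hq hq1 ((inv_mul_le_iff₀ hK).2 h)

theorem tendsto_mul_zero_of_pow_le_add {x : ι → ℝ} {a b : ι → ℕ} {m : ℕ} {K C C' q q' : ℝ}
    (hx : ∀ i, 0 ≤ x i) (hx0 : Tendsto x L (𝓝 0)) (ha : Tendsto a L atTop) (hK : 0 < K)
    (hab : ∀ i, (a i : ℝ) ≤ K * b i) (hC : 0 < C) (hC' : 0 < C') (hq : 0 < q) (hq1 : q < 1)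
    (hq' : 0 < q') (hq1' : q' < 1) (hbound : ∀ᶠ i in L, x i ^ m ≤ C * q ^ a i + C' * q' ^ b i) :
    Tendsto (fun i => (a i : ℝ) * x i) L (𝓝 0) := by
  have hroot : 0 < q' ^ K⁻¹ := Real.rpow_pos_of_pos hq' _
  refine tendsto_mul_zero_of_pow_le_geometric (m := m) (C := C + C') (ρ := max q (q' ^ K⁻¹)) hx hx0
    ha (hq.le.trans (le_max_left _ _))
    (max_lt hq1 (Real.rpow_lt_one hq'.le hq1' (inv_pos.2 hK))) (hbound.mono fun i hi => ?_)
  calc x i ^ m ≤ C * q ^ a i + C' * q' ^ b i := hi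
    _ ≤ C * q ^ a i + C' * (q' ^ K⁻¹) ^ a i := by
        gcongr
        exact pow_le_rpow_inv_pow hq' hq1'.le hK (hab i)
    _ ≤ C * max q (q' ^ K⁻¹) ^ a i + C' * max q (q' ^ K⁻¹) ^ a i := by
        gcongr
        exacts [le_max_left _ _, le_max_right _ _]
    _ = (C + C') * max q (q' ^ K⁻¹) ^ a i := by ring

theorem div_eq_rpow_of_mul_rpow_eq {β s s' A A' : ℝ} (hβ : β ≠ 0) (hs : 0 < s) (hs' : 0 < s')
    (hA : 0 < A) (h : A * s' ^ β = A' * s ^ β) : s' / s = (A' / A) ^ (1 / β) := by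
  have hpow : (s' / s) ^ β = A' / A := by
    rw [Real.div_rpow hs'.le hs.le,
      div_eq_div_iff (Real.rpow_pos_of_pos hs β).ne' hA.ne', mul_comm, h]
  rw [← hpow, ← Real.rpow_mul (div_pos hs' hs).le, mul_one_div_cancel hβ, Real.rpow_one]

theorem tendsto_div_rpow_normalized {m P P' x y : ι → ℝ} {a b : ι → ℕ} {m₀ A A' x₀ y₀ β : ℝ}
    (hm : Tendsto m L (𝓝 m₀)) (hm₀ : m₀ ≠ 0) (hP : Tendsto P L (𝓝 A)) (hA : 0 < A)
    (hP' : Tendsto P' L (𝓝 A')) (hA' : 0 < A') (hx : ∀ i, 0 < x i) (hx₀ : 0 < x₀)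
    (hy : ∀ i, 0 < y i) (hy₀ : 0 < y₀) (hpow : Tendsto (fun i => (x i / x₀) ^ a i) L (𝓝 1))
    (hpow' : Tendsto (fun i => (y i / y₀) ^ b i) L (𝓝 1)) :
    Tendsto (fun i => m i * (P' i * y i ^ b i / (P i * x i ^ a i)) ^ β *
      (m₀ * (A' / A * (y₀ ^ b i / x₀ ^ a i)) ^ β)⁻¹) L (𝓝 1) := by
  have hfactor := ((hP'.div hP hA.ne').div_const (A' / A)).mul (hpow'.div hpow one_ne_zero)
  have hlim := (hm.div_const m₀).mul (hfactor.rpow_const (p := β) (Or.inl (by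
    rw [div_self (div_pos hA' hA).ne', div_one, mul_one]
    exact one_ne_zero)))
  rw [div_self (div_pos hA' hA).ne', div_self hm₀, div_one, mul_one, Real.one_rpow, mul_one] at hlim
  refine hlim.congr' ?_
  filter_upwards [hP.eventually (lt_mem_nhds hA), hP'.eventually (lt_mem_nhds hA')] with i hi hi'
  have hxi := hx i
  have hyi := hy i
  have hquot : P' i / P i / (A' / A) * ((y i / y₀) ^ b i / (x i / x₀) ^ a i)
      = P' i * y i ^ b i / (P i * x i ^ a i) / (A' / A * (y₀ ^ b i / x₀ ^ a i)) := by
    rw [div_pow, div_pow]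
    field_simp
  simp only [Pi.div_apply]
  rw [hquot, Real.div_rpow (by positivity) (by positivity), mul_inv]
  ring

end Powers

/-! ### Full renormalizations -/

theorem sub_one_div_two_mul_le {α : ℝ} (hα : 1 < α) : (α - 1) / (2 * α) ≤ 1 / 2 := by
  rw [div_le_div_iff₀ (by linarith) two_pos]
  linarith

theorem Branch.IsTame.one_lt_slope_one {α δ : ℝ} {B : Branch} (hB : B.IsTame) (hα : 1 < α)
    (hv : B.v = 1) (hδ : δ ≤ (α - 1) / (2 * α)) (hψ : |B.ψ 1 - 1| ≤ δ) : 1 < B.slope α 1 := by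
  have hα0 : 0 < α := one_pos.trans hα
  have hψ1 : 1 - (α - 1) / (2 * α) ≤ B.ψ 1 := by linarith [(abs_le.1 hψ).1]
  calc 1 < (1 - (α - 1) / (2 * α)) * α := by
        field_simp
        linarith
    _ ≤ B.ψ 1 * (α / (1 - B.c)) := by
        refine mul_le_mul hψ1 ?_ hα0.le (hB.ψ_pos (right_mem_Icc.2 zero_le_one)).le
        exact le_div_self hα0.le (sub_pos.2 hB.c_lt_one) (sub_le_self 1 hB.c_pos.le)
    _ = B.slope α 1 := by rw [hB.slope_one, hv, one_mul]

theorem Branch.IsTame.slope_one_pos {α : ℝ} {B : Branch} (hB : B.IsTame) (hα : 1 < α)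
    (hv : 0 < B.v) : 0 < B.slope α 1 := by
  rw [hB.slope_one]
  exact mul_pos (hB.ψ_pos (right_mem_Icc.2 zero_le_one))
    (mul_pos hv (div_pos (one_pos.trans hα) (sub_pos.2 hB.c_lt_one)))

theorem LorenzMap.IsReturnMap.crit_div_one_sub {α l r : ℝ} {f g : LorenzMap α}
    (h : f.IsReturnMap l r g) :
    g.c / (1 - g.c)
      = f.c / (1 - f.c) * (f.leftBranch.coord (1 - l) / f.rightBranch.coord r) := by
  have hc := f.c_mem.1.ne'
  have hc1 := (sub_pos.2 f.c_mem.2).ne'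
  have hr := (sub_pos.2 h.lt_r).ne'
  have hlr := (sub_pos.2 (h.l_lt.trans h.lt_r)).ne'
  have hright : f.rightBranch.coord r = (r - f.c) / (1 - f.c) := rfl
  have hcompl : 1 - (f.c - l) / (r - l) = (r - f.c) / (r - l) := by
    rw [one_sub_div hlr, sub_sub_sub_cancel_right]
  rw [coord_leftBranch, hright, h.crit, hcompl]
  field_simp

/-- A full map which expands at both fixed points, together with backward orbits of its two branches
(the left one reflected). -/
structure LorenzMap.IsExpandingFull {α : ℝ} (f : LorenzMap α) (o o' : ℕ → ℝ) : Prop where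
  isFull : f.IsFull
  isBackwardOrbit_right : f.rightBranch.IsBackwardOrbit α o
  isBackwardOrbit_left : f.leftBranch.IsBackwardOrbit α o'
  one_lt_right : 1 < f.rightBranch.slope α 1
  one_lt_left : 1 < f.leftBranch.slope α 1

theorem LorenzMap.IsFull.exists_isExpandingFull {α δ : ℝ} {f : LorenzMap α} (hf : f.IsFull)
    (hfix : f.OnlyFixesEndpoints) (hα : 1 < α) (hδ : δ ≤ (α - 1) / (2 * α))
    (hclose : f.CloseToStandard δ) : ∃ o o', f.IsExpandingFull o o' := by
  have hδ2 : δ ≤ 1 / 2 := hδ.trans (sub_one_div_two_mul_le hα)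
  have hR := hclose.isTame_rightBranch hδ2
  have hL := hclose.isTame_leftBranch hδ2
  have hv := Branch.v_eq_one_of_map_c hR hα (isFull_iff.1 hf).1
  have hu := Branch.v_eq_one_of_map_c hL hα (isFull_iff.1 hf).2
  obtain ⟨o, ho⟩ := hR.exists_isBackwardOrbit hα hv hfix.map_rightBranch_ne
  obtain ⟨o', ho'⟩ := hL.exists_isBackwardOrbit hα hu hfix.map_leftBranch_ne
  refine ⟨o, o', hf, ho, ho', hR.one_lt_slope_one hα hv hδ ?_, hL.one_lt_slope_one hα hu hδ ?_⟩
  · exact (hclose f.φp (by simp) 1 (by norm_num)).2.1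
  · exact (hclose f.φm (by simp) (1 - 1) (by norm_num)).2.1

/-- Maps `F (t i)` with monotone return maps `g i` to `[l i, r i]` which are full, and with return
times tending to infinity. The return intervals are not required to be maximal. -/
structure FullRenormalizations {α : ℝ} (U : Set (ℝ × ℝ)) (F : ℝ × ℝ → LorenzMap α) {ι : Type*}
    (Λ : Filter ι) (t : ι → ℝ × ℝ) (l r : ι → ℝ) (g : ι → LorenzMap α) (a b : ι → ℕ) : Prop where
  mem : ∀ i, t i ∈ U
  isReturnMap : ∀ i, (F (t i)).IsReturnMap (l i) (r i) (g i)
  isMonotoneType : ∀ i, (F (t i)).IsMonotoneType (l i) (r i) (a i) (b i)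
  isFull : ∀ i, (g i).IsFull
  time_left : Tendsto a Λ atTop
  time_right : Tendsto b Λ atTop

namespace FullRenormalizations

variable {α : ℝ} {U : Set (ℝ × ℝ)} {F : ℝ × ℝ → LorenzMap α} {p s : ℝ × ℝ} {ι : Type*}
  {Λ : Filter ι} {t : ι → ℝ × ℝ} {l r : ι → ℝ} {g : ι → LorenzMap α} {a b : ι → ℕ} {o o' : ℕ → ℝ}

theorem mono (h : FullRenormalizations U F Λ t l r g a b) {Λ' : Filter ι} (hΛ : Λ' ≤ Λ) :
    FullRenormalizations U F Λ' t l r g a b :=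
  { h with time_left := h.time_left.mono_left hΛ, time_right := h.time_right.mono_left hΛ }

theorem linkedTendsTo_rightBranch (h : FullRenormalizations U F Λ t l r g a b)
    (hF : IsTameFamily U F) (hα : 1 < α) (ht : Tendsto t Λ (𝓝 s)) (hs : s ∈ U) :
    Branch.LinkedTendsTo α Λ (fun i => (F (t i)).rightBranch) (fun i => (F (t i)).leftBranch)
      (F s).rightBranch (F s).leftBranch r (fun i => 1 - l i) a where
  fst := hF.tendsTo_rightBranch ht h.mem hs
  snd := hF.tendsTo_leftBranch ht h.mem hs
  linked i := (h.isReturnMap i).isLinked_rightBranch (h.isMonotoneType i) (h.isFull i).1 hα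
    (hF.isTame_rightBranch _ (h.mem i)) (hF.isTame_leftBranch _ (h.mem i))
  time := h.time_left

theorem linkedTendsTo_leftBranch (h : FullRenormalizations U F Λ t l r g a b)
    (hF : IsTameFamily U F) (hα : 1 < α) (ht : Tendsto t Λ (𝓝 s)) (hs : s ∈ U) :
    Branch.LinkedTendsTo α Λ (fun i => (F (t i)).leftBranch) (fun i => (F (t i)).rightBranch)
      (F s).leftBranch (F s).rightBranch (fun i => 1 - l i) r b where
  fst := hF.tendsTo_leftBranch ht h.mem hs
  snd := hF.tendsTo_rightBranch ht h.mem hs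
  linked i := (h.isReturnMap i).isLinked_leftBranch (h.isMonotoneType i) (h.isFull i).2 hα
    (hF.isTame_rightBranch _ (h.mem i)) (hF.isTame_leftBranch _ (h.mem i))
  time := h.time_right

theorem tendsto_parameter (h : FullRenormalizations U F Λ t l r g a b) (hF : IsTameFamily U F)
    (hα : 1 < α) (hU : IsCompact U) (hp : IsUniqueFull U F p) : Tendsto t Λ (𝓝 p) := by
  refine hU.tendsto_nhds_of_unique_mapClusterPt (Eventually.of_forall h.mem) fun s hs hcluster => ?_
  obtain ⟨G, hG, ht⟩ := mapClusterPt_iff_ultrafilter.1 hcluster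
  have hle := LorenzMap.map_c_le (hF.nontrivial s hs)
  exact hp.2.2 s hs (LorenzMap.isFull_iff.2
    (((h.mono hG).linkedTendsTo_rightBranch hF hα ht hs).map_c_eq_zero_and
      ((h.mono hG).linkedTendsTo_leftBranch hF hα ht hs) hα hle.1 hle.2
      (hF.fixes s hs).map_rightBranch_ne (hF.fixes s hs).map_leftBranch_ne))

theorem linkedTendsToFull (h : FullRenormalizations U F Λ t l r g a b) (hF : IsTameFamily U F)
    (hα : 1 < α) (ht : Tendsto t Λ (𝓝 p)) (hp : p ∈ U) (hfull : (F p).IsFull) :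
    Branch.LinkedTendsToFull α Λ (fun i => (F (t i)).rightBranch) (fun i => (F (t i)).leftBranch)
      (F p).rightBranch (F p).leftBranch r (fun i => 1 - l i) a b where
  link := h.linkedTendsTo_rightBranch hF hα ht hp
  link' := h.linkedTendsTo_leftBranch hF hα ht hp
  time_pos i := (h.isMonotoneType i).1
  time_pos' i := (h.isMonotoneType i).2.1
  map_ne i := (hF.fixes _ (h.mem i)).map_rightBranch_ne
  map_ne' i := (hF.fixes _ (h.mem i)).map_leftBranch_ne
  v_eq_one := Branch.v_eq_one_of_map_c (hF.isTame_rightBranch p hp) hα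
    (LorenzMap.isFull_iff.1 hfull).1
  v_eq_one' := Branch.v_eq_one_of_map_c (hF.isTame_leftBranch p hp) hα
    (LorenzMap.isFull_iff.1 hfull).2
  limit_map_ne := (hF.fixes p hp).map_rightBranch_ne
  limit_map_ne' := (hF.fixes p hp).map_leftBranch_ne

theorem exists_norm_pow_le [Λ.NeBot] (h : FullRenormalizations U F Λ t l r g a b)
    (hF : IsTameFamily U F) (hα : 1 < α) (ht : Tendsto t Λ (𝓝 p)) (hp : p ∈ U)
    (hexp : (F p).IsExpandingFull o o') (huniq : IsAnalyticallyUniqueFull U F p) :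
    ∃ (m : ℕ) (C C' q q' : ℝ), 0 < C ∧ 0 < C' ∧ 0 < q ∧ q < 1 ∧ 0 < q' ∧ q' < 1 ∧
      ∀ᶠ i in Λ, ‖t i - p‖ ^ m ≤ C * q ^ a i + C' * q' ^ b i := by
  have hlink := h.linkedTendsToFull hF hα ht hp hexp.isFull
  obtain ⟨C, q, hC, hq0, hq1, hu⟩ :=
    hlink.exists_one_sub_v_le hα hexp.isBackwardOrbit_right hexp.one_lt_right
  obtain ⟨C', q', hC', hq0', hq1', hv⟩ :=
    hlink.symm.exists_one_sub_v_le hα hexp.isBackwardOrbit_left hexp.one_lt_left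
  obtain ⟨m, hm⟩ := huniq.exists_norm_pow_le
  refine ⟨m, C, C', q, q', hC, hC', hq0, hq1, hq0', hq1', ?_⟩
  filter_upwards [ht.eventually hm, hu, hv] with i hi hui hvi
  exact (hi (h.mem i)).trans (add_le_add hui hvi)

theorem tendsto_slope_pow [Λ.NeBot] (h : FullRenormalizations U F Λ t l r g a b)
    (hF : IsTameFamily U F) (hα : 1 < α) (ht : Tendsto t Λ (𝓝 p)) (hp : p ∈ U)
    (hexp : (F p).IsExpandingFull o o') (huniq : IsAnalyticallyUniqueFull U F p) {K K' : ℝ}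
    (hK : 0 < K) (hab : ∀ i, (a i : ℝ) ≤ K * b i) (hK' : 0 < K')
    (hba : ∀ i, (b i : ℝ) ≤ K' * a i) :
    Tendsto (fun i => ((F (t i)).rightBranch.slope α 1 / (F p).rightBranch.slope α 1) ^ a i) Λ
        (𝓝 1) ∧
      Tendsto (fun i => ((F (t i)).leftBranch.slope α 1 / (F p).leftBranch.slope α 1) ^ b i) Λ
        (𝓝 1) := by
  obtain ⟨m, C, C', q, q', hC, hC', hq0, hq1, hq0', hq1', hbound⟩ :=
    h.exists_norm_pow_le hF hα ht hp hexp huniq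
  have hnorm : Tendsto (fun i => ‖t i - p‖) Λ (𝓝 0) := tendsto_iff_norm_sub_tendsto_zero.1 ht
  have hnonneg : ∀ i, 0 ≤ ‖t i - p‖ := fun i => norm_nonneg _
  have hR := hF.analyticParam_slope_rightBranch
  have hL := hF.analyticParam_slope_leftBranch
  constructor
  · exact tendsto_div_pow_one (one_pos.trans hexp.one_lt_right).ne' (hR.tendsto ht h.mem hp)
      (hR.isBigO_sub ht h.mem hp) (tendsto_mul_zero_of_pow_le_add hnonneg hnorm h.time_left hK hab
        hC hC' hq0 hq1 hq0' hq1' hbound)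
  · simp only [add_comm (C * _)] at hbound
    exact tendsto_div_pow_one (one_pos.trans hexp.one_lt_left).ne' (hL.tendsto ht h.mem hp)
      (hL.isBigO_sub ht h.mem hp) (tendsto_mul_zero_of_pow_le_add hnonneg hnorm h.time_right hK' hba
        hC' hC hq0' hq1' hq0 hq1 hbound)

/- Both expressions for the length of the return interval, one from each side of the critical point,
agree; solving for the ratio of the two sides gives the critical point of the renormalization. -/
theorem exists_crit_div_one_sub_eq [Λ.NeBot] (h : FullRenormalizations U F Λ t l r g a b)
    (hF : IsTameFamily U F) (hα : 1 < α) (ht : Tendsto t Λ (𝓝 p)) (hp : p ∈ U)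
    (hexp : (F p).IsExpandingFull o o') :
    ∃ P P' : ι → ℝ,
      Tendsto P Λ (𝓝 ((F p).rightBranch.returnFactor α (F p).leftBranch o)) ∧
      Tendsto P' Λ (𝓝 ((F p).leftBranch.returnFactor α (F p).rightBranch o')) ∧
      ∀ᶠ i in Λ, (g i).c / (1 - (g i).c) = (F (t i)).c / (1 - (F (t i)).c) *
        (P' i * (F (t i)).leftBranch.slope α 1 ^ b i /
          (P i * (F (t i)).rightBranch.slope α 1 ^ a i)) ^ (1 / α) := by
  have hlink := h.linkedTendsToFull hF hα ht hp hexp.isFull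
  obtain ⟨P, hP, heqP⟩ :=
    hlink.exists_tendsto_returnFactor hα hexp.isBackwardOrbit_right hexp.one_lt_right
  obtain ⟨P', hP', heqP'⟩ :=
    hlink.symm.exists_tendsto_returnFactor hα hexp.isBackwardOrbit_left hexp.one_lt_left
  refine ⟨P, P', hP, hP', ?_⟩
  have hpos : 0 < (F p).rightBranch.returnFactor α (F p).leftBranch o :=
    Branch.returnFactor_pos (hF.isTame_leftBranch p hp) hlink.v_eq_one' o
  filter_upwards [hP.eventually (lt_mem_nhds hpos)] with i hPi
  have hslope := (hF.isTame_rightBranch _ (h.mem i)).slope_one_pos hα (hlink.v_pos hα i)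
  have hsides : (F (t i)).leftBranch.coord (1 - l i) / (F (t i)).rightBranch.coord (r i) =
      (P' i * (F (t i)).leftBranch.slope α 1 ^ b i /
        (P i * (F (t i)).rightBranch.slope α 1 ^ a i)) ^ (1 / α) :=
    div_eq_rpow_of_mul_rpow_eq (one_pos.trans hα).ne'
      ((hF.isTame_rightBranch _ (h.mem i)).coord_pos (h.isReturnMap i).lt_r)
      ((hF.isTame_leftBranch _ (h.mem i)).coord_pos (hlink.link.linked i).c_lt')
      (mul_pos hPi (pow_pos hslope (a i))) (by linear_combination heqP' i - heqP i)
  rw [(h.isReturnMap i).crit_div_one_sub, hsides]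

theorem tendsto_crit_div_one_sub [Λ.NeBot] (h : FullRenormalizations U F Λ t l r g a b)
    (hF : IsTameFamily U F) (hα : 1 < α) (ht : Tendsto t Λ (𝓝 p)) (hp : p ∈ U)
    (hexp : (F p).IsExpandingFull o o') (huniq : IsAnalyticallyUniqueFull U F p) {K K' : ℝ}
    (hK : 0 < K) (hab : ∀ i, (a i : ℝ) ≤ K * b i) (hK' : 0 < K')
    (hba : ∀ i, (b i : ℝ) ≤ K' * a i) :
    Tendsto (fun i => (g i).c / (1 - (g i).c) * ((F p).c / (1 - (F p).c) *
      ((F p).leftBranch.returnFactor α (F p).rightBranch o' /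
          (F p).rightBranch.returnFactor α (F p).leftBranch o *
        ((F p).leftBranch.slope α 1 ^ b i / (F p).rightBranch.slope α 1 ^ a i)) ^ (1 / α))⁻¹) Λ
      (𝓝 1) := by
  have hlink := h.linkedTendsToFull hF hα ht hp hexp.isFull
  obtain ⟨P, P', hP, hP', hratio⟩ := h.exists_crit_div_one_sub_eq hF hα ht hp hexp
  obtain ⟨hpow, hpow'⟩ := h.tendsto_slope_pow hF hα ht hp hexp huniq hK hab hK' hba
  have hc := hF.analytic.c.tendsto ht h.mem hp
  have hc1 : 0 < 1 - (F p).c := sub_pos.2 (F p).c_mem.2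
  refine (tendsto_div_rpow_normalized (β := 1 / α) (hc.div (hc.const_sub 1) hc1.ne')
    (div_pos (F p).c_mem.1 hc1).ne' hP
    (Branch.returnFactor_pos (hF.isTame_leftBranch p hp) hlink.v_eq_one' o) hP'
    (Branch.returnFactor_pos (hF.isTame_rightBranch p hp) hlink.v_eq_one o')
    (fun i => (hF.isTame_rightBranch _ (h.mem i)).slope_one_pos hα (hlink.v_pos hα i))
    (one_pos.trans hexp.one_lt_right)
    (fun i => (hF.isTame_leftBranch _ (h.mem i)).slope_one_pos hα (hlink.symm.v_pos hα i))
    (one_pos.trans hexp.one_lt_left) hpow hpow').congr' (hratio.mono fun i hi => ?_)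
  simp only [hi, Pi.div_apply]

end FullRenormalizations

theorem IsTameFamily.of_closeToStandard {α δ : ℝ} {U : Set (ℝ × ℝ)} {F : ℝ × ℝ → LorenzMap α}
    (hA : IsAnalyticFamily U F) (hfix : ∀ t ∈ U, (F t).OnlyFixesEndpoints)
    (hnon : ∀ t ∈ U, (F t).Nontrivial ∨ (F t).HasTrivialBranch) (hδ : δ ≤ 1 / 2)
    (hclose : ∀ t ∈ U, (F t).CloseToStandard δ) : IsTameFamily U F where
  analytic := hA
  isTame_rightBranch t ht := (hclose t ht).isTame_rightBranch hδ
  isTame_leftBranch t ht := (hclose t ht).isTame_leftBranch hδ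
  fixes := hfix
  nontrivial := hnon

theorem mainTheorem3_general {α δ : ℝ} (hα : 1 < α) (hδ : δ ≤ (α - 1) / (2 * α))
    {U : Set (ℝ × ℝ)} {F : ℝ × ℝ → LorenzMap α} {p : ℝ × ℝ} (hU : IsCompact U)
    (hfix : ∀ t ∈ U, (F t).OnlyFixesEndpoints)
    (hnon : ∀ t ∈ U, (F t).Nontrivial ∨ (F t).HasTrivialBranch) (hA : IsAnalyticFamily U F)
    (hclose : ∀ t ∈ U, (F t).CloseToStandard δ) (hp : IsUniqueFull U F p)
    (huniq : IsAnalyticallyUniqueFull U F p) :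
    ∃ γ : ℝ, 0 < γ ∧ ∀ ε : ℝ, 0 < ε → ∀ K : ℝ, 0 < K → ∃ N : ℕ, 1 ≤ N ∧
      ∀ a b : ℕ, N ≤ a → N ≤ b →
        1 / K ≤ (a : ℝ) / (b : ℝ) → (a : ℝ) / (b : ℝ) ≤ K →
        ∀ (t : ℝ × ℝ) (l r : ℝ) (g : LorenzMap α), t ∈ U → (F t).IsReturnMap l r g →
          (F t).IsMonotoneType l r a b → g.IsFull →
          1 - ε ≤ g.c / (1 - g.c) *
              ((F p).c / (1 - (F p).c) *
                (γ * (derivWithin (F p).toFun (Icc 0 1) 0 ^ b /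
                      derivWithin (F p).toFun (Icc 0 1) 1 ^ a)) ^ (1 / α))⁻¹ ∧
          g.c / (1 - g.c) *
              ((F p).c / (1 - (F p).c) *
                (γ * (derivWithin (F p).toFun (Icc 0 1) 0 ^ b /
                      derivWithin (F p).toFun (Icc 0 1) 1 ^ a)) ^ (1 / α))⁻¹
            ≤ 1 + ε := by
  have hF : IsTameFamily U F :=
    .of_closeToStandard hA hfix hnon (hδ.trans (sub_one_div_two_mul_le hα)) hclose
  have hR := hF.isTame_rightBranch p hp.1
  have hL := hF.isTame_leftBranch p hp.1
  obtain ⟨o, o', hexp⟩ := hp.2.1.exists_isExpandingFull (hfix p hp.1) hα hδ (hclose p hp.1)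
  have hfull := LorenzMap.isFull_iff.1 hexp.isFull
  refine ⟨(F p).leftBranch.returnFactor α (F p).rightBranch o' /
      (F p).rightBranch.returnFactor α (F p).leftBranch o,
    div_pos (Branch.returnFactor_pos hR (Branch.v_eq_one_of_map_c hR hα hfull.1) o')
      (Branch.returnFactor_pos hL (Branch.v_eq_one_of_map_c hL hα hfull.2) o),
    fun ε hε K hK => ?_⟩
  rw [LorenzMap.derivWithin_toFun_zero hL hα, LorenzMap.derivWithin_toFun_one hR hα]
  by_contra! hcon
  choose a b ha hb hKab habK t l r g ht hret htype hgfull hbad using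
    fun n : ℕ => hcon (n + 1) (Nat.le_add_left 1 n)
  have h : FullRenormalizations U F atTop t l r g a b :=
    ⟨ht, hret, htype, hgfull,
      tendsto_atTop_mono (fun n => (Nat.le_succ n).trans (ha n)) tendsto_id,
      tendsto_atTop_mono (fun n => (Nat.le_succ n).trans (hb n)) tendsto_id⟩
  have hbpos : ∀ n, (0 : ℝ) < b n := fun n => Nat.cast_pos.2 ((Nat.succ_pos n).trans_le (hb n))
  have hba : ∀ n, (b n : ℝ) ≤ K * a n := fun n => by
    simpa only [one_mul, mul_comm K] using (div_le_div_iff₀ hK (hbpos n)).1 (hKab n)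
  have hlim := h.tendsto_crit_div_one_sub hF hα (h.tendsto_parameter hF hα hU hp) hp.1 hexp huniq
    hK (fun n => (div_le_iff₀ (hbpos n)).1 (habK n)) hK hba
  obtain ⟨n, hlower, hupper⟩ := ((hlim.eventually_const_le (sub_lt_self 1 hε)).and
    (hlim.eventually_le_const (lt_add_of_pos_right 1 hε))).exists
  exact (hbad n hlower).not_ge hupper

theorem mainTheorem3 (α : ℝ) (hα : 1 < α) :
    ∃ δ : ℝ, 0 < δ ∧
      ∀ (U : Set (ℝ × ℝ)) (F : ℝ × ℝ → LorenzMap α) (p : ℝ × ℝ),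
        IsLorenzFamily U F → IsAnalyticFamily U F →
        (∀ t ∈ U, (F t).CloseToStandard δ) →
        IsUniqueFull U F p → IsAnalyticallyUniqueFull U F p →
        ∃ γ : ℝ, 0 < γ ∧ ∀ ε : ℝ, 0 < ε → ∀ K : ℝ, 0 < K → ∃ N : ℕ, 1 ≤ N ∧
          ∀ a b : ℕ, N ≤ a → N ≤ b →
            1 / K ≤ (a : ℝ) / (b : ℝ) → (a : ℝ) / (b : ℝ) ≤ K →
            ∀ (D : Set (ℝ × ℝ)) (t : ℝ × ℝ) (g : LorenzMap α),
              IsIsland U F a b D → IsFullVertex U F a b D t g →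
              1 - ε ≤ g.c / (1 - g.c) *
                  ((F p).c / (1 - (F p).c) *
                    (γ * (derivWithin (F p).toFun (Set.Icc 0 1) 0 ^ b /
                          derivWithin (F p).toFun (Set.Icc 0 1) 1 ^ a)) ^ (1 / α))⁻¹ ∧
              g.c / (1 - g.c) *
                  ((F p).c / (1 - (F p).c) *
                    (γ * (derivWithin (F p).toFun (Set.Icc 0 1) 0 ^ b /
                          derivWithin (F p).toFun (Set.Icc 0 1) 1 ^ a)) ^ (1 / α))⁻¹
                ≤ 1 + ε := by
  refine ⟨(α - 1) / (2 * α), div_pos (by linarith) (by linarith), ?_⟩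
  intro U F p hF hA hclose hp huniq
  obtain ⟨γ, hγ, hbound⟩ := mainTheorem3_general hα le_rfl hF.compact hF.fixes
    (fun t ht => (hF.nontrivial t ht).imp_right And.right) hA hclose hp huniq
  refine ⟨γ, hγ, fun ε hε K hK => (hbound ε hε K hK).imp fun N hN => ⟨hN.1, ?_⟩⟩
  rintro a b ha hb hKab habK D t g - ⟨-, ht, ⟨l, r, ⟨hret, -⟩, htype⟩, hfull⟩
  exact hN.2 a b ha hb hKab habK t l r g ht hret htype hfull
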